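/- **Setting.** For a $d$-dimensional lattice simplex $P\subset\mathbb R^d$ with vertices $v_0,\dots,v_d\in\mathbb Z^d$, let $Y_P\subset(\mathbb R^d)^*$ be the codimension one skeleton of its normal fan, i.e. the set of linear forms whose minimum on $P$ is attained at two or more vertices. Let $P\subset\mathbb R^a$ and $Q\subset(\mathbb R^b)^*$ be lattice simplices of dimensions $a$ and $b$. The *symple model* of $(P,Q)$ is the pair $\big((\mathbb R^a)^*\times\mathbb R^b,\;Y_P\times Y_Q\big)$ together with the local system $\Lambda$ with stalk $\mathbb Z^a\oplus\mathbb Z^b$ on the complement of $Y_P\times Y_Q$ whose monodromy along a simple loop around the maximal stratum dual to an edge $vv'$ of $P$ and an edge $ww'$ of $Q$ is $u\mapsto u+\langle u,w'-w\rangle\,(v'-v)$, where $v'-v\in\mathbb Z^a$ and $w'-w\in(\mathbb Z^b)^*$. (Explicitly, $\Lambda$ has a frame on $U_v=\{(x,y): x \text{ lies in the open cone dual to } v, \text{ or } y\notin Y_Q\}$ for each vertex $v$ of $P$. For $v\ne v'$ the coordinate change from $U_v$ to $U_{v'}$ over the set where $y$ lies in the open cone dual to the vertex $w$ of $Q$ is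 $u\mapsto u-\langle u,w\rangle(v'-v)$.) An integral affine $n$-manifold with singularities $(B,\Delta)$, possibly with boundary, is given by a Hausdorff space $B$, a closed subset $\Delta$ with dense complement, and an atlas on $B\setminus\Delta$ with values in $\mathbb R^n$ and transition maps in $\mathrm{GL}_n(\mathbb Z)\ltimes\mathbb R^n$. Let $\Lambda$ be the local system of integral tangent vectors on $B\setminus\Delta$, $\Lambda_{\mathbb Q}=\Lambda\otimes_{\mathbb Z}\mathbb Q$, and $\iota\colon B\setminus\Delta\hookrightarrow B$ the inclusion. It is *symple* if every point of $B$ has an open neighbourhood with a *symple chart*: a homeomorphism onto an open subset of a product $\prod_{j=1}^r\big((\mathbb R^{a_j})^*\times\mathbb R^{b_j}\big)\times\mathbb R^c\times\mathbb R_{\ge0}^{c'}$ of symple models, for lattice simplices $P_j,Q_j$, and a trivial factor, which identifies $\Delta$ with the union of the inverse images of the sets $Y_{P_j}\times Y_{Q_j}$, and which identifies $\Lambda$ on the complement of $\Delta$ with the direct sum of the pullbacks of the local systems of the models and the constant local system $\mathbb Z^{c+c'}$. **Theorem.** Let $n\ge3$, let $(B,\Delta)$ be a symple integral affine $n$-manifold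 with singularities, and let $p\in B$. Then $$H^1(U\setminus\{p\},\iota_*\Lambda_{\mathbb Q})=0$$ for every small neighbourhood $U$ of $p$. Precisely: for every symple chart around $p$ and every sufficiently small $\varepsilon>0$, this holds for the neighbourhood $U$ of $p$ that corresponds in the chart to the open ball of radius $\varepsilon$ (in the maximum metric) around the image of $p$. In particular, every neighbourhood of $p$ contains an open neighbourhood $U$ of $p$ with this property. -/

import Mathlib

open TopologicalSpace Topology Matrix CategoryTheory Opposite

universe u v

/-! ### Local systems presented by local frames -/

/-- A local system of free modules of rank `κ` on `X`, given by frames `i` on the sets `dom i`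
and integral transition matrices: `Trans i j x A` says that, at the point `x`, a vector with
coordinates `u` in the frame `i` has coordinates `A *ᵥ u` in the frame `j`. -/
structure FrameSystem (κ : Type) [Fintype κ] (X : Type u) where
  Frame : Type v
  dom : Frame → Set X
  Trans : Frame → Frame → X → Matrix κ κ ℤ → Prop

namespace FrameSystem

variable {κ : Type} [Fintype κ] {X : Type u}

/-- The local system `f⁻¹ F`: its frames are the pulled back frames. -/
def pullback (F : FrameSystem.{u, v} κ X) {Z : Type*} (f : Z → X) : FrameSystem κ Z where
  Frame := F.Frame
  dom i := f ⁻¹' F.dom i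
  Trans i j z A := F.Trans i j (f z) A

variable [TopologicalSpace X]

/-- Sections over `V` of the local system with coefficients extended from `ℤ` to `R`: at each
point `x` of `V` and for each frame `i` around `x` a coordinate vector in `κ → R`, such that the
coordinates in a fixed frame are locally constant and the coordinates in different frames at the
same point are related by the transition matrices. -/
def sections (F : FrameSystem.{u, v} κ X) (R : Type) [CommRing R] (V : Opens X) :
    AddSubgroup (∀ x : V, {i : F.Frame // x.1 ∈ F.dom i} → κ → R) where
  carrier := {s |
    (∀ (x : V) (i : F.Frame) (hi : x.1 ∈ F.dom i),
      ∀ᶠ y in 𝓝 x, ∀ hy : y.1 ∈ F.dom i, s y ⟨i, hy⟩ = s x ⟨i, hi⟩) ∧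
    (∀ (x : V) (i j : F.Frame) (hi : x.1 ∈ F.dom i) (hj : x.1 ∈ F.dom j) (A : Matrix κ κ ℤ),
      F.Trans i j x.1 A → s x ⟨j, hj⟩ = A.map (Int.cast : ℤ → R) *ᵥ s x ⟨i, hi⟩)}
  zero_mem' := by
    refine ⟨fun x i hi => Filter.Eventually.of_forall fun y hy => rfl, ?_⟩
    intro x i j hi hj A _
    simp
  add_mem' := by
    rintro s t ⟨hs, hs'⟩ ⟨ht, ht'⟩
    refine ⟨fun x i hi => ?_, fun x i j hi hj A hA => ?_⟩
    · filter_upwards [hs x i hi, ht x i hi] with y h1 h2 hy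
      simp [h1 hy, h2 hy]
    · simp [hs' x i j hi hj A hA, ht' x i j hi hj A hA, Matrix.mulVec_add]
  neg_mem' := by
    rintro s ⟨hs, hs'⟩
    refine ⟨fun x i hi => ?_, fun x i j hi hj A hA => ?_⟩
    · filter_upwards [hs x i hi] with y h1 hy
      simp [h1 hy]
    · simp [hs' x i j hi hj A hA, Matrix.mulVec_neg]

/-- Restriction of sections. -/
def res (F : FrameSystem.{u, v} κ X) (R : Type) [CommRing R] {V W : Opens X} (h : W ≤ V) :
    F.sections R V →+ F.sections R W where
  toFun s := ⟨fun x => s.1 ⟨x.1, h x.2⟩, by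
    refine ⟨fun x i hi => ?_, fun x i j hi hj A hA =>
      s.2.2 ⟨x.1, h x.2⟩ i j hi hj A hA⟩
    have hc : Filter.Tendsto (fun y : W => (⟨y.1, h y.2⟩ : V)) (𝓝 x) (𝓝 ⟨x.1, h x.2⟩) :=
      (Continuous.subtype_mk continuous_subtype_val _).tendsto x
    exact hc.eventually (s.2.1 ⟨x.1, h x.2⟩ i hi)⟩
  map_zero' := rfl
  map_add' _ _ := rfl

/-- The sections as a presheaf of abelian groups. -/
def presheaf (F : FrameSystem.{u, u} κ X) (R : Type) [CommRing R] :
    TopCat.Presheaf AddCommGrpCat.{u} (TopCat.of X) where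
  obj V := AddCommGrpCat.of (F.sections R V.unop)
  map i := AddCommGrpCat.ofHom (F.res R i.unop.le)

/-- Being a section is a local condition. -/
def localPredicate (F : FrameSystem.{u, u} κ X) (R : Type) [CommRing R] :
    TopCat.LocalPredicate
      (fun x : TopCat.of X => {i : F.Frame // (x : X) ∈ F.dom i} → κ → R) where
  pred {V} s := s ∈ F.sections R V
  res {W V} i s hs := (F.res R i.le ⟨s, hs⟩).2
  locality {V} s h := by
    refine ⟨fun x i hi => ?_, fun x i j hi hj A hA => ?_⟩
    · obtain ⟨W, hxW, k, hW⟩ := h x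
      have h1 := hW.1 ⟨x.1, hxW⟩ i hi
      have ho : IsOpenEmbedding (fun y : W => (⟨y.1, k.le y.2⟩ : V)) :=
        Opens.isOpenEmbedding_of_le k.le
      have h2 := ho.map_nhds_eq ⟨x.1, hxW⟩
      have h3 : ∀ᶠ y in Filter.map (fun y : W => (⟨y.1, k.le y.2⟩ : V)) (𝓝 ⟨x.1, hxW⟩),
          ∀ hy : y.1 ∈ F.dom i, s y ⟨i, hy⟩ = s x ⟨i, hi⟩ := h1
      rwa [h2] at h3
    · obtain ⟨W, hxW, k, hW⟩ := h x
      exact hW.2 ⟨x.1, hxW⟩ i j hi hj A hA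

/-- The sheaf of abelian groups of sections of a local system, with coefficients in `R`. -/
def sheaf (F : FrameSystem.{u, u} κ X) (R : Type) [CommRing R] :
    TopCat.Sheaf AddCommGrpCat.{u} (TopCat.of X) :=
  ⟨F.presheaf R, by
    have h := TopCat.subpresheafToTypes.isSheaf (F.localPredicate R)
    exact (TopCat.Presheaf.isSheaf_iff_isSheaf_comp (CategoryTheory.forget AddCommGrpCat.{u})
      (F.presheaf R)).2 h⟩

/-- An isomorphism between two local systems of free abelian groups, that is, between their
sheaves of integral sections. -/
structure Iso {κ' : Type} [Fintype κ'] (F : FrameSystem κ X) (G : FrameSystem κ' X) where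
  equiv : ∀ V : Opens X, F.sections ℤ V ≃+ G.sections ℤ V
  naturality : ∀ {V W : Opens X} (h : W ≤ V) (s : F.sections ℤ V),
    equiv W (F.res ℤ h s) = G.res ℤ h (equiv V s)

end FrameSystem

/-! ### Integral affine manifolds with singularities -/

/-- A chart with values in `ℝⁿ`: an embedding of an open set, whose image is an open subset of
`ℝⁿ` or, at boundary points, is at least contained in the closure of its interior. -/
structure AffineChart (n : ℕ) (X : Type u) [TopologicalSpace X] where
  domain : Opens X
  toFun : X → Fin n → ℝ
  isEmbedding : IsEmbedding (fun x : domain => toFun x)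
  subset_closure_interior :
    toFun '' (domain : Set X) ⊆ closure (interior (toFun '' (domain : Set X)))

/-- Near `x`, the coordinate change from the chart `c` to the chart `d` is an element of
`GL_n(ℤ) ⋉ ℝⁿ` with linear part `A`. -/
def AffineChart.IsTransition {n : ℕ} {X : Type u} [TopologicalSpace X] (c d : AffineChart n X)
    (x : X) (A : Matrix (Fin n) (Fin n) ℤ) : Prop :=
  IsUnit A.det ∧
    ∃ b : Fin n → ℝ, ∀ᶠ y in 𝓝 x, d.toFun y = A.map (Int.cast : ℤ → ℝ) *ᵥ c.toFun y + b

/-- An atlas (for a manifold, possibly with boundary) with transition maps in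
`GL_n(ℤ) ⋉ ℝⁿ`. -/
structure IntegralAffineAtlas (n : ℕ) (X : Type u) [TopologicalSpace X] where
  charts : Set (AffineChart n X)
  cover : ∀ x : X, ∃ c ∈ charts, x ∈ c.domain
  compatible : ∀ c ∈ charts, ∀ d ∈ charts, ∀ x ∈ c.domain ⊓ d.domain,
    ∃ A : Matrix (Fin n) (Fin n) ℤ, c.IsTransition d x A

/-- The local system of flat tangent vectors of an integral affine manifold. The frames are the
coordinate frames of the charts. The sections over `ℤ` are the integral tangent vectors `Λ`, the
sections over `ℚ` are those of `Λ ⊗ ℚ`. -/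
def IntegralAffineAtlas.tangent {n : ℕ} {X : Type u} [TopologicalSpace X]
    (𝓐 : IntegralAffineAtlas n X) : FrameSystem.{u, u} (Fin n) X where
  Frame := 𝓐.charts
  dom c := (c.1.domain : Set X)
  Trans c d x A := c.1.IsTransition d.1 x A

/-- An integral affine structure with singularities on a space `B`: a closed discriminant with
dense complement, and an integral affine atlas on the complement. -/
structure IntegralAffineSing (n : ℕ) (B : Type u) [TopologicalSpace B] where
  disc : Set B
  isClosed_disc : IsClosed disc
  dense_compl : Dense discᶜ
  atlas : IntegralAffineAtlas n ↥discᶜ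

/-! ### Symple models -/

/-- A `d`-dimensional lattice simplex in `ℝᵈ`. -/
structure LatticeSimplex (d : ℕ) where
  vertex : Fin (d + 1) → Fin d → ℤ
  affineIndependent : AffineIndependent ℝ (fun i k => (vertex i k : ℝ))

namespace LatticeSimplex

variable {d : ℕ} (P : LatticeSimplex d)

/-- The pairing of a point of the dual space with a vertex. -/
def pair (x : Fin d → ℝ) (i : Fin (d + 1)) : ℝ := ∑ k, x k * (P.vertex i k : ℝ)

/-- The interior of the maximal cone of the normal fan that is dual to the vertex `i`. -/
def chamber (i : Fin (d + 1)) : Set (Fin d → ℝ) :=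
  {x | ∀ j, j ≠ i → P.pair x i < P.pair x j}

/-- The codimension one skeleton of the normal fan: the union of the cones dual to the faces of
positive dimension, that is, the points at which the minimum over the simplex is attained at
two or more vertices. -/
def skeleton : Set (Fin d → ℝ) :=
  {x | ∃ i j, i ≠ j ∧ P.pair x i = P.pair x j ∧ ∀ k, P.pair x i ≤ P.pair x k}

end LatticeSimplex

/-- The data for a product of `r` symple models and a trivial factor `ℝ^c × ℝ_{≥0}^{c'}`. -/
structure SympleModel where
  r : ℕ
  a : Fin r → ℕ
  b : Fin r → ℕ
  c : ℕ
  c' : ℕ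
  P : ∀ j, LatticeSimplex (a j)
  Q : ∀ j, LatticeSimplex (b j)

namespace SympleModel

variable (S : SympleModel)

/-- The space `∏ⱼ ((ℝ^{aⱼ})^* × ℝ^{bⱼ}) × ℝ^c × ℝ_{≥0}^{c'}`. -/
abbrev Space : Type :=
  (∀ j, (Fin (S.a j) → ℝ) × (Fin (S.b j) → ℝ)) × (Fin S.c → ℝ) × (Fin S.c' → NNReal)

/-- The union of the inverse images of the sets `Yⱼ × Y̌ⱼ`. -/
def disc : Set S.Space :=
  {z | ∃ j, (z.1 j).1 ∈ (S.P j).skeleton ∧ (z.1 j).2 ∈ (S.Q j).skeleton}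

/-- The coordinates of tangent vectors, with values in
`⨁ⱼ (ℤ^{aⱼ} ⊕ ℤ^{bⱼ}) ⊕ ℤ^c ⊕ ℤ^{c'}`. -/
abbrev Coord : Type := (Σ j, Fin (S.a j) ⊕ Fin (S.b j)) ⊕ (Fin S.c ⊕ Fin S.c')

/-- For vertices `vⱼ, v'ⱼ` of the simplices `Pⱼ` and vertices `wⱼ` of the simplices `Qⱼ`, the map
`(mⱼ, nⱼ)ⱼ ↦ (mⱼ - ⟨nⱼ, wⱼ⟩ • (v'ⱼ - vⱼ), nⱼ)ⱼ`, the identity on the trivial factor. -/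
def shear (v v' : ∀ j, Fin (S.a j + 1)) (w : ∀ j, Fin (S.b j + 1)) (t : S.Coord → ℤ) :
    S.Coord → ℤ
  | .inl ⟨j, .inl k⟩ => t (.inl ⟨j, .inl k⟩) -
      (∑ l, t (.inl ⟨j, .inr l⟩) * (S.Q j).vertex (w j) l) *
        ((S.P j).vertex (v' j) k - (S.P j).vertex (v j) k)
  | p => t p

/-- The local system of integral tangent vectors on the complement of the discriminant of a
product of symple models. For one factor `(P, Q)` there is, for every vertex `v` of `P`, a frame on
the contractible open set `U_v` of those `(x, y)` with `x` in the chamber of `v` or `y` not in the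
skeleton of `Q`. If `v ≠ v'`, then `U_v ∩ U_{v'}` is the set of `(x, y)` for which `y` lies in the
chamber of some vertex `w` of `Q`, and there the frames are related by
`(m, n) ↦ (m - ⟨n, w⟩ • (v' - v), n)`. So the monodromy along a simple loop around the maximal
stratum dual to an edge `v v'` of `P` and an edge `w w'` of `Q`, going from `U_v` to `U_{v'}`
through the chamber of `w` and back through the chamber of `w'`, is
`(m, n) ↦ (m + ⟨n, w' - w⟩ • (v' - v), n)`; see `SympleModel.shear_shear`. -/
def tangent : FrameSystem.{0, 0} S.Coord S.Space where
  Frame := ∀ j, Fin (S.a j + 1)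
  dom v := {z | ∀ j, (z.1 j).1 ∈ (S.P j).chamber (v j) ∨ (z.1 j).2 ∉ (S.Q j).skeleton}
  Trans v v' z A := ∃ w : ∀ j, Fin (S.b j + 1),
    (∀ j, v j ≠ v' j → (z.1 j).2 ∈ (S.Q j).chamber (w j)) ∧ ∀ t, A *ᵥ t = S.shear v v' w t

/-- The monodromy formula for the frames of `SympleModel.tangent`. -/
theorem shear_shear (v v' : ∀ j, Fin (S.a j + 1)) (w w' : ∀ j, Fin (S.b j + 1))
    (t : S.Coord → ℤ) (j : Fin S.r) (k : Fin (S.a j)) :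
    S.shear v' v w' (S.shear v v' w t) (.inl ⟨j, .inl k⟩) = t (.inl ⟨j, .inl k⟩) +
      (∑ l, t (.inl ⟨j, .inr l⟩) * ((S.Q j).vertex (w' j) l - (S.Q j).vertex (w j) l)) *
        ((S.P j).vertex (v' j) k - (S.P j).vertex (v j) k) := by
  simp only [shear, mul_sub, Finset.sum_sub_distrib]
  ring

end SympleModel

/-! ### Symple singularities -/

/-- A symple chart: a homeomorphism from an open subset of `B` onto an open subset of a product of
symple models and a trivial factor, which identifies the discriminants, and which identifies the
local systems of integral tangent vectors on the complements of the discriminants. -/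
structure SympleChart {n : ℕ} {B : Type u} [TopologicalSpace B] (M : IntegralAffineSing n B) where
  model : SympleModel
  toHomeo : OpenPartialHomeomorph B model.Space
  mem_disc_iff : ∀ x ∈ toHomeo.source, x ∈ M.disc ↔ toHomeo x ∈ model.disc
  iso : FrameSystem.Iso
    (M.atlas.tangent.pullback
      (fun z : {x : B // x ∈ toHomeo.source ∧ x ∈ M.discᶜ} => (⟨z.1, z.2.2⟩ : ↥M.discᶜ)))
    (model.tangent.pullback
      (fun z : {x : B // x ∈ toHomeo.source ∧ x ∈ M.discᶜ} => toHomeo z.1))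

namespace IntegralAffineSing

variable {n : ℕ} {B : Type u} [TopologicalSpace B]

/-- `B` is symple: it is locally a product of symple models and a trivial factor. -/
def IsSymple (M : IntegralAffineSing n B) : Prop :=
  ∀ y : B, ∃ φ : SympleChart M, y ∈ φ.toHomeo.source

/-- The sheaf `ι_* Λ_ℚ` on `B`, for the inclusion `ι` of the complement of the discriminant and
`Λ_ℚ = Λ ⊗ ℚ`. -/
noncomputable def pushforwardTangentRat (M : IntegralAffineSing n B) :
    TopCat.Sheaf AddCommGrpCat.{u} (TopCat.of B) :=
  (TopCat.Sheaf.pushforward AddCommGrpCat.{u}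
    (TopCat.ofHom (⟨Subtype.val, continuous_subtype_val⟩ : C(↥M.discᶜ, B)))).obj
    (M.atlas.tangent.sheaf ℚ)

/-- The sheaf cohomology group `H^1(V, ι_* Λ_ℚ)` of an open subset `V` of `B`. -/
noncomputable def H1 (M : IntegralAffineSing n B) (V : Opens B) : AddCommGrpCat.{u} :=
  Sheaf.H' M.pushforwardTangentRat 1 (show Opens (TopCat.of B) from V)

end IntegralAffineSing

/-- The open set `U \ {p}`. -/
def puncture {B : Type u} [TopologicalSpace B] [T1Space B] (U : Opens B) (p : B) : Opens B :=
  ⟨(U : Set B) \ {p}, U.isOpen.sdiff isClosed_singleton⟩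

/-- The open neighbourhood of `p` that corresponds to the part in the chart of the open ball of
radius `ε` around the image of `p`. The metric on the model is the maximum metric. -/
def SympleChart.ball {n : ℕ} {B : Type u} [TopologicalSpace B] {M : IntegralAffineSing n B}
    (φ : SympleChart M) (p : B) (ε : ℝ) : Opens B :=
  ⟨φ.toHomeo.source ∩ φ.toHomeo ⁻¹' Metric.ball (φ.toHomeo p) ε,
    φ.toHomeo.isOpen_inter_preimage Metric.isOpen_ball⟩

/-! By dimension shifting along an injective embedding, `H¹(V, F)` vanishes as soon as every Čech
1-cocycle on every open covering of `V` is a coboundary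
(`TopCat.Sheaf.subsingleton_H'_one_of_cech`). So explicit cocycles suffice. A symple chart turns
sections of `ι_* Λ_ℚ` into coordinate functions, one for each frame, on a product of models.
Doubling the factors `ℝ_{≥0}` moves the problem to a punctured ball in a real vector space of
dimension `n`.

The discriminant does not locally disconnect the space, so the component of a section in one factor
extends over the discriminants of the other factors. Thus the pushforward splits into one summand
for each pair `(P, Q)` and a constant sheaf (`SympleModel.cech`). The constant summand is harmless
because a punctured ball of dimension at least 3 has no first cohomology.

For one factor (`IsSmallBall.cech`), the cocycle is first trivialized over each frame domain `U_v`.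
Inside the punctured ball, `U_v` is either everything or a convex set with disjoint convex sets
attached along convex sets. Over the chamber of a vertex `w` of `Q`, which is connected in the
punctured ball, the trivializations for `v` and `v'` differ by a constant `δ_w(v, v')`. It remains
to absorb all `δ_w(v, v')` by changing each trivialization by a constant `C v`. The stratum dual to
edges `vv'` and `ww'` has dimension `n - 2 ≥ 1`, so it contains points other than `p` close to `p`
(`exists_near_stratum`). The covering has a member around such a point, and this forces `δ_w(v, v')`
and `δ_{w'}(v, v')` to come from one common pair of constants.

The rest is linear algebra (`LatticeSimplex.exists_trivialization`). The local conditions make the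
`Q`-components of `δ_w` independent of `w`, and they leave a defect `l_w (v - v₀)` in the
`P`-components. Independence of the edge vectors of `P` makes `l_w` independent of `v`. Affine
independence of the vertices of `Q` then yields a rational vector whose pairing with `w` is `l_w` up
to a common constant; inverting the integral matrix of the vertices is what needs rational
coefficients. -/

section

open Abelian TopCat.Presheaf

/-! ### First sheaf cohomology and Čech cocycles -/

namespace CategoryTheory.Sheaf

variable {C : Type u} [Category.{v} C] {J : GrothendieckTopology C}
  [HasSheafify J AddCommGrpCat.{v}]

/-- A morphism out of the free abelian sheaf on `V` lifts along `g` if `g` is surjective on `V`. -/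
theorem exists_lift_of_surjective (V : C) {F G : Sheaf J AddCommGrpCat.{v}} (g : F ⟶ G)
    (h : Function.Surjective (g.hom.app (op V)))
    (φ : (presheafToSheaf J AddCommGrpCat.{v}).obj (yoneda.obj V ⋙ AddCommGrpCat.free) ⟶ G) :
    ∃ ψ, ψ ≫ g = φ := by
  let A := sheafificationAdjunction J AddCommGrpCat.{v}
  let A2 := AddCommGrpCat.adj.{v}.whiskerRight Cᵒᵖ
  -- Sheafification, the free abelian group functor and Yoneda identify morphisms from the free
  -- sheaf on `V` to `G` with `G(V)`, naturally in `G`.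
  let e (G : Sheaf J AddCommGrpCat.{v}) :=
    (A.homEquiv (yoneda.obj V ⋙ AddCommGrpCat.free) G).trans
      ((A2.homEquiv (yoneda.obj V) G.obj).trans yonedaEquiv)
  have key : ∀ ψ, e G (ψ ≫ g) = g.hom.app (op V) (e F ψ) := by
    intro ψ
    simp only [e, Equiv.trans_apply]
    rw [A.homEquiv_naturality_right]
    erw [A2.homEquiv_naturality_right]
    rw [yonedaEquiv_comp]
    rfl
  obtain ⟨t, ht⟩ := h (e G φ)
  refine ⟨(e F).symm t, (e G).injective ?_⟩
  rw [← ht, key, Equiv.apply_symm_apply]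

/-- Every class in `Ext¹` dies in the injective middle term, so it comes from a morphism into `S.X₃`
under the connecting map. Such a morphism lifts to `S.X₂` by surjectivity on `V`, and the connecting
map kills whatever lifts. -/
theorem subsingleton_H'_one [HasExt.{v} (Sheaf J AddCommGrpCat.{v})] (V : C)
    {S : ShortComplex (Sheaf J AddCommGrpCat.{v})} (hS : S.ShortExact) [Injective S.X₂]
    (h : Function.Surjective (S.g.hom.app (op V))) :
    Subsingleton (Sheaf.H' S.X₁ 1 V) := by
  have h0 : ∀ x : Ext ((presheafToSheaf J AddCommGrpCat.{v}).obj
      (yoneda.obj V ⋙ AddCommGrpCat.free)) S.X₁ 1, x = 0 := by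
    intro x
    obtain ⟨x₃, rfl⟩ := Ext.covariant_sequence_exact₁ _ hS x (Ext.eq_zero_of_injective _) rfl
    obtain ⟨φ, rfl⟩ := (Ext.mk₀_bijective _ _).2 x₃
    obtain ⟨ψ, rfl⟩ := exists_lift_of_surjective V S.g h φ
    rw [← Ext.mk₀_comp_mk₀, Ext.comp_assoc_of_second_deg_zero, hS.comp_extClass, Ext.comp_zero]
  exact subsingleton_of_forall_eq (α := Ext _ S.X₁ 1) 0 h0

end CategoryTheory.Sheaf

/-- If all Čech `1`-cocycles on all open coverings of `V` are coboundaries, then `H¹(V, F) = 0`. -/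
theorem TopCat.Sheaf.subsingleton_H'_one_of_cech {X : TopCat.{u}}
    (F : TopCat.Sheaf AddCommGrpCat.{u} X) (V : Opens X)
    (h : ∀ (U : V → Opens X), (∀ i, U i ≤ V) → (∀ i, i.1 ∈ U i) →
      ∀ f : ∀ i j, F.obj.obj (op (U i ⊓ U j)),
      (∀ i j k, F.obj.map (homOfLE (show U i ⊓ U j ⊓ U k ≤ U i ⊓ U j from inf_le_left)).op (f i j) +
        F.obj.map (homOfLE (show U i ⊓ U j ⊓ U k ≤ U j ⊓ U k from
          le_inf (inf_le_left.trans inf_le_right) inf_le_right)).op (f j k) =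
        F.obj.map (homOfLE (show U i ⊓ U j ⊓ U k ≤ U i ⊓ U k from
          le_inf (inf_le_left.trans inf_le_left) inf_le_right)).op (f i k)) →
      ∃ g : ∀ i, F.obj.obj (op (U i)), ∀ i j, f i j =
        F.obj.map (homOfLE (show U i ⊓ U j ≤ U j from inf_le_right)).op (g j) -
        F.obj.map (homOfLE (show U i ⊓ U j ≤ U i from inf_le_left)).op (g i)) :
    Subsingleton (CategoryTheory.Sheaf.H' F 1 V) := by
  let S : ShortComplex (TopCat.Sheaf AddCommGrpCat.{u} X) :=
    ShortComplex.mk (Injective.ι F) (Limits.cokernel.π (Injective.ι F))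
      (Limits.cokernel.condition _)
  have hS : S.ShortExact :=
    { exact := ShortComplex.exact_of_g_is_cokernel _ (Limits.cokernelIsCokernel _)
      mono_f := by dsimp [S]; infer_instance
      epi_g := by dsimp [S]; infer_instance }
  have : Injective S.X₂ := Injective.injective_under F
  refine @CategoryTheory.Sheaf.subsingleton_H'_one _ _ _ _ _ V S hS this ?_
  intro s
  have hepi := (TopCat.Sheaf.isLocallySurjective_iff_epi S.g).mpr hS.epi_g
  have hloc := (isLocallySurjective_iff S.g.hom).mp hepi V s
  choose U hU hx using fun i : V => hloc i.1 i.2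
  choose t ht using fun i => (hx i).1
  have hmem := fun i => (hx i).2
  have hcov : V ≤ iSup U := fun x hxV => Opens.mem_iSup.2 ⟨⟨x, hxV⟩, hmem _⟩
  have hmono : ∀ W : Opens X, Function.Injective (S.f.hom.app (op W)) := by
    intro W
    have : Mono S.f := hS.mono_f
    have h1 : Mono ((TopCat.Sheaf.forget AddCommGrpCat.{u} X).map S.f) := inferInstance
    have : Mono (S.f.hom.app (op W)) := (NatTrans.mono_iff_mono_app _).1 h1 (op W)
    exact (AddCommGrpCat.mono_iff_injective _).1 this
  have natf : ∀ {W W' : Opens X} (k : W' ≤ W) (a : F.obj.obj (op W)),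
      S.f.hom.app (op W') (F.obj.map (homOfLE k).op a) =
        S.X₂.obj.map (homOfLE k).op (S.f.hom.app (op W) a) := fun k a =>
    ConcreteCategory.congr_hom (S.f.hom.naturality (homOfLE k).op) a
  have natg : ∀ {W W' : Opens X} (k : W' ≤ W) (a : S.X₂.obj.obj (op W)),
      S.g.hom.app (op W') (S.X₂.obj.map (homOfLE k).op a) =
        S.X₃.obj.map (homOfLE k).op (S.g.hom.app (op W) a) := fun k a =>
    ConcreteCategory.congr_hom (S.g.hom.naturality (homOfLE k).op) a
  have mapmap : ∀ (G : TopCat.Sheaf AddCommGrpCat.{u} X) {W W' W'' : Opens X} (k : W' ≤ W)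
      (k' : W'' ≤ W') (a : G.obj.obj (op W)),
      G.obj.map (homOfLE k').op (G.obj.map (homOfLE k).op a) =
        G.obj.map (homOfLE (k'.trans k)).op a := by
    intro G W W' W'' k k' a
    rw [← CategoryTheory.comp_apply, ← Functor.map_comp]
    rfl
  have hzero : ∀ {W : Opens X} (a : F.obj.obj (op W)),
      S.g.hom.app (op W) (S.f.hom.app (op W) a) = 0 := by
    intro W a
    have h2 : S.f.hom.app (op W) ≫ S.g.hom.app (op W) = 0 :=
      congrArg (fun k : S.X₁ ⟶ S.X₃ => k.hom.app (op W)) S.zero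
    exact ConcreteCategory.congr_hom h2 a
  -- Two local lifts of the same section differ by an element of the kernel, which is `F` by left
  -- exactness of sections. These differences form the cocycle.
  have hker : ∀ i j : V, ∃ a : F.obj.obj (op (U i ⊓ U j)), S.f.hom.app (op (U i ⊓ U j)) a =
      S.X₂.obj.map (homOfLE (show U i ⊓ U j ≤ U j from inf_le_right)).op (t j) -
      S.X₂.obj.map (homOfLE (show U i ⊓ U j ≤ U i from inf_le_left)).op (t i) := by
    intro i j
    refine TopCat.Sheaf.sections_exact_of_left_exact hS.1 hS.2 _ ?_
    rw [map_sub, natg, natg, ht, ht]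
    change S.X₃.obj.map _ (S.X₃.obj.map (homOfLE (hU j)).op s) -
      S.X₃.obj.map _ (S.X₃.obj.map (homOfLE (hU i)).op s) = 0
    rw [mapmap, mapmap, sub_self]
  choose f hf using hker
  obtain ⟨g, hg⟩ := h U hU hmem f (by
    intro i j k
    apply hmono
    rw [map_add, natf, natf, natf, hf, hf, hf]
    simp only [map_sub, mapmap]
    abel)
  -- Correcting the lifts `t i` by the cochain `g` makes them agree on overlaps; subtracting
  -- elements of `F` does not change their images.
  obtain ⟨τ, hτ, -⟩ := TopCat.Sheaf.existsUnique_gluing' S.X₂ U V (fun i => homOfLE (hU i)) hcov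
    (fun i => t i - S.f.hom.app (op (U i)) (g i)) (by
      intro i j
      have h1 := hf i j
      rw [hg, map_sub, natf, natf] at h1
      change S.X₂.obj.map (homOfLE (show U i ⊓ U j ≤ U i from inf_le_left)).op _ =
        S.X₂.obj.map (homOfLE (show U i ⊓ U j ≤ U j from inf_le_right)).op _
      rw [map_sub, map_sub]
      rw [sub_eq_sub_iff_add_eq_add] at h1 ⊢
      rw [add_comm, ← h1, add_comm])
  refine ⟨τ, TopCat.Sheaf.eq_of_locally_eq' S.X₃ U V (fun i => homOfLE (hU i)) hcov _ _ ?_⟩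
  intro i
  rw [← natg, hτ, map_sub, ht, hzero, sub_zero]
  rfl

end

/-! ### Locally constant functions and cocycles with constant coefficients -/

/-- The function `h` is locally constant near every point of `s`. -/
def LocConstOn {X A : Type*} [TopologicalSpace X] (h : X → A) (s : Set X) : Prop :=
  ∀ z ∈ s, ∀ᶠ z' in 𝓝 z, h z' = h z

namespace LocConstOn

variable {X Y A A' : Type*} [TopologicalSpace X] [TopologicalSpace Y] {h : X → A} {s t : Set X}

theorem mono (H : LocConstOn h s) (hts : t ⊆ s) : LocConstOn h t := fun z hz => H z (hts hz)

theorem comp_left (H : LocConstOn h s) (g : A → A') : LocConstOn (fun x => g (h x)) s :=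
  fun z hz => (H z hz).mono fun _ e => congrArg g e

theorem comp₂ {A'' : Type*} {k : X → A'} (H : LocConstOn h s) (K : LocConstOn k s)
    (g : A → A' → A'') : LocConstOn (fun x => g (h x) (k x)) s := fun z hz => by
  filter_upwards [H z hz, K z hz] with z' e e'
  rw [e, e']

theorem pi {ι : Type*} [Finite ι] {B : ι → Type*} {k : X → ∀ i, B i}
    (H : ∀ i, LocConstOn (fun x => k x i) s) : LocConstOn k s := fun z hz => by
  filter_upwards [Filter.eventually_all.2 fun i => H i z hz] with z' e
  exact funext e

theorem comp_right (H : LocConstOn h s) {g : Y → X} (hg : Continuous g) :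
    LocConstOn (fun y => h (g y)) (g ⁻¹' s) := fun z hz =>
  hg.continuousAt.eventually (H (g z) hz)

theorem eq_of_isPreconnected (H : LocConstOn h s) (hs : IsPreconnected s) {x y : X} (hx : x ∈ s)
    (hy : y ∈ s) : h x = h y := by
  have : PreconnectedSpace s := isPreconnected_iff_preconnectedSpace.1 hs
  have hl : IsLocallyConstant (fun z : s => h z) := by
    rw [IsLocallyConstant.iff_eventually_eq]
    intro z
    exact continuous_subtype_val.continuousAt.eventually (H z z.2)
  exact hl.apply_eq_of_preconnectedSpace ⟨x, hx⟩ ⟨y, hy⟩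

theorem exists_const [Inhabited A] (H : LocConstOn h s) (hs : IsPreconnected s) :
    ∃ c, ∀ z ∈ s, h z = c := by
  rcases s.eq_empty_or_nonempty with rfl | ⟨x, hx⟩
  · exact ⟨default, fun z hz => hz.elim⟩
  · exact ⟨h x, fun z hz => H.eq_of_isPreconnected hs hz hx⟩

end LocConstOn

/-- Every Čech `1`-cocycle on an open covering of `W`, with coefficients in the constant sheaf `A`,
is a coboundary. -/
def ConstCechTrivial (A : Type v) [AddCommGroup A] {X : Type*} [TopologicalSpace X] (W : Set X) :
    Prop :=
  ∀ (ι : Type u) (U : ι → Set X), (∀ i, IsOpen (U i)) → (W ⊆ ⋃ i, U i) →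
    ∀ f : ι → ι → X → A, (∀ i j, LocConstOn (f i j) (U i ∩ U j ∩ W)) →
    (∀ i j k, ∀ z ∈ W, z ∈ U i → z ∈ U j → z ∈ U k → f i j z + f j k z = f i k z) →
    ∃ h : ι → X → A, (∀ i, LocConstOn (h i) (U i ∩ W)) ∧
      ∀ i j, ∀ z ∈ W, z ∈ U i → z ∈ U j → f i j z = h j z - h i z

namespace ConstCechTrivial

variable {A : Type v} [AddCommGroup A] {X : Type*} [TopologicalSpace X]

/-- A cocycle with discrete coefficients is gluing data for a covering space with fibre `A`. Over a
simply connected base the covering has a global section, whose expressions in the local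
trivializations form the required cochain. -/
theorem of_simplyConnected {W : Set X} (hW : IsOpen W) [SimplyConnectedSpace W]
    [LocallyPathConnectedSpace W] : ConstCechTrivial.{u} A W := by
  intro ι U hU hcov f hf hcoc
  let _ : TopologicalSpace A := ⊥
  have : DiscreteTopology A := ⟨rfl⟩
  have hcov' : ∀ z : W, ∃ i, z.1 ∈ U i := fun z => by simpa using hcov z.2
  choose idx hidx using hcov'
  have hself : ∀ i, ∀ z ∈ W, z ∈ U i → f i i z = 0 := fun i z hz hi => by
    simpa using hcoc i i i z hz hi hi hi
  let Z : FiberBundleCore ι W A :=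
    { baseSet := fun i => Subtype.val ⁻¹' U i
      isOpen_baseSet := fun i => (hU i).preimage continuous_subtype_val
      indexAt := idx
      mem_baseSet_at := hidx
      coordChange := fun i j x v => v + f i j x
      coordChange_self := fun i x hx v => by simp [hself i x x.2 hx]
      continuousOn_coordChange := by
        rintro i j ⟨x, v⟩ ⟨⟨hi, hj⟩, -⟩
        refine ContinuousAt.continuousWithinAt ?_
        have hc : ContinuousAt (fun p : W × A => f i j p.1) (x, v) := by
          have h1 : ∀ᶠ p : W × A in 𝓝 (x, v), f i j p.1 = f i j x :=
            (continuous_subtype_val.comp continuous_fst).continuousAt.tendsto.eventually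
              (p := fun z => f i j z = f i j x) (hf i j x ⟨⟨hi, hj⟩, x.2⟩)
          exact (continuousAt_const (y := f i j x)).congr (h1.mono fun p hp => hp.symm)
        exact (continuous_of_discreteTopology (f := fun q : A × A => q.1 + q.2)).continuousAt.comp
          (continuousAt_snd.prodMk hc)
      coordChange_comp := fun i j k x hx v => by
        rw [add_assoc, hcoc i j k x x.2 hx.1.1 hx.1.2 hx.2] }
  have hcovmap : IsCoveringMap Z.proj := FiberBundle.isCoveringMap (F := A) (E := Z.Fiber)
  obtain ⟨x₀⟩ : Nonempty W := inferInstance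
  -- The global section is the lift of the identity map of `W`.
  obtain ⟨σ, ⟨-, hσ⟩, -⟩ := hcovmap.existsUnique_continuousMap_lifts (ContinuousMap.id W) x₀
    (⟨x₀, (0 : A)⟩ : Z.TotalSpace) rfl
  have hproj : ∀ z, Z.proj (σ z) = z := fun z => congrFun hσ z
  classical
  refine ⟨fun i z => if hz : z ∈ W then (Z.localTriv i (σ ⟨z, hz⟩)).2 else 0, ?_, ?_⟩
  · rintro i z ⟨hi, hz⟩
    have hsrc : σ ⟨z, hz⟩ ∈ (Z.localTriv i).source := by
      rw [Z.mem_localTriv_source]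
      change (Z.proj (σ ⟨z, hz⟩)).1 ∈ U i
      rwa [hproj]
    have hcont : ContinuousAt (fun w : W => (Z.localTriv i (σ w)).2) ⟨z, hz⟩ :=
      continuousAt_snd.comp (((Z.localTriv i).continuousAt hsrc).comp σ.continuous.continuousAt)
    have hev : ∀ᶠ w : W in 𝓝 ⟨z, hz⟩, (Z.localTriv i (σ w)).2 = (Z.localTriv i (σ ⟨z, hz⟩)).2 :=
      hcont.eventually (isOpen_discrete {(Z.localTriv i (σ ⟨z, hz⟩)).2} |>.mem_nhds rfl)
    have hev' := hev
    rw [nhds_subtype_eq_comap, Filter.eventually_comap] at hev'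
    filter_upwards [hev', hW.mem_nhds hz] with w hw hwW
    rw [dif_pos hwW, dif_pos hz]
    exact hw ⟨w, hwW⟩ rfl
  · intro i j z hz hi hj
    simp only [dif_pos hz]
    have hp : (σ ⟨z, hz⟩).1 = ⟨z, hz⟩ := hproj ⟨z, hz⟩
    rw [Z.localTriv_apply, Z.localTriv_apply]
    have h1 := Z.coordChange_comp (Z.indexAt (σ ⟨z, hz⟩).1) i j (σ ⟨z, hz⟩).1
      ⟨⟨Z.mem_baseSet_at _, by rw [hp]; exact hi⟩, by rw [hp]; exact hj⟩ (σ ⟨z, hz⟩).2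
    dsimp only
    rw [← h1]
    have h2 : Z.coordChange i j (σ ⟨z, hz⟩).1 = fun v => v + f i j z := by
      change (fun v => v + f i j (σ ⟨z, hz⟩).1) = _
      rw [hp]
    rw [h2]
    simp

theorem of_isEmpty : ConstCechTrivial.{u} A (∅ : Set X) := by
  intro _ _ _ _ _ _ _
  exact ⟨fun _ _ => 0, fun _ _ hz => hz.2.elim, fun _ _ _ hz => hz.elim⟩

/-- This is the Mayer–Vietoris argument. The cochains found on the two pieces differ on the
intersection by a function independent of the member of the covering. It is locally constant, hence
constant by connectedness, and it can be subtracted from one of them. -/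
theorem union {W₁ W₂ : Set X} (ho₁ : IsOpen W₁) (ho₂ : IsOpen W₂) (h₁ : ConstCechTrivial.{u} A W₁)
    (h₂ : ConstCechTrivial.{u} A W₂) (hc : IsPreconnected (W₁ ∩ W₂)) :
    ConstCechTrivial.{u} A (W₁ ∪ W₂) := by
  intro ι U hU hcov f hf hcoc
  obtain ⟨g, hg, hg'⟩ := h₁ ι U hU (Set.subset_union_left.trans hcov) f
    (fun i j => (hf i j).mono (Set.inter_subset_inter_right _ Set.subset_union_left))
    (fun i j k z hz => hcoc i j k z (Or.inl hz))
  obtain ⟨k, hk, hk'⟩ := h₂ ι U hU (Set.subset_union_right.trans hcov) f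
    (fun i j => (hf i j).mono (Set.inter_subset_inter_right _ Set.subset_union_right))
    (fun i j k z hz => hcoc i j k z (Or.inr hz))
  have hdiff : ∃ c, ∀ i, ∀ z ∈ W₁ ∩ W₂, z ∈ U i → k i z - g i z = c := by
    have key : ∀ i j, ∀ z ∈ W₁ ∩ W₂, z ∈ U i → z ∈ U j → k i z - g i z = k j z - g j z := by
      intro i j z hz hi hj
      have := (hg' i j z hz.1 hi hj).symm.trans (hk' i j z hz.2 hi hj)
      rw [sub_eq_sub_iff_add_eq_add] at this ⊢
      rw [add_comm, ← this, add_comm]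
    have hcov' : ∀ z, z ∈ W₁ ∩ W₂ → ∃ i, z ∈ U i := fun z hz => by
      simpa using hcov (Or.inl hz.1)
    rcases (W₁ ∩ W₂).eq_empty_or_nonempty with he | ⟨z₀, hz₀⟩
    · exact ⟨0, fun i z hz => by simp [he] at hz⟩
    have : Nonempty ι := ⟨(hcov' z₀ hz₀).choose⟩
    choose! idx hidx using hcov'
    have hl : LocConstOn (fun z => k (idx z) z - g (idx z) z) (W₁ ∩ W₂) := by
      intro z hz
      filter_upwards [hg (idx z) z ⟨hidx z hz, hz.1⟩, hk (idx z) z ⟨hidx z hz, hz.2⟩,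
        (ho₁.inter ho₂).mem_nhds hz, (hU (idx z)).mem_nhds (hidx z hz)] with w h1 h2 h3 h4
      rw [key _ (idx z) w h3 (hidx w h3) h4, h1, h2]
    have : Inhabited A := ⟨0⟩
    obtain ⟨c, hcc⟩ := hl.exists_const hc
    exact ⟨c, fun i z hz hi => by rw [← hcc z hz]; exact key i (idx z) z hz hi (hidx z hz)⟩
  obtain ⟨c, hc⟩ := hdiff
  classical
  have e1 : ∀ i, ∀ z ∈ W₁, (if z ∈ W₁ then g i z else k i z - c) = g i z := fun i z hz => if_pos hz
  have e2 : ∀ i, ∀ z ∈ W₂, z ∈ U i → (if z ∈ W₁ then g i z else k i z - c) = k i z - c := by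
    intro i z hz hi
    split_ifs with h
    · rw [← hc i z ⟨h, hz⟩ hi]; abel
    · rfl
  refine ⟨fun i z => if z ∈ W₁ then g i z else k i z - c, ?_, ?_⟩
  · rintro i z ⟨hi, hz | hz⟩
    · filter_upwards [hg i z ⟨hi, hz⟩, ho₁.mem_nhds hz] with w h1 h2
      rw [e1 i w h2, e1 i z hz, h1]
    · filter_upwards [hk i z ⟨hi, hz⟩, ho₂.mem_nhds hz, (hU i).mem_nhds hi] with w h1 h2 h3
      rw [e2 i w h2 h3, e2 i z hz hi, h1]
  · rintro i j z (hz | hz) hi hj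
    · simp only [e1 _ z hz]; exact hg' i j z hz hi hj
    · simp only [e2 _ z hz hi, e2 _ z hz hj, hk' i j z hz hi hj]; abel

variable {E : Type*} [NormedAddCommGroup E] [NormedSpace ℝ E]

theorem of_starConvex {W : Set E} (hW : IsOpen W) {x : E} (h : StarConvex ℝ x W) :
    ConstCechTrivial.{u} A W := by
  rcases W.eq_empty_or_nonempty with rfl | hne
  · exact of_isEmpty
  · have := h.contractibleSpace hne
    have : LocallyPathConnectedSpace W := hW.locallyPathConnectedSpace
    exact of_simplyConnected hW

theorem of_convex {W : Set E} (hW : IsOpen W) (h : Convex ℝ W) : ConstCechTrivial.{u} A W := by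
  rcases W.eq_empty_or_nonempty with rfl | ⟨x, hx⟩
  · exact of_isEmpty
  · exact of_starConvex hW (h.starConvex hx)

/-- The union of a convex set and finitely many pairwise disjoint convex sets. -/
theorem union_biUnion {κ : Type*} (s : Finset κ) {D : Set E} {D' : κ → Set E} (hD : IsOpen D)
    (hD' : ∀ w, IsOpen (D' w)) (hc : Convex ℝ D) (hc' : ∀ w, Convex ℝ (D' w))
    (hdisj : ∀ w w', w ≠ w' → Disjoint (D' w) (D' w')) :
    ConstCechTrivial.{u} A (D ∪ ⋃ w ∈ s, D' w) := by
  classical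
  induction s using Finset.induction_on with
  | empty => simpa using of_convex hD hc
  | insert a s ha ih =>
    have e : D ∪ ⋃ w ∈ insert a s, D' w = (D ∪ ⋃ w ∈ s, D' w) ∪ D' a := by
      rw [Finset.set_biUnion_insert, Set.union_comm (D' a), Set.union_assoc]
    rw [e]
    refine union (hD.union (isOpen_biUnion fun w _ => hD' w)) (hD' a) ih (of_convex (hD' a) (hc' a))
      ?_
    -- The new piece misses the earlier ones, so it is attached along an intersection of two convex
    -- sets.
    have e2 : (D ∪ ⋃ w ∈ s, D' w) ∩ D' a = D ∩ D' a := by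
      rw [Set.union_inter_distrib_right]
      refine Set.union_eq_self_of_subset_right ?_
      rintro z ⟨hz, hza⟩
      simp only [Set.mem_iUnion] at hz
      obtain ⟨w, hw, hzw⟩ := hz
      exact (Set.disjoint_left.1 (hdisj w a (by rintro rfl; exact ha hw)) hzw hza).elim
    rw [e2]
    exact (hc.inter (hc' a)).isPreconnected

end ConstCechTrivial

/-! ### Punctured balls -/

section PuncturedBall

variable {E : Type*} [NormedAddCommGroup E] [NormedSpace ℝ E]

/-- The map `x ↦ p + r / (1 + ‖x‖) • x` identifies `E` with the ball and rescales each vector, so it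
carries the complement of `L` onto the set in question. The complement of a subspace of codimension
at least 2 is connected. -/
theorem isPreconnected_ball_diff_submodule (p : E) {r : ℝ} (hr : 0 < r) (L : Submodule ℝ E)
    (hL : 1 < Module.rank ℝ (E ⧸ L)) :
    IsPreconnected (Metric.ball p r \ {z | z - p ∈ L}) := by
  have h1 : IsPreconnected ((L : Set E)ᶜ) :=
    (isConnected_compl_of_one_lt_codim hL).isPreconnected
  have hc : Continuous fun x : E => p + (r / (1 + ‖x‖)) • x := by
    have : ∀ x : E, 1 + ‖x‖ ≠ 0 := fun x => by positivity
    fun_prop (disch := exact this _)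
  convert h1.image _ hc.continuousOn using 1
  ext z
  simp only [Set.mem_sdiff, Metric.mem_ball, Set.mem_ofPred_eq, Set.mem_image, Set.mem_compl_iff,
    SetLike.mem_coe, dist_eq_norm]
  constructor
  · rintro ⟨hz, hzL⟩
    have h0 : 0 < r - ‖z - p‖ := by linarith
    refine ⟨(r - ‖z - p‖)⁻¹ • (z - p), fun h => hzL ?_, ?_⟩
    · have := L.smul_mem (r - ‖z - p‖) h
      rwa [smul_smul, mul_inv_cancel₀ h0.ne', one_smul] at this
    · rw [norm_smul, Real.norm_of_nonneg (inv_nonneg.2 h0.le), smul_smul]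
      have : r / (1 + (r - ‖z - p‖)⁻¹ * ‖z - p‖) * (r - ‖z - p‖)⁻¹ = 1 := by
        field_simp
        ring_nf
      rw [this, one_smul, add_sub_cancel]
  · rintro ⟨x, hx, rfl⟩
    have h0 : 0 < 1 + ‖x‖ := by positivity
    rw [add_sub_cancel_left]
    refine ⟨?_, fun h => hx ?_⟩
    · rw [norm_smul, Real.norm_of_nonneg (by positivity), div_mul_eq_mul_div, div_lt_iff₀ h0]
      nlinarith [norm_nonneg x]
    · have := L.smul_mem ((1 + ‖x‖) / r) h
      rwa [smul_smul, div_mul_div_cancel₀ hr.ne', div_self h0.ne', one_smul] at this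

theorem isPreconnected_ball_diff_singleton (p : E) {r : ℝ} (hr : 0 < r)
    (hE : 2 ≤ Module.finrank ℝ E) : IsPreconnected (Metric.ball p r \ {p}) := by
  have := isPreconnected_ball_diff_submodule p hr ⊥ (by
    rw [(Submodule.quotEquivOfEqBot (⊥ : Submodule ℝ E) rfl).rank_eq]
    exact Module.lt_rank_of_lt_finrank (by exact_mod_cast hE))
  convert this using 2
  ext z
  simp [sub_eq_zero]

/-- A ball without a closed ray starting at the centre is star-shaped. -/
theorem starConvex_ball_diff_ray (p e : E) {r δ : ℝ} (hδ : 0 < δ) (hr : ‖δ • e‖ < r) (he : e ≠ 0) :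
    StarConvex ℝ (p + δ • e) (Metric.ball p r \ (fun t : ℝ => p + t • e) '' Set.Iic 0) := by
  rintro z ⟨hz, hz'⟩ a b ha hb hab
  refine ⟨convex_ball p r (by simpa using hr) hz ha hb hab, ?_⟩
  rintro ⟨t, ht, hte⟩
  rcases hb.eq_or_lt with rfl | hb
  · have ha1 : a = 1 := by linarith
    subst ha1
    have h2 : (t - δ) • e = 0 := by
      have h1 : p + t • e = p + δ • e := by simpa using hte
      rw [sub_smul, sub_eq_zero]
      exact add_left_cancel h1
    rcases smul_eq_zero.1 h2 with h3 | h3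
    · have : t ≤ 0 := ht
      linarith
    · exact he h3
  -- If a point of the segment lay on the ray, solving for `z` would put `z` on the ray too, with
  -- this nonpositive parameter.
  · refine hz' ⟨b⁻¹ * (t - a * δ), ?_, ?_⟩
    · have : t ≤ 0 := ht
      have h1 := mul_nonneg ha hδ.le
      exact mul_nonpos_of_nonneg_of_nonpos (inv_nonneg.2 hb.le) (by linarith)
    · have h1 : b • z = p + t • e - a • (p + δ • e) := by
        dsimp only at hte
        rw [hte]; abel
      have h2 : z = b⁻¹ • (p + t • e - a • (p + δ • e)) := by
        rw [← h1, smul_smul, inv_mul_cancel₀ hb.ne', one_smul]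
      dsimp only
      rw [h2]
      have ha' : a = 1 - b := by linarith
      subst ha'
      have h3 : p + t • e - (1 - b) • (p + δ • e) = b • p + (t - (1 - b) * δ) • e := by
        module
      rw [h3, smul_add, smul_smul, smul_smul, inv_mul_cancel₀ hb.ne', one_smul]

theorem isClosed_ray (p : E) {e : E} (he : e ≠ 0) :
    IsClosed ((fun t : ℝ => p + t • e) '' Set.Iic 0) := by
  have h1 := (isClosedEmbedding_smul_left (𝕜 := ℝ) he).isClosedMap _ (isClosed_Iic (a := (0 : ℝ)))
  have h2 := (Homeomorph.addLeft p).isClosedMap _ h1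
  rwa [Set.image_image] at h2

/-- The punctured ball is covered by two star-shaped slit balls, obtained by removing opposite rays
from `p`. Their intersection is the ball without a line, which is connected because the line has
codimension at least 2. This is where dimension 3 enters for constant coefficients. -/
theorem ConstCechTrivial.ball_diff_singleton (A : Type v) [AddCommGroup A] (p : E) {r : ℝ}
    (hr : 0 < r) (hE : 3 ≤ Module.finrank ℝ E) :
    ConstCechTrivial.{u} A (Metric.ball p r \ {p}) := by
  have : Nontrivial E := Module.nontrivial_of_finrank_pos (R := ℝ) (by omega)
  have : FiniteDimensional ℝ E := Module.finite_of_finrank_pos (by omega)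
  obtain ⟨e, he⟩ := exists_ne (0 : E)
  have he' : -e ≠ 0 := neg_ne_zero.2 he
  have hne : 0 < ‖e‖ := norm_pos_iff.2 he
  obtain ⟨δ, hδ, hδr⟩ : ∃ δ : ℝ, 0 < δ ∧ ‖δ • e‖ < r := by
    refine ⟨r / 2 / ‖e‖, by positivity, ?_⟩
    rw [norm_smul, Real.norm_of_nonneg (by positivity), div_mul_cancel₀ _ hne.ne']
    linarith
  have hδr' : ‖δ • (-e)‖ < r := by rwa [smul_neg, norm_neg]
  have ho : ∀ e : E, e ≠ 0 →
      IsOpen (Metric.ball p r \ (fun t : ℝ => p + t • e) '' Set.Iic 0) := fun e he =>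
    Metric.isOpen_ball.sdiff (isClosed_ray p he)
  have hU : Metric.ball p r \ {p} = (Metric.ball p r \ (fun t : ℝ => p + t • e) '' Set.Iic 0) ∪
      (Metric.ball p r \ (fun t : ℝ => p + t • (-e)) '' Set.Iic 0) := by
    rw [← Set.sdiff_inter]
    congr 1
    ext z
    constructor
    · rintro rfl
      exact ⟨⟨0, by simp, by simp⟩, ⟨0, by simp, by simp⟩⟩
    · rintro ⟨⟨t, ht, rfl⟩, ⟨s, hs, hst⟩⟩
      have h1 : (s + t) • e = 0 := by
        have h2 : s • (-e) = t • e := add_left_cancel hst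
        rw [add_smul, ← h2]; simp
      have h3 : s + t = 0 := (smul_eq_zero.1 h1).resolve_right he
      have ht' : t ≤ 0 := ht
      have hs' : s ≤ 0 := hs
      have : t = 0 := by linarith
      simp [this]
  rw [hU]
  refine union (ho e he) (ho (-e) he')
    (of_starConvex (ho e he) (starConvex_ball_diff_ray p e hδ hδr he))
    (of_starConvex (ho (-e) he') (starConvex_ball_diff_ray p (-e) hδ hδr' he')) ?_
  rw [Set.sdiff_inter_sdiff]
  convert isPreconnected_ball_diff_submodule p hr (Submodule.span ℝ {e}) ?_ using 2
  · ext z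
    simp only [Set.mem_union, Set.mem_image, Set.mem_Iic, Set.mem_ofPred_eq,
      Submodule.mem_span_singleton]
    constructor
    · rintro (⟨t, -, rfl⟩ | ⟨t, -, rfl⟩)
      · exact ⟨t, by simp⟩
      · exact ⟨-t, by simp⟩
    · rintro ⟨t, ht⟩
      rcases le_total t 0 with h | h
      · exact Or.inl ⟨t, h, by rw [ht]; abel⟩
      · exact Or.inr ⟨-t, by linarith, by rw [smul_neg, neg_smul, neg_neg, ht]; abel⟩
  · refine Module.lt_rank_of_lt_finrank ?_
    have h1 := Submodule.finrank_quotient_add_finrank (Submodule.span ℝ {e})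
    rw [finrank_span_singleton he] at h1
    omega

end PuncturedBall

/-! ### Extension of locally constant functions over small closed sets -/

/-- If `D` is dense and every neighbourhood of a point of `O` contains a neighbourhood whose
intersection with `D` is connected, then locally constant functions on `O ∩ D` extend to `O`. -/
theorem LocConstOn.exists_extension {X A : Type*} [TopologicalSpace X] [Inhabited A] {O D : Set X}
    (hO : IsOpen O) (hD : Dense D)
    (hconn : ∀ z ∈ O, ∃ N ∈ 𝓝 z, N ⊆ O ∧ IsPreconnected (N ∩ D))
    {h : X → A} (hh : LocConstOn h (O ∩ D)) :
    ∃ g : X → A, LocConstOn g O ∧ ∀ z ∈ O ∩ D, g z = h z := by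
  -- The extension takes at `z` the value that `h` has on the points of `D` near `z`; density makes
  -- this value unique.
  have hex : ∀ z ∈ O, ∃ c, ∀ᶠ z' in 𝓝[D] z, h z' = c := by
    intro z hz
    obtain ⟨N, hN, hNO, hNc⟩ := hconn z hz
    obtain ⟨c, hc⟩ := (hh.mono (Set.inter_subset_inter_left D hNO)).exists_const hNc
    refine ⟨c, ?_⟩
    filter_upwards [mem_nhdsWithin_of_mem_nhds hN, self_mem_nhdsWithin] with w h1 h2
    exact hc w ⟨h1, h2⟩
  choose! g hg using hex
  have hne : ∀ z, (𝓝[D] z).NeBot := fun z => mem_closure_iff_nhdsWithin_neBot.1 (hD z)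
  have huniq : ∀ z ∈ O, ∀ c, (∀ᶠ z' in 𝓝[D] z, h z' = c) → g z = c := by
    intro z hz c hc
    have := hne z
    obtain ⟨w, h1, h2⟩ := ((hg z hz).and hc).exists
    rw [← h1, h2]
  refine ⟨g, ?_, ?_⟩
  · intro z hz
    have h1 := eventually_eventually_nhdsWithin.2 (hg z hz)
    have h2 : ∀ᶠ y in 𝓝 z, ∀ᶠ x in 𝓝[D] y, h x = g z := by
      have := hg z hz
      rw [eventually_nhdsWithin_iff] at this
      filter_upwards [eventually_eventually_nhds.2 this] with y hy
      rwa [eventually_nhdsWithin_iff]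
    filter_upwards [h2, hO.mem_nhds hz] with y hy hyO
    exact huniq y hyO _ hy
  · intro z hz
    exact huniq z hz.1 _ (mem_nhdsWithin_of_mem_nhds (hh z hz))

/-- Two locally constant functions that agree on a dense set agree. -/
theorem LocConstOn.eq_of_dense {X A : Type*} [TopologicalSpace X] {O D : Set X} (hO : IsOpen O)
    (hD : Dense D) {g h : X → A} (hg : LocConstOn g O) (hh : LocConstOn h O)
    (e : ∀ z ∈ O ∩ D, g z = h z) : ∀ z ∈ O, g z = h z := by
  intro z hz
  obtain ⟨w, ⟨h1, h2, h3⟩, hw⟩ := mem_closure_iff_nhds.1 (hD z) _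
    ((hg z hz).and ((hh z hz).and (hO.mem_nhds hz)))
  rw [← h1, ← h2, e w ⟨h3, hw⟩]

/-! ### Linear algebra of lattice simplices -/

namespace LatticeSimplex

variable {a b d : ℕ}

/-- Over a field of characteristic zero, the values of a linear form at the vertices of a lattice
simplex can be prescribed up to a common constant. -/
theorem exists_pairing (P : LatticeSimplex d) (k : Type*) [Field k] [CharZero k]
    (f : Fin (d + 1) → k) :
    ∃ (x : Fin d → k) (c : k), ∀ i, ∑ l, x l * (P.vertex i l : k) = f i + c := by
  -- The rows are the vertices preceded by a 1, so affine independence says that the determinant is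
  -- nonzero over `ℝ`. Being an integer, it is then nonzero in every field of characteristic zero.
  -- The coefficient of the column of ones becomes the common constant.
  let N : Matrix (Fin (d + 1)) (Fin (d + 1)) ℤ := Matrix.of fun i => Fin.cons 1 (P.vertex i)
  have hdetR : (N.map (Int.cast : ℤ → ℝ)).det ≠ 0 := by
    intro h0
    obtain ⟨w, hw, hw0⟩ := Matrix.exists_vecMul_eq_zero_iff.2 h0
    refine hw (funext fun i => ?_)
    have h1 : ∑ i, w i = 0 := by
      simpa [N, Matrix.vecMul, dotProduct] using congrFun hw0 0
    have h2 : ∑ i, w i • (fun l => (P.vertex i l : ℝ)) = 0 := by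
      ext l
      simpa [N, Matrix.vecMul, dotProduct] using congrFun hw0 l.succ
    exact (affineIndependent_iff.1 P.affineIndependent) Finset.univ w h1 h2 i (Finset.mem_univ i)
  have hdet : N.det ≠ 0 := by
    intro h0
    apply hdetR
    have := (Int.castRingHom ℝ).map_det N
    rw [h0, map_zero] at this
    exact this.symm
  have hdetk : IsUnit (N.map (Int.cast : ℤ → k)).det := by
    have := (Int.castRingHom k).map_det N
    rw [isUnit_iff_ne_zero]
    intro h0
    have h1 : (Int.castRingHom k) N.det = 0 := this.trans h0
    exact hdet (by simpa using h1)
  set y := (N.map (Int.cast : ℤ → k))⁻¹ *ᵥ f with hy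
  have hNy : (N.map (Int.cast : ℤ → k)) *ᵥ y = f := by
    rw [hy, Matrix.mulVec_mulVec, Matrix.mul_nonsing_inv _ hdetk, Matrix.one_mulVec]
  refine ⟨fun l => y l.succ, -y 0, fun i => ?_⟩
  have := congrFun hNy i
  simp only [N, Matrix.mulVec, dotProduct, Fin.sum_univ_succ, Matrix.map_apply, Matrix.of_apply,
    Fin.cons_zero, Fin.cons_succ, Int.cast_one, one_mul] at this
  rw [← this]
  simp only [mul_comm]
  ring

/-- The vertices as rational vectors. -/
def ratVertex (P : LatticeSimplex d) (i : Fin (d + 1)) : Fin d → ℚ := fun l => P.vertex i l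

/-- The pairing of a rational linear form with a vertex. -/
def ratPair (P : LatticeSimplex d) (n : Fin d → ℚ) (i : Fin (d + 1)) : ℚ :=
  ∑ l, n l * (P.vertex i l : ℚ)

theorem ratPair_add (P : LatticeSimplex d) (n n' : Fin d → ℚ) (i : Fin (d + 1)) :
    P.ratPair (n + n') i = P.ratPair n i + P.ratPair n' i := by
  simp [ratPair, add_mul, Finset.sum_add_distrib]

theorem ratPair_sub (P : LatticeSimplex d) (n n' : Fin d → ℚ) (i : Fin (d + 1)) :
    P.ratPair (n - n') i = P.ratPair n i - P.ratPair n' i := by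
  simp [ratPair, sub_mul, Finset.sum_sub_distrib]

/-- Apply a linear form that separates the vertex `i` from all the others: it isolates `α` because
its common constant cancels in differences of vertices. -/
theorem eq_zero_of_smul_ratVertex (P : LatticeSimplex d) {i j k : Fin (d + 1)} (hij : i ≠ j)
    (hik : i ≠ k) {α β : ℚ}
    (h : α • (P.ratVertex i - P.ratVertex k) = β • (P.ratVertex j - P.ratVertex k)) : α = 0 := by
  obtain ⟨x, c, hx⟩ := P.exists_pairing ℚ (Pi.single i 1)
  have h1 := congrArg (fun v : Fin d → ℚ => ∑ l, x l * v l) h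
  have h2 : ∀ (γ : ℚ) (i' : Fin (d + 1)),
      ∑ l, x l * (γ • (P.ratVertex i' - P.ratVertex k)) l =
        γ * (∑ l, x l * (P.vertex i' l : ℚ) - ∑ l, x l * (P.vertex k l : ℚ)) := by
    intro γ i'
    rw [← Finset.sum_sub_distrib, Finset.mul_sum]
    refine Finset.sum_congr rfl fun l _ => ?_
    simp only [Pi.smul_apply, Pi.sub_apply, ratVertex, smul_eq_mul]
    ring
  simp only [h2, hx] at h1
  simpa [Pi.single_eq_of_ne hij.symm, Pi.single_eq_of_ne hik.symm] using h1

/-- Over the chamber dual to the vertex `w` of `Q`, the change from the coordinates in the frame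
that belongs to the vertex `v` of `P` to coordinates which do not depend on `v`. -/
def shift (P : LatticeSimplex a) (Q : LatticeSimplex b) (v : Fin (a + 1)) (w : Fin (b + 1)) :
    (Fin a → ℚ) × (Fin b → ℚ) ≃+ (Fin a → ℚ) × (Fin b → ℚ) where
  toFun c := (c.1 + Q.ratPair c.2 w • P.ratVertex v, c.2)
  invFun c := (c.1 - Q.ratPair c.2 w • P.ratVertex v, c.2)
  left_inv c := by simp
  right_inv c := by simp
  map_add' c c' := by
    refine Prod.ext ?_ rfl
    simp only [Prod.fst_add, Prod.snd_add, ratPair_add, add_smul]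
    abel

theorem shift_apply (P : LatticeSimplex a) (Q : LatticeSimplex b) (v : Fin (a + 1))
    (w : Fin (b + 1)) (c) : P.shift Q v w c = (c.1 + Q.ratPair c.2 w • P.ratVertex v, c.2) := rfl

/-- Combinatorial form of the vanishing theorem. The differences `δ w v v'` between trivializations
over the domains of the frames `v` and `v'`, computed over the chamber of `w`, can be removed
if this is possible around each of the maximal strata of the discriminant. -/
theorem exists_trivialization (P : LatticeSimplex a) (Q : LatticeSimplex b)
    (G : Set (Fin (a + 1))) (H : Set (Fin (b + 1))) {v₀ : Fin (a + 1)} (hv₀ : v₀ ∈ G)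
    {w₀ : Fin (b + 1)} (hw₀ : w₀ ∈ H)
    (δ : Fin (b + 1) → Fin (a + 1) → Fin (a + 1) → (Fin a → ℚ) × (Fin b → ℚ))
    (hδ : ∀ w ∈ H, ∀ v v' v'', δ w v v' + δ w v' v'' = δ w v v'')
    (hloc : ∀ v ∈ G, ∀ v' ∈ G, v ≠ v' → ∀ w ∈ H, ∀ w' ∈ H, w ≠ w' → ∃ c c',
      δ w v v' = P.shift Q v' w c' - P.shift Q v w c ∧
      δ w' v v' = P.shift Q v' w' c' - P.shift Q v w' c) :
    ∃ C : Fin (a + 1) → (Fin a → ℚ) × (Fin b → ℚ), ∀ v ∈ G, ∀ v' ∈ G, ∀ w ∈ H,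
      δ w v v' = P.shift Q v' w (C v') - P.shift Q v w (C v) := by
  classical
  have hself : ∀ w ∈ H, ∀ v, δ w v v = 0 := fun w hw v => by simpa using hδ w hw v v v
  -- The map `shift` does not touch the second component, so the local condition makes that
  -- component independent of `w`.
  have hν : ∀ v ∈ G, ∀ w ∈ H, (δ w v₀ v).2 = (δ w₀ v₀ v).2 := by
    intro v hv w hw
    by_cases hvv : v₀ = v
    · subst hvv; rw [hself w hw, hself w₀ hw₀]
    by_cases hww : w = w₀
    · rw [hww]
    obtain ⟨c, c', h1, h2⟩ := hloc v₀ hv₀ v hv hvv w hw w₀ hw₀ hww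
    rw [h1, h2]; rfl
  set ν : Fin (a + 1) → Fin b → ℚ := fun v => (δ w₀ v₀ v).2 with hνdef
  -- What is left of the first component after the dependence on `w` that is forced by `ν v` has
  -- been removed.
  set μ : Fin (b + 1) → Fin (a + 1) → Fin a → ℚ := fun w v =>
    (δ w v₀ v).1 - Q.ratPair (ν v) w • P.ratVertex v with hμ
  -- The local solution uses the same `c` and `c'` over both chambers. Its contribution can vary
  -- with `w` only through the pairing of `c.2 - ν v₁` with `w`, hence only along the edge vector.
  have hdiff : ∀ v₁ ∈ G, ∀ v₂ ∈ G, v₁ ≠ v₂ → ∀ w ∈ H, ∃ l : ℚ,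
      (μ w v₂ - μ w v₁) - (μ w₀ v₂ - μ w₀ v₁) = l • (P.ratVertex v₂ - P.ratVertex v₁) := by
    intro v₁ h₁ v₂ h₂ hne w hw
    by_cases hww : w = w₀
    · exact ⟨0, by simp [hww]⟩
    obtain ⟨c, c', e, e₀⟩ := hloc v₁ h₁ v₂ h₂ hne w hw w₀ hw₀ hww
    have key : ∀ w ∈ H, δ w v₁ v₂ = P.shift Q v₂ w c' - P.shift Q v₁ w c →
        μ w v₂ - μ w v₁ = c'.1 - c.1 + Q.ratPair (c.2 - ν v₁) w •
          (P.ratVertex v₂ - P.ratVertex v₁) := by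
      intro w hw e
      have h3 : δ w v₁ v₂ = δ w v₀ v₂ - δ w v₀ v₁ := eq_sub_of_add_eq' (hδ w hw v₀ v₁ v₂)
      have e1 : (δ w v₀ v₂).1 - (δ w v₀ v₁).1 =
          c'.1 + Q.ratPair c'.2 w • P.ratVertex v₂ - (c.1 + Q.ratPair c.2 w • P.ratVertex v₁) := by
        have := congrArg Prod.fst (h3.symm.trans e)
        simpa only [Prod.fst_sub, shift_apply] using this
      have e2 : ν v₂ - ν v₁ = c'.2 - c.2 := by
        have := congrArg Prod.snd (h3.symm.trans e)
        rw [Prod.snd_sub, hν v₂ h₂ w hw, hν v₁ h₁ w hw] at this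
        simpa only [Prod.snd_sub, shift_apply] using this
      have e3 : c'.2 = c.2 - ν v₁ + ν v₂ := by
        rw [sub_add_eq_add_sub, add_sub_assoc, e2, add_sub_cancel]
      have e4 : Q.ratPair c'.2 w = Q.ratPair c.2 w - Q.ratPair (ν v₁) w + Q.ratPair (ν v₂) w := by
        rw [e3, ratPair_add, ratPair_sub]
      rw [e4] at e1
      rw [ratPair_sub]
      simp only [hμ]
      ext l
      have := congrFun e1 l
      simp only [Pi.sub_apply, Pi.add_apply, Pi.smul_apply, smul_eq_mul] at this ⊢
      linear_combination this
    refine ⟨Q.ratPair (c.2 - ν v₁) w - Q.ratPair (c.2 - ν v₁) w₀, ?_⟩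
    rw [key w hw e, key w₀ hw₀ e₀, sub_smul]
    abel
  have hμ₀ : ∀ w ∈ H, μ w v₀ = 0 := by
    intro w hw
    simp only [hμ, hνdef, hself w hw, hself w₀ hw₀]
    simp [ratPair]
  -- The edge condition at `v₀` gives a scalar for each `v`. To compare it with the scalar of a
  -- fixed `v₁`, use the triangle `v₀, v₁, v`: its third edge condition and the independence of the
  -- edge vectors at `v` and at `v₁` force both scalars to agree.
  obtain ⟨l, hl⟩ : ∃ l : Fin (b + 1) → ℚ, ∀ w ∈ H, ∀ v ∈ G,
      μ w v - μ w₀ v = l w • (P.ratVertex v - P.ratVertex v₀) := by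
    by_cases hG : ∃ v₁ ∈ G, v₁ ≠ v₀
    · obtain ⟨v₁, hv₁, hne⟩ := hG
      have h1 := hdiff v₀ hv₀ v₁ hv₁ hne.symm
      choose! l hl using h1
      have hl' : ∀ w ∈ H, μ w v₁ - μ w₀ v₁ = l w • (P.ratVertex v₁ - P.ratVertex v₀) := by
        intro w hw
        rw [← hl w hw, hμ₀ w hw, hμ₀ w₀ hw₀, sub_zero, sub_zero]
      refine ⟨l, fun w hw v hv => ?_⟩
      by_cases hv0 : v = v₀
      · subst hv0; simp [hμ₀ w hw, hμ₀ w₀ hw₀]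
      by_cases hv1 : v = v₁
      · rw [hv1, hl' w hw]
      obtain ⟨l₂, hl₂⟩ := hdiff v₀ hv₀ v hv (Ne.symm hv0) w hw
      rw [hμ₀ w hw, hμ₀ w₀ hw₀, sub_zero, sub_zero] at hl₂
      obtain ⟨l₃, hl₃⟩ := hdiff v₁ hv₁ v hv (Ne.symm hv1) w hw
      have e : (l₂ - l₃) • (P.ratVertex v - P.ratVertex v₀) =
          (l w - l₃) • (P.ratVertex v₁ - P.ratVertex v₀) := by
        have e1 : l₂ • (P.ratVertex v - P.ratVertex v₀) -
            l w • (P.ratVertex v₁ - P.ratVertex v₀) =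
            l₃ • (P.ratVertex v - P.ratVertex v₁) := by
          rw [← hl₂, ← hl' w hw, ← hl₃]; abel
        ext k
        have := congrFun e1 k
        simp only [Pi.sub_apply, Pi.smul_apply, smul_eq_mul] at this ⊢
        linear_combination this
      have e1 := P.eq_zero_of_smul_ratVertex hv1 hv0 e
      have e2 := P.eq_zero_of_smul_ratVertex (Ne.symm hv1) hne e.symm
      rw [hl₂]
      congr 1
      linarith
    · push Not at hG
      refine ⟨0, fun w hw v hv => ?_⟩
      rw [hG v hv, hμ₀ w hw, hμ₀ w₀ hw₀]
      simp
  -- The defect is realized by a vector paired with the vertices of `Q`. The vector is rational in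
  -- general, since the vertex matrix need not be unimodular.
  obtain ⟨n, κ, hn⟩ := Q.exists_pairing ℚ l
  have hn' : ∀ w, Q.ratPair n w = l w + κ := hn
  -- Adding `n` to every second component contributes the pairing of `n` with `w` times `v - v₀`;
  -- the first component subtracts its value at `w₀`. What survives is `l w - l w₀` times `v - v₀`,
  -- in which `κ` cancels.
  let C : Fin (a + 1) → (Fin a → ℚ) × (Fin b → ℚ) := fun v =>
    (μ w₀ v - Q.ratPair n w₀ • (P.ratVertex v - P.ratVertex v₀), n + ν v)
  have hν₀ : ν v₀ = 0 := by simp only [hνdef, hself w₀ hw₀]; rfl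
  have hC : ∀ v ∈ G, ∀ w ∈ H, δ w v₀ v = P.shift Q v w (C v) - P.shift Q v₀ w (C v₀) := by
    intro v hv w hw
    refine Prod.ext ?_ ?_
    · have h1 := hl w hw v hv
      have h2 := hl w₀ hw₀ v hv
      have e0 : (δ w v₀ v).1 = μ w v + Q.ratPair (ν v) w • P.ratVertex v := by simp [hμ]
      rw [e0]
      simp only [C, shift_apply, Prod.fst_sub, hν₀, add_zero, hμ₀ w₀ hw₀, ratPair_add, hn']
      ext k
      have h1' := congrFun h1 k
      have h2' := congrFun h2 k
      simp only [Pi.sub_apply, Pi.add_apply, Pi.smul_apply, smul_eq_mul, Pi.zero_apply] at h1' h2' ⊢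
      linear_combination h1' - h2'
    · simp only [C, shift_apply, Prod.snd_sub, hν₀]
      rw [hν v hv w hw]
      simp [hνdef]
  refine ⟨C, fun v hv v' hv' w hw => ?_⟩
  rw [eq_sub_of_add_eq' (hδ w hw v₀ v v'), hC v hv w hw, hC v' hv' w hw]
  abel

end LatticeSimplex

/-! ### Chambers and skeleta -/

namespace LatticeSimplex

variable {d : ℕ} (P : LatticeSimplex d)

theorem pair_add (x y : Fin d → ℝ) (i : Fin (d + 1)) :
    P.pair (x + y) i = P.pair x i + P.pair y i := by
  simp [pair, add_mul, Finset.sum_add_distrib]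

theorem pair_smul (t : ℝ) (x : Fin d → ℝ) (i : Fin (d + 1)) :
    P.pair (t • x) i = t * P.pair x i := by
  simp [pair, Finset.mul_sum, mul_assoc]

theorem pair_zero (i : Fin (d + 1)) : P.pair 0 i = 0 := by simp [pair]

theorem continuous_pair (i : Fin (d + 1)) : Continuous fun x => P.pair x i := by
  unfold pair; fun_prop

theorem exists_pair (f : Fin (d + 1) → ℝ) : ∃ (x : Fin d → ℝ) (c : ℝ), ∀ i, P.pair x i = f i + c :=
  P.exists_pairing ℝ f

theorem isOpen_chamber (i : Fin (d + 1)) : IsOpen (P.chamber i) := by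
  have : P.chamber i = ⋂ j : {j // j ≠ i}, {x | P.pair x i < P.pair x j} := by
    ext x; simp [chamber]
  rw [this]
  exact isOpen_iInter_of_finite fun j => isOpen_lt (P.continuous_pair i) (P.continuous_pair j)

theorem convex_chamber (i : Fin (d + 1)) : Convex ℝ (P.chamber i) := by
  intro x hx y hy s t hs ht hst j hj
  rw [pair_add, pair_add, pair_smul, pair_smul, pair_smul, pair_smul]
  have h1 := hx j hj
  have h2 := hy j hj
  rcases hs.eq_or_lt with rfl | hs
  · have : t = 1 := by linarith
    subst this; linarith
  · have := mul_lt_mul_of_pos_left h1 hs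
    have := mul_le_mul_of_nonneg_left h2.le ht
    linarith

theorem eq_of_mem_chamber {x : Fin d → ℝ} {i j : Fin (d + 1)} (hi : x ∈ P.chamber i)
    (hj : x ∈ P.chamber j) : i = j := by
  by_contra h
  exact lt_asymm (hi j (Ne.symm h)) (hj i h)

theorem notMem_skeleton_iff {x : Fin d → ℝ} : x ∉ P.skeleton ↔ ∃ i, x ∈ P.chamber i := by
  constructor
  · intro h
    obtain ⟨i, hi⟩ := Finite.exists_min (P.pair x)
    refine ⟨i, fun j hj => lt_of_le_of_ne (hi j) fun e => h ⟨i, j, hj.symm, e, hi⟩⟩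
  · rintro ⟨i, hi⟩ ⟨j, k, hjk, e, hmin⟩
    have hj : j = i := by
      by_contra hj
      exact absurd (hi j hj) (not_lt.2 (hmin i))
    subst hj
    exact absurd (hi k hjk.symm) (by rw [e]; exact lt_irrefl _)

theorem isOpen_compl_skeleton : IsOpen P.skeletonᶜ := by
  have : P.skeletonᶜ = ⋃ i, P.chamber i := by
    ext x; simp [notMem_skeleton_iff]
  rw [this]
  exact isOpen_iUnion P.isOpen_chamber

/-- The vertices at which the minimum is attained. -/
def minimizers (x : Fin d → ℝ) : Set (Fin (d + 1)) := {i | ∀ j, P.pair x i ≤ P.pair x j}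

theorem exists_mem_minimizers (x : Fin d → ℝ) : ∃ i, i ∈ P.minimizers x :=
  Finite.exists_min (P.pair x)

/-- A direction that points from the cone of the vertices `i` in `s` into its interior. -/
theorem exists_direction (s : Set (Fin (d + 1))) : ∃ ξ : Fin d → ℝ,
    (∀ i ∈ s, ∀ j ∈ s, P.pair ξ i = P.pair ξ j) ∧ ∀ i ∈ s, ∀ j ∉ s, P.pair ξ i < P.pair ξ j := by
  classical
  -- Only comparisons between vertices matter, so the uncontrolled constant `c` does no harm.
  obtain ⟨ξ, c, h⟩ := P.exists_pair fun i => if i ∈ s then -1 else 0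
  refine ⟨ξ, fun i hi j hj => ?_, fun i hi j hj => ?_⟩
  · rw [h, h, if_pos hi, if_pos hj]
  · rw [h, h, if_pos hi, if_neg hj]; linarith

theorem mem_chamber_of_direction {x ξ : Fin d → ℝ} {i : Fin (d + 1)} (hi : i ∈ P.minimizers x)
    (hξ : ∀ j, j ≠ i → P.pair ξ i < P.pair ξ j) {t : ℝ} (ht : 0 < t) : x + t • ξ ∈ P.chamber i := by
  intro j hj
  rw [pair_add, pair_add, pair_smul, pair_smul]
  have := mul_lt_mul_of_pos_left (hξ j hj) ht
  linarith [hi j]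

/-- A vertex that is not minimizing at `x` is strictly beaten by another one, and this persists
nearby. So only the chambers of minimizing vertices meet a small ball. -/
theorem eventually_notMem_chamber (x : Fin d → ℝ) :
    ∀ᶠ y in 𝓝 x, ∀ i, i ∉ P.minimizers x → y ∉ P.chamber i := by
  refine Filter.eventually_all.2 fun i => ?_
  by_cases hi : i ∈ P.minimizers x
  · exact Filter.Eventually.of_forall fun y h => (h hi).elim
  · have : ∃ j, P.pair x j < P.pair x i := by simpa [minimizers] using hi
    obtain ⟨j, hj⟩ := this
    filter_upwards [(P.continuous_pair j).continuousAt.eventually_lt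
      (P.continuous_pair i).continuousAt hj] with y hy _ hyi
    have hji : j ≠ i := by rintro rfl; exact lt_irrefl _ hj
    exact lt_asymm hy (hyi j hji)

theorem eventually_mem_chamber (x : Fin d → ℝ) :
    ∀ᶠ y in 𝓝 x, ∀ i, x ∈ P.chamber i → y ∈ P.chamber i := by
  refine Filter.eventually_all.2 fun i => ?_
  by_cases hi : x ∈ P.chamber i
  · filter_upwards [(P.isOpen_chamber i).mem_nhds hi] with y hy _ using hy
  · exact Filter.Eventually.of_forall fun y h => (hi h).elim

end LatticeSimplex

/-! ### One factor of a symple model -/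

section Factor

variable {a b : ℕ} (P : LatticeSimplex a) (Q : LatticeSimplex b)
  {E : Type*} [NormedAddCommGroup E] [NormedSpace ℝ E]
  (x : E →L[ℝ] (Fin a → ℝ)) (y : E →L[ℝ] (Fin b → ℝ))

/-- The pullback to `E` of the domain of the frame that belongs to the vertex `v`. -/
def factorDom (v : Fin (a + 1)) : Set E := {z | x z ∈ P.chamber v ∨ y z ∉ Q.skeleton}

theorem factorDom_eq (v : Fin (a + 1)) :
    factorDom P Q x y v = x ⁻¹' P.chamber v ∪ ⋃ w ∈ Finset.univ, y ⁻¹' Q.chamber w := by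
  ext z
  simp [factorDom, LatticeSimplex.notMem_skeleton_iff]

theorem isOpen_factorDom (v : Fin (a + 1)) : IsOpen (factorDom P Q x y v) :=
  ((P.isOpen_chamber v).preimage x.continuous).union
    (Q.isOpen_compl_skeleton.preimage y.continuous)

theorem mem_factorDom_of_chamber {w : Fin (b + 1)} {z : E} (hz : y z ∈ Q.chamber w)
    (v : Fin (a + 1)) : z ∈ factorDom P Q x y v := Or.inr (Q.notMem_skeleton_iff.2 ⟨w, hz⟩)

/-- Sections over `O` of the pushforward of the local system of a symple model. -/
structure IsFactorSection (O : Set E) (s : Fin (a + 1) → E → (Fin a → ℚ) × (Fin b → ℚ)) :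
    Prop where
  locConst : ∀ v, LocConstOn (s v) (O ∩ factorDom P Q x y v)
  shift_eq : ∀ w v v', ∀ z ∈ O, y z ∈ Q.chamber w →
    P.shift Q v w (s v z) = P.shift Q v' w (s v' z)

variable {P Q x y}

/-- Near `p` there are points other than `p` on the stratum of the discriminant that is dual
to a pair of edges. -/
theorem exists_near_stratum [FiniteDimensional ℝ E] (hE : 3 ≤ Module.finrank ℝ E)
    (hxy : ∀ ξ η, ∃ e, x e = ξ ∧ y e = η) (p : E) {ε : ℝ} (hε : 0 < ε)
    {v v' : Fin (a + 1)} (hv : v ∈ P.minimizers (x p)) (hv' : v' ∈ P.minimizers (x p))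
    (hvv : v ≠ v') {w w' : Fin (b + 1)} (hw : w ∈ Q.minimizers (y p))
    (hw' : w' ∈ Q.minimizers (y p)) (hww : w ≠ w') :
    ∃ z ∈ Metric.ball p ε \ {p}, ∀ N ∈ 𝓝 z, ∀ i ∈ ({v, v'} : Set _), ∀ j ∈ ({w, w'} : Set _),
      ∃ q ∈ N, x q ∈ P.chamber i ∧ y q ∈ Q.chamber j := by
  -- A nonzero direction tangent to the closed stratum. If `P` or `Q` has a third vertex, it can be
  -- chosen in that simplex's coordinate alone, pointing into the cone dual to the edge.
  obtain ⟨k, hk0, hkP, hkQ⟩ : ∃ k : E, k ≠ 0 ∧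
      (∀ i ∈ ({v, v'} : Set _), ∀ j, P.pair (x k) i ≤ P.pair (x k) j) ∧
      (∀ i ∈ ({w, w'} : Set _), ∀ j, Q.pair (y k) i ≤ Q.pair (y k) j) := by
    by_cases hP : ∃ u, u ∉ ({v, v'} : Set _)
    · obtain ⟨u, hu⟩ := hP
      obtain ⟨ξ, h1, h2⟩ := P.exists_direction {v, v'}
      obtain ⟨e, rfl, he⟩ := hxy ξ 0
      refine ⟨e, ?_, fun i hi j => ?_, fun i hi j => ?_⟩
      · rintro rfl
        have := h2 v (by simp) u hu
        simp [LatticeSimplex.pair_zero] at this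
      · by_cases hj : j ∈ ({v, v'} : Set _)
        exacts [(h1 i hi j hj).le, (h2 i hi j hj).le]
      · simp [he, LatticeSimplex.pair_zero]
    by_cases hQ : ∃ u, u ∉ ({w, w'} : Set _)
    · obtain ⟨u, hu⟩ := hQ
      obtain ⟨η, h1, h2⟩ := Q.exists_direction {w, w'}
      obtain ⟨e, he, rfl⟩ := hxy 0 η
      refine ⟨e, ?_, fun i hi j => ?_, fun i hi j => ?_⟩
      · rintro rfl
        have := h2 w (by simp) u hu
        simp [LatticeSimplex.pair_zero] at this
      · simp [he, LatticeSimplex.pair_zero]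
      · by_cases hj : j ∈ ({w, w'} : Set _)
        exacts [(h1 i hi j hj).le, (h2 i hi j hj).le]
    push Not at hP hQ
    -- Both simplices are now segments, and the stratum is cut out by two linear equations. The
    -- dimension is at least 3, so they have a nonzero common solution.
    let L : E →ₗ[ℝ] ℝ × ℝ :=
      { toFun := fun e => (P.pair (x e) v - P.pair (x e) v', Q.pair (y e) w - Q.pair (y e) w')
        map_add' := fun e e' => by
          simp only [map_add, LatticeSimplex.pair_add, Prod.mk_add_mk, Prod.mk.injEq]
          constructor <;> ring
        map_smul' := fun t e => by
          simp only [map_smul, LatticeSimplex.pair_smul, RingHom.id_apply, Prod.smul_mk,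
            smul_eq_mul, Prod.mk.injEq]
          constructor <;> ring }
    have hL : LinearMap.ker L ≠ ⊥ := LinearMap.ker_ne_bot_of_finrank_lt (by simp; omega)
    obtain ⟨k, hk, hk0⟩ := (Submodule.ne_bot_iff _).1 hL
    have hk' : L k = 0 := hk
    have h1 : P.pair (x k) v = P.pair (x k) v' := sub_eq_zero.1 (congrArg Prod.fst hk')
    have h2 : Q.pair (y k) w = Q.pair (y k) w' := sub_eq_zero.1 (congrArg Prod.snd hk')
    refine ⟨k, hk0, fun i hi j => ?_, fun i hi j => ?_⟩
    · rcases hi with rfl | rfl <;> rcases hP j with rfl | rfl <;> simp [h1]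
    · rcases hi with rfl | rfl <;> rcases hQ j with rfl | rfl <;> simp [h2]
  have hkn : 0 < ‖k‖ := norm_pos_iff.2 hk0
  obtain ⟨t, ht, htε⟩ : ∃ t : ℝ, 0 < t ∧ ‖t • k‖ < ε := by
    refine ⟨ε / 2 / ‖k‖, by positivity, ?_⟩
    rw [norm_smul, Real.norm_of_nonneg (by positivity), div_mul_cancel₀ _ hkn.ne']
    linarith
  refine ⟨p + t • k, ⟨by simpa using htε, ?_⟩, ?_⟩
  · simp [ht.ne', hk0]
  intro N hN i hi j hj
  have hiP : i ∈ P.minimizers (x p) := by rcases hi with rfl | rfl <;> assumption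
  have hjQ : j ∈ Q.minimizers (y p) := by rcases hj with rfl | rfl <;> assumption
  have hi' : i ∈ P.minimizers (x (p + t • k)) := fun l => by
    simp only [map_add, map_smul, LatticeSimplex.pair_add, LatticeSimplex.pair_smul]
    have := mul_le_mul_of_nonneg_left (hkP i hi l) ht.le
    linarith [hiP l]
  have hj' : j ∈ Q.minimizers (y (p + t • k)) := fun l => by
    simp only [map_add, map_smul, LatticeSimplex.pair_add, LatticeSimplex.pair_smul]
    have := mul_le_mul_of_nonneg_left (hkQ j hj l) ht.le
    linarith [hjQ l]
  -- A small move from the stratum in suitable directions reaches any chosen pair of chambers,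
  -- because `i` and `j` are still minimizing at the new point.
  obtain ⟨ξ, -, hξ⟩ := P.exists_direction {i}
  obtain ⟨η, -, hη⟩ := Q.exists_direction {j}
  obtain ⟨m, rfl, rfl⟩ := hxy ξ η
  have hlim : Filter.Tendsto (fun s : ℝ => p + t • k + s • m) (𝓝[>] 0) (𝓝 (p + t • k)) := by
    have : Continuous fun s : ℝ => p + t • k + s • m := by fun_prop
    have h := this.tendsto 0
    simp only [zero_smul, add_zero] at h
    exact h.mono_left nhdsWithin_le_nhds
  obtain ⟨s, hs, hs0⟩ := ((hlim.eventually hN).and self_mem_nhdsWithin).exists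
  refine ⟨_, hs, ?_, ?_⟩
  · rw [map_add, map_smul x s m]
    exact P.mem_chamber_of_direction hi' (fun l hl => hξ i rfl l hl) hs0
  · rw [map_add, map_smul y s m]
    exact Q.mem_chamber_of_direction hj' (fun l hl => hη j rfl l hl) hs0

variable (P Q x y) in
/-- The conditions on the radius of a ball around `p` for one factor. -/
def IsSmallBall (p : E) (ε : ℝ) : Prop :=
  ∀ z ∈ Metric.ball p ε, (∀ v, v ∉ P.minimizers (x p) → x z ∉ P.chamber v) ∧
    (∀ w, w ∉ Q.minimizers (y p) → y z ∉ Q.chamber w) ∧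
    (∀ v, x p ∈ P.chamber v → x z ∈ P.chamber v) ∧
    (∀ w, y p ∈ Q.chamber w → y z ∈ Q.chamber w)

theorem eventually_ball {X : Type*} [PseudoMetricSpace X] {p : X} {q : X → Prop}
    (h : ∀ᶠ z in 𝓝 p, q z) : ∀ᶠ ε in 𝓝[>] (0 : ℝ), ∀ z ∈ Metric.ball p ε, q z := by
  obtain ⟨r, hr, hq⟩ := Metric.eventually_nhds_iff_ball.1 h
  filter_upwards [Ioo_mem_nhdsGT hr] with ε hε z hz
  exact hq z (Metric.ball_subset_ball hε.2.le hz)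

variable (P Q x y) in
theorem eventually_isSmallBall (p : E) : ∀ᶠ ε in 𝓝[>] (0 : ℝ), IsSmallBall P Q x y p ε := by
  refine eventually_ball ?_
  filter_upwards [x.continuous.continuousAt.eventually (P.eventually_notMem_chamber (x p)),
    y.continuous.continuousAt.eventually (Q.eventually_notMem_chamber (y p)),
    x.continuous.continuousAt.eventually (P.eventually_mem_chamber (x p)),
    y.continuous.continuousAt.eventually (Q.eventually_mem_chamber (y p))] with z h1 h2 h3 h4
  exact ⟨h1, h2, h3, h4⟩

/-- If `p` lies in the frame domain, so does the whole small ball, and the set is a punctured ball.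
Otherwise the puncture is invisible, and the set is the convex part over the chamber of `v` together
with disjoint convex parts over the chambers of `Q`. -/
theorem IsSmallBall.constCechTrivial {p : E} {ε : ℝ} (hs : IsSmallBall P Q x y p ε) (hε : 0 < ε)
    (hE : 3 ≤ Module.finrank ℝ E) (A : Type v) [AddCommGroup A] (v : Fin (a + 1)) :
    ConstCechTrivial.{u} A (factorDom P Q x y v ∩ (Metric.ball p ε \ {p})) := by
  by_cases hp : p ∈ factorDom P Q x y v
  · have : factorDom P Q x y v ∩ (Metric.ball p ε \ {p}) = Metric.ball p ε \ {p} := by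
      refine Set.inter_eq_right.2 fun z hz => ?_
      rcases hp with hp | hp
      · exact Or.inl ((hs z hz.1).2.2.1 v hp)
      · obtain ⟨w, hw⟩ := Q.notMem_skeleton_iff.1 hp
        exact mem_factorDom_of_chamber P Q x y ((hs z hz.1).2.2.2 w hw) v
    rw [this]
    exact ConstCechTrivial.ball_diff_singleton A p hε hE
  · have : factorDom P Q x y v ∩ (Metric.ball p ε \ {p}) = (x ⁻¹' P.chamber v ∩ Metric.ball p ε) ∪
        ⋃ w ∈ Finset.univ, (y ⁻¹' Q.chamber w ∩ Metric.ball p ε) := by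
      rw [← Set.inter_sdiff_assoc, Set.sdiff_singleton_eq_self fun h => hp h.1, factorDom_eq,
        Set.union_inter_distrib_right, Set.iUnion₂_inter]
    rw [this]
    refine ConstCechTrivial.union_biUnion _
      (((P.isOpen_chamber v).preimage x.continuous).inter Metric.isOpen_ball)
      (fun w => ((Q.isOpen_chamber w).preimage y.continuous).inter Metric.isOpen_ball)
      (((P.convex_chamber v).is_linear_preimage x.toLinearMap.isLinear).inter (convex_ball _ _))
      (fun w => ((Q.convex_chamber w).is_linear_preimage y.toLinearMap.isLinear).inter
        (convex_ball _ _)) fun w w' hww => ?_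
    rw [Set.disjoint_left]
    rintro z ⟨hz, -⟩ ⟨hz', -⟩
    exact hww (Q.eq_of_mem_chamber hz hz')

/-- Either the chamber contains the whole small ball, leaving a punctured ball, or it misses `p` and
the set is convex. -/
theorem IsSmallBall.isPreconnected {p : E} {ε : ℝ} (hs : IsSmallBall P Q x y p ε) (hε : 0 < ε)
    (hE : 3 ≤ Module.finrank ℝ E) (w : Fin (b + 1)) :
    IsPreconnected (y ⁻¹' Q.chamber w ∩ (Metric.ball p ε \ {p})) := by
  by_cases hp : y p ∈ Q.chamber w
  · have : y ⁻¹' Q.chamber w ∩ (Metric.ball p ε \ {p}) = Metric.ball p ε \ {p} :=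
      Set.inter_eq_right.2 fun z hz => (hs z hz.1).2.2.2 w hp
    rw [this]
    exact isPreconnected_ball_diff_singleton p hε (by omega)
  · rw [← Set.inter_sdiff_assoc, Set.sdiff_singleton_eq_self fun h => hp h.1]
    exact (((Q.convex_chamber w).is_linear_preimage y.toLinearMap.isLinear).inter
      (convex_ball _ _)).isPreconnected

end Factor

/-! ### Gluing the trivializations of one factor -/

section FactorCech

variable {a b : ℕ} {P : LatticeSimplex a} {Q : LatticeSimplex b}
  {E : Type*} [NormedAddCommGroup E] [NormedSpace ℝ E]
  {x : E →L[ℝ] (Fin a → ℝ)} {y : E →L[ℝ] (Fin b → ℝ)}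

/-- Sections over the union of the domains of the frames that belong to minimizing vertices at `p`
extend to the remaining frames. -/
theorem IsSmallBall.exists_isFactorSection {p : E} {ε : ℝ} (hs : IsSmallBall P Q x y p ε)
    {v₀ : Fin (a + 1)} (hv₀ : v₀ ∈ P.minimizers (x p)) {O : Set E}
    (hO : O ⊆ Metric.ball p ε)
    (s : Fin (a + 1) → E → (Fin a → ℚ) × (Fin b → ℚ))
    (hs1 : ∀ v ∈ P.minimizers (x p), LocConstOn (s v) (O ∩ factorDom P Q x y v))
    (hs2 : ∀ w, ∀ v ∈ P.minimizers (x p), ∀ v' ∈ P.minimizers (x p), ∀ z ∈ O, y z ∈ Q.chamber w →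
      P.shift Q v w (s v z) = P.shift Q v' w (s v' z)) :
    ∃ s', IsFactorSection P Q x y O s' ∧ (∀ v ∈ P.minimizers (x p), s' v = s v) ∧
      ∀ v w, ∀ z ∈ O, y z ∈ Q.chamber w →
        P.shift Q v w (s' v z) = P.shift Q v₀ w (s v₀ z) := by
  classical
  let ω : E → Fin (b + 1) := fun z => if h : ∃ w, y z ∈ Q.chamber w then h.choose else 0
  have hω : ∀ z w, y z ∈ Q.chamber w → ω z = w := by
    intro z w hw
    have h : ∃ w, y z ∈ Q.chamber w := ⟨w, hw⟩
    have e : ω z = h.choose := dif_pos h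
    rw [e]
    exact Q.eq_of_mem_chamber h.choose_spec hw
  -- The chamber of a non-minimizing vertex misses the ball, so there its frame lives only over the
  -- chambers of `Q`, where the coordinate change from the frame `v₀` determines the section.
  let s' : Fin (a + 1) → E → (Fin a → ℚ) × (Fin b → ℚ) := fun v z =>
    if v ∈ P.minimizers (x p) then s v z
    else (P.shift Q v (ω z)).symm (P.shift Q v₀ (ω z) (s v₀ z))
  have key : ∀ v w, ∀ z ∈ O, y z ∈ Q.chamber w →
      P.shift Q v w (s' v z) = P.shift Q v₀ w (s v₀ z) := by
    intro v w z hz hw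
    by_cases hv : v ∈ P.minimizers (x p)
    · simp only [s', if_pos hv]
      exact hs2 w v hv v₀ hv₀ z hz hw
    · simp only [s', if_neg hv, hω z w hw, AddEquiv.apply_symm_apply]
  refine ⟨s', ⟨fun v => ?_, fun w v v' z hz hw => by rw [key v w z hz hw, key v' w z hz hw]⟩,
    fun v hv => by funext z; simp only [s', if_pos hv], key⟩
  by_cases hv : v ∈ P.minimizers (x p)
  · have : s' v = s v := by funext z; simp only [s', if_pos hv]
    rw [this]
    exact hs1 v hv
  · rintro z ⟨hzO, hz⟩
    have hzQ : ∃ w, y z ∈ Q.chamber w := by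
      rcases hz with hz | hz
      · exact ((hs z (hO hzO)).1 v hv hz).elim
      · exact Q.notMem_skeleton_iff.1 hz
    obtain ⟨w, hw⟩ := hzQ
    filter_upwards [hs1 v₀ hv₀ z ⟨hzO, mem_factorDom_of_chamber P Q x y hw v₀⟩,
      ((Q.isOpen_chamber w).preimage y.continuous).mem_nhds hw] with z' h1 h2
    simp only [s', if_neg hv, hω z w hw, hω z' w h2, h1]

/-- Čech `1`-cocycles of a symple model are coboundaries on small punctured balls. -/
theorem IsSmallBall.cech [FiniteDimensional ℝ E] (hE : 3 ≤ Module.finrank ℝ E)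
    (hxy : ∀ ξ η, ∃ e, x e = ξ ∧ y e = η) {p : E} {ε : ℝ} (hε : 0 < ε)
    (hs : IsSmallBall P Q x y p ε) {ι : Type u} (U : ι → Set E) (hU : ∀ i, IsOpen (U i))
    (hcov : Metric.ball p ε \ {p} ⊆ ⋃ i, U i)
    (f : ι → ι → Fin (a + 1) → E → (Fin a → ℚ) × (Fin b → ℚ))
    (hf : ∀ i j, IsFactorSection P Q x y (U i ∩ U j ∩ (Metric.ball p ε \ {p})) (f i j))
    (hcoc : ∀ i j k v, ∀ z ∈ factorDom P Q x y v ∩ (Metric.ball p ε \ {p}), z ∈ U i → z ∈ U j →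
      z ∈ U k → f i j v z + f j k v z = f i k v z) :
    ∃ h : ι → Fin (a + 1) → E → (Fin a → ℚ) × (Fin b → ℚ),
      (∀ i, IsFactorSection P Q x y (U i ∩ (Metric.ball p ε \ {p})) (h i)) ∧
      ∀ i j v, ∀ z ∈ factorDom P Q x y v ∩ (Metric.ball p ε \ {p}), z ∈ U i → z ∈ U j →
        f i j v z = h j v z - h i v z := by
  set V := Metric.ball p ε \ {p} with hV
  have hVo : IsOpen V := Metric.isOpen_ball.sdiff isClosed_singleton
  have ht : ∀ v, ∃ t : ι → E → (Fin a → ℚ) × (Fin b → ℚ),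
      (∀ i, LocConstOn (t i) (U i ∩ (factorDom P Q x y v ∩ V))) ∧
      ∀ i j, ∀ z ∈ factorDom P Q x y v ∩ V, z ∈ U i → z ∈ U j → f i j v z = t j z - t i z :=
    fun v => hs.constCechTrivial hε hE _ v ι U hU (Set.inter_subset_right.trans hcov)
      (fun i j => f i j v)
      (fun i j => ((hf i j).locConst v).mono fun z hz => ⟨⟨hz.1, hz.2.2⟩, hz.2.1⟩)
      (fun i j k z hz => hcoc i j k v z hz)
  choose t ht1 ht2 using ht
  have hdom : ∀ {w z}, y z ∈ Q.chamber w → ∀ v, z ∈ factorDom P Q x y v := fun hz v =>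
    mem_factorDom_of_chamber P Q x y hz v
  -- The differences between the trivializations are constant over the chambers of `Q`.
  have hconst : ∀ w v v', ∃ c, ∀ i, ∀ z ∈ V, z ∈ U i → y z ∈ Q.chamber w →
      P.shift Q v' w (t v' i z) - P.shift Q v w (t v i z) = c := by
    intro w v v'
    -- The cocycle itself is compatible with the coordinate changes, so it cancels and the
    -- difference does not depend on the member of the covering.
    have hind : ∀ i j, ∀ z ∈ V, z ∈ U i → z ∈ U j → y z ∈ Q.chamber w →
        P.shift Q v' w (t v' i z) - P.shift Q v w (t v i z) =
          P.shift Q v' w (t v' j z) - P.shift Q v w (t v j z) := by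
      intro i j z hz hi hj hw
      have h1 := (hf i j).shift_eq w v v' z ⟨⟨hi, hj⟩, hz⟩ hw
      rw [ht2 v i j z ⟨hdom hw v, hz⟩ hi hj, ht2 v' i j z ⟨hdom hw v', hz⟩ hi hj, map_sub,
        map_sub, sub_eq_sub_iff_add_eq_add] at h1
      rw [sub_eq_sub_iff_add_eq_add, add_comm, h1]
    rcases (y ⁻¹' Q.chamber w ∩ V).eq_empty_or_nonempty with he | ⟨z₀, hz₀⟩
    · refine ⟨0, fun i z hz hi hw => ?_⟩
      have : z ∈ y ⁻¹' Q.chamber w ∩ V := ⟨hw, hz⟩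
      simp [he] at this
    have hcov' : ∀ z, z ∈ y ⁻¹' Q.chamber w ∩ V → ∃ i, z ∈ U i := fun z hz => by
      simpa using hcov hz.2
    have : Nonempty ι := ⟨(hcov' z₀ hz₀).choose⟩
    choose! idx hidx using hcov'
    have hl : LocConstOn (fun z => P.shift Q v' w (t v' (idx z) z) -
        P.shift Q v w (t v (idx z) z)) (y ⁻¹' Q.chamber w ∩ V) := by
      intro z hz
      filter_upwards [ht1 v (idx z) z ⟨hidx z hz, hdom hz.1 v, hz.2⟩,
        ht1 v' (idx z) z ⟨hidx z hz, hdom hz.1 v', hz.2⟩,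
        (((Q.isOpen_chamber w).preimage y.continuous).inter hVo).mem_nhds hz,
        (hU (idx z)).mem_nhds (hidx z hz)] with z' h1 h2 h3 h4
      rw [hind (idx z') (idx z) z' h3.2 (hidx z' h3) h4 h3.1, h1, h2]
    obtain ⟨c, hc⟩ := hl.exists_const (hs.isPreconnected hε hE w)
    exact ⟨c, fun i z hz hi hw => by
      rw [← hc z ⟨hw, hz⟩, hind i (idx z) z hz hi (hidx z ⟨hw, hz⟩) hw]⟩
  obtain ⟨v₀, hv₀⟩ := P.exists_mem_minimizers (x p)
  obtain ⟨w₀, hw₀⟩ := Q.exists_mem_minimizers (y p)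
  choose e he using fun w v => hconst w v₀ v
  have hδ : ∀ w v v' i, ∀ z ∈ V, z ∈ U i → y z ∈ Q.chamber w →
      e w v' - e w v = P.shift Q v' w (t v' i z) - P.shift Q v w (t v i z) := by
    intro w v v' i z hz hi hw
    rw [← he w v i z hz hi hw, ← he w v' i z hz hi hw]
    abel
  obtain ⟨C, hC⟩ := P.exists_trivialization Q (P.minimizers (x p)) (Q.minimizers (y p)) hv₀ hw₀
    (fun w v v' => e w v' - e w v) (fun w _ v v' v'' => by abel) (by
      intro v hv v' hv' hvv w hw w' hw' hww
      -- Around this point a single member `U i` of the covering meets all four products of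
      -- chambers. On a small ball `t u i` is constant over the chamber of `u` in `P` and over each
      -- chamber of `Q`.
      obtain ⟨z, hz, hN⟩ := exists_near_stratum hE hxy p hε hv hv' hvv hw hw' hww
      obtain ⟨i, hi⟩ : ∃ i, z ∈ U i := by simpa using hcov hz
      obtain ⟨η, hη, hηU⟩ := Metric.isOpen_iff.1 ((hU i).inter hVo) z ⟨hi, hz⟩
      have hlc : ∀ u, ∃ c, ∀ q ∈ x ⁻¹' P.chamber u ∩ Metric.ball z η, t u i q = c := fun u =>
        ((ht1 u i).mono fun q hq =>
          ⟨(hηU hq.2).1, Or.inl hq.1, (hηU hq.2).2⟩).exists_const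
          (((P.convex_chamber u).is_linear_preimage x.toLinearMap.isLinear).inter
            (convex_ball _ _)).isPreconnected
      have hlc' : ∀ u ω, ∃ c, ∀ q ∈ y ⁻¹' Q.chamber ω ∩ Metric.ball z η, t u i q = c := fun u ω =>
        ((ht1 u i).mono fun q hq =>
          ⟨(hηU hq.2).1, hdom hq.1 u, (hηU hq.2).2⟩).exists_const
          (((Q.convex_chamber ω).is_linear_preimage y.toLinearMap.isLinear).inter
            (convex_ball _ _)).isPreconnected
      choose c hc using hlc
      choose c' hc' using hlc'
      -- The two convex pieces meet, so the constant over the chamber of `ω` equals the one over the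
      -- chamber of `u`. It is therefore the same for `w` and `w'`, which is the hypothesis of the
      -- linear algebra.
      have hcc : ∀ u ∈ ({v, v'} : Set _), ∀ ω ∈ ({w, w'} : Set _), c' u ω = c u := by
        intro u hu ω hω
        obtain ⟨q, hqN, hq1, hq2⟩ := hN _ (Metric.ball_mem_nhds z hη) u hu ω hω
        rw [← hc u q ⟨hq1, hqN⟩, hc' u ω q ⟨hq2, hqN⟩]
      have main : ∀ ω ∈ ({w, w'} : Set _),
          e ω v' - e ω v = P.shift Q v' ω (c v') - P.shift Q v ω (c v) := by
        intro ω hω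
        obtain ⟨q, hqN, hq1, hq2⟩ := hN _ (Metric.ball_mem_nhds z hη) v (by simp) ω hω
        rw [hδ ω v v' i q (hηU hqN).2 (hηU hqN).1 hq2, hc' v ω q ⟨hq2, hqN⟩,
          hc' v' ω q ⟨hq2, hqN⟩, hcc v (by simp) ω hω, hcc v' (by simp) ω hω]
      exact ⟨c v, c v', main w (by simp), main w' (by simp)⟩)
  -- After subtraction of the constants `C v`, the trivializations for the minimizing vertices are
  -- compatible over the chambers of `Q`.
  have hext := fun i => hs.exists_isFactorSection hv₀ (O := U i ∩ V)
    (fun z hz => hz.2.1) (fun v z => t v i z - C v)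
    (fun v _ => ((ht1 v i).mono fun z hz => ⟨hz.1.1, hz.2, hz.1.2⟩).comp_left (· - C v))
    (fun w v hv v' hv' z hz hw => by
      have hwm : w ∈ Q.minimizers (y p) := by
        by_contra h
        exact (hs z hz.2.1).2.1 w h hw
      have h1 := hC v hv v' hv' w hwm
      rw [hδ w v v' i z hz.2 hz.1 hw, sub_eq_sub_iff_add_eq_add] at h1
      rw [map_sub, map_sub, sub_eq_sub_iff_add_eq_add, add_comm, add_comm (P.shift Q v' w _), h1,
        add_comm])
  choose h hh1 hh2 hh3 using hext
  refine ⟨h, hh1, fun i j v z hz hi hj => ?_⟩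
  by_cases hv : v ∈ P.minimizers (x p)
  · rw [hh2 i v hv, hh2 j v hv, ht2 v i j z hz hi hj]
    exact (sub_sub_sub_cancel_right _ _ _).symm
  · have hzQ : ∃ w, y z ∈ Q.chamber w := by
      rcases hz.1 with hz' | hz'
      · exact ((hs z hz.2.1).1 v hv hz').elim
      · exact Q.notMem_skeleton_iff.1 hz'
    obtain ⟨w, hw⟩ := hzQ
    apply (P.shift Q v w).injective
    rw [map_sub, hh3 i v w z ⟨hi, hz.2⟩ hw, hh3 j v w z ⟨hj, hz.2⟩ hw,
      (hf i j).shift_eq w v v₀ z ⟨⟨hi, hj⟩, hz.2⟩ hw, ht2 v₀ i j z ⟨hdom hw v₀, hz.2⟩ hi hj,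
      ← map_sub]
    congr 1
    abel

end FactorCech

/-! ### Products of symple models, extended to a vector space -/

namespace SympleModel

variable (S : SympleModel)

/-- The space `∏ⱼ ((ℝ^{aⱼ})^* × ℝ^{bⱼ}) × ℝ^c × ℝ^{c'}`. -/
abbrev RealSpace : Type :=
  (∀ j, (Fin (S.a j) → ℝ) × (Fin (S.b j) → ℝ)) × (Fin S.c → ℝ) × (Fin S.c' → ℝ)

theorem finrank_realSpace : Module.finrank ℝ S.RealSpace = Fintype.card S.Coord := by
  simp [Module.finrank_prod, Module.finrank_pi_fintype, Fintype.card_sum, Fintype.card_sigma]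

/-- The first coordinate of the factor `j`. -/
def xMap (j : Fin S.r) : S.RealSpace →L[ℝ] (Fin (S.a j) → ℝ) :=
  (ContinuousLinearMap.fst ℝ _ _).comp
    ((ContinuousLinearMap.proj (R := ℝ)
      (φ := fun j => (Fin (S.a j) → ℝ) × (Fin (S.b j) → ℝ)) j).comp (ContinuousLinearMap.fst ℝ _ _))

/-- The second coordinate of the factor `j`. -/
def yMap (j : Fin S.r) : S.RealSpace →L[ℝ] (Fin (S.b j) → ℝ) :=
  (ContinuousLinearMap.snd ℝ _ _).comp
    ((ContinuousLinearMap.proj (R := ℝ)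
      (φ := fun j => (Fin (S.a j) → ℝ) × (Fin (S.b j) → ℝ)) j).comp (ContinuousLinearMap.fst ℝ _ _))

theorem xMap_apply (j : Fin S.r) (z : S.RealSpace) : S.xMap j z = (z.1 j).1 := rfl

theorem yMap_apply (j : Fin S.r) (z : S.RealSpace) : S.yMap j z = (z.1 j).2 := rfl

theorem exists_xMap_yMap (j : Fin S.r) (ξ : Fin (S.a j) → ℝ) (η : Fin (S.b j) → ℝ) :
    ∃ e, S.xMap j e = ξ ∧ S.yMap j e = η := by
  classical
  exact ⟨(Function.update 0 j (ξ, η), 0), by simp [xMap_apply], by simp [yMap_apply]⟩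

/-- The domains of the frames. -/
def realDom (v : ∀ j, Fin (S.a j + 1)) : Set S.RealSpace :=
  {z | ∀ j, S.xMap j z ∈ (S.P j).chamber (v j) ∨ S.yMap j z ∉ (S.Q j).skeleton}

/-- The complement of the discriminant. -/
def regular : Set S.RealSpace :=
  {z | ∀ j, S.xMap j z ∉ (S.P j).skeleton ∨ S.yMap j z ∉ (S.Q j).skeleton}

variable {S}

theorem isOpen_realDom (v : ∀ j, Fin (S.a j + 1)) : IsOpen (S.realDom v) := by
  have : S.realDom v = ⋂ j, factorDom (S.P j) (S.Q j) (S.xMap j) (S.yMap j) (v j) := by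
    ext z; simp [realDom, factorDom]
  rw [this]
  exact isOpen_iInter_of_finite fun j => isOpen_factorDom _ _ _ _ _

theorem realDom_subset_factorDom (v : ∀ j, Fin (S.a j + 1)) (j : Fin S.r) :
    S.realDom v ⊆ factorDom (S.P j) (S.Q j) (S.xMap j) (S.yMap j) (v j) := fun _ hz => hz j

theorem realDom_subset_regular (v : ∀ j, Fin (S.a j + 1)) : S.realDom v ⊆ S.regular :=
  fun _ hz j => (hz j).imp_left fun h => (S.P j).notMem_skeleton_iff.2 ⟨_, h⟩

theorem exists_realDom {z : S.RealSpace} (hz : z ∈ S.regular) : ∃ v, z ∈ S.realDom v := by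
  have : ∀ j, ∃ u, S.xMap j z ∈ (S.P j).chamber u ∨ S.yMap j z ∉ (S.Q j).skeleton := by
    intro j
    rcases hz j with h | h
    · obtain ⟨i, hi⟩ := (S.P j).notMem_skeleton_iff.1 h
      exact ⟨i, Or.inl hi⟩
    · exact ⟨0, Or.inr h⟩
  choose v hv using this
  exact ⟨v, hv⟩

/-- At a regular point there is a frame with a prescribed component. -/
theorem exists_frame {z : S.RealSpace} (hz : z ∈ S.regular) (j : Fin S.r) {u : Fin (S.a j + 1)}
    (hu : z ∈ factorDom (S.P j) (S.Q j) (S.xMap j) (S.yMap j) u) :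
    ∃ v, z ∈ S.realDom v ∧ v j = u := by
  classical
  obtain ⟨v, hv⟩ := exists_realDom hz
  refine ⟨Function.update v j u, fun j' => ?_, by simp⟩
  by_cases hj : j' = j
  · subst hj; rw [Function.update_self]; exact hu
  · simpa [Function.update_of_ne hj] using hv j'

/-- Two frames at the same point are related by a choice of chambers. -/
theorem exists_chambers {z : S.RealSpace} {v v' : ∀ j, Fin (S.a j + 1)} (hz : z ∈ S.realDom v)
    (hz' : z ∈ S.realDom v') :
    ∃ w : ∀ j, Fin (S.b j + 1), ∀ j, v j ≠ v' j → S.yMap j z ∈ (S.Q j).chamber (w j) := by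
  have : ∀ j, ∃ w, v j ≠ v' j → S.yMap j z ∈ (S.Q j).chamber w := by
    intro j
    by_cases hy : S.yMap j z ∈ (S.Q j).skeleton
    · refine ⟨0, fun hne => (hne ?_).elim⟩
      exact (S.P j).eq_of_mem_chamber ((hz j).resolve_right (not_not.2 hy))
        ((hz' j).resolve_right (not_not.2 hy))
    · obtain ⟨w, hw⟩ := (S.Q j).notMem_skeleton_iff.1 hy
      exact ⟨w, fun _ => hw⟩
  choose w hw using this
  exact ⟨w, hw⟩

/-- Points close to `z` that lie in chambers of all factors. -/
theorem exists_generic {z : S.RealSpace} {N : Set S.RealSpace} (hN : N ∈ 𝓝 z) :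
    ∃ q ∈ N, ∀ j, S.xMap j q ∉ (S.P j).skeleton ∧ S.yMap j q ∉ (S.Q j).skeleton := by
  choose i hi using fun j => (S.P j).exists_mem_minimizers (S.xMap j z)
  choose k hk using fun j => (S.Q j).exists_mem_minimizers (S.yMap j z)
  choose ξ _ hξ using fun j => (S.P j).exists_direction {i j}
  choose η _ hη using fun j => (S.Q j).exists_direction {k j}
  let m : S.RealSpace := (fun j => (ξ j, η j), 0)
  have hlim : Filter.Tendsto (fun s : ℝ => z + s • m) (𝓝[>] 0) (𝓝 z) := by
    have : Continuous fun s : ℝ => z + s • m := by fun_prop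
    have h := this.tendsto 0
    simp only [zero_smul, add_zero] at h
    exact h.mono_left nhdsWithin_le_nhds
  obtain ⟨s, hs, hs0⟩ := ((hlim.eventually hN).and self_mem_nhdsWithin).exists
  refine ⟨_, hs, fun j => ⟨(S.P j).notMem_skeleton_iff.2 ⟨i j, ?_⟩,
    (S.Q j).notMem_skeleton_iff.2 ⟨k j, ?_⟩⟩⟩
  · rw [map_add, map_smul (S.xMap j) s m]
    exact (S.P j).mem_chamber_of_direction (hi j) (fun l hl => hξ j (i j) rfl l hl) hs0
  · rw [map_add, map_smul (S.yMap j) s m]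
    exact (S.Q j).mem_chamber_of_direction (hk j) (fun l hl => hη j (k j) rfl l hl) hs0

theorem dense_regular : Dense S.regular := by
  intro z
  rw [mem_closure_iff_nhds]
  intro N hN
  obtain ⟨q, hq, h⟩ := exists_generic hN
  exact ⟨q, hq, fun j => Or.inl (h j).1⟩

theorem mem_ball_iff {p z : S.RealSpace} {η : ℝ} (hη : 0 < η) : z ∈ Metric.ball p η ↔
    (∀ j, dist (z.1 j).1 (p.1 j).1 < η ∧ dist (z.1 j).2 (p.1 j).2 < η) ∧ dist z.2 p.2 < η := by
  rw [Metric.mem_ball, Prod.dist_eq, max_lt_iff, dist_pi_lt_iff hη]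
  simp only [Prod.dist_eq, max_lt_iff]

/-- Any regular `z` is joined to a fixed generic `r` by two segments. In each factor, the first
segment moves one coordinate while the other stays off its skeleton; the second segment moves the
remaining coordinate, with the first now fixed at its generic value. Mixed coordinates stay in the
ball because the metric is a maximum. -/
theorem isPreconnected_ball_inter_regular (p : S.RealSpace) {η : ℝ} (hη : 0 < η) :
    IsPreconnected (Metric.ball p η ∩ S.regular) := by
  classical
  obtain ⟨r, hr, hreg⟩ := exists_generic (Metric.ball_mem_nhds p hη)
  refine isPreconnected_of_forall r fun z hz => ?_
  let z' : S.RealSpace := (fun j => if S.yMap j z ∉ (S.Q j).skeleton then ((r.1 j).1, (z.1 j).2)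
    else ((z.1 j).1, (r.1 j).2), r.2)
  have hpos : ∀ j, S.yMap j z ∉ (S.Q j).skeleton → z'.1 j = ((r.1 j).1, (z.1 j).2) :=
    fun j h => if_pos h
  have hneg : ∀ j, ¬ S.yMap j z ∉ (S.Q j).skeleton → z'.1 j = ((z.1 j).1, (r.1 j).2) :=
    fun j h => if_neg h
  have hz' : z' ∈ Metric.ball p η := by
    have h1 := (mem_ball_iff hη).1 hz.1
    have h2 := (mem_ball_iff hη).1 hr
    refine (mem_ball_iff hη).2 ⟨fun j => ?_, h2.2⟩
    by_cases h : S.yMap j z ∉ (S.Q j).skeleton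
    · rw [hpos j h]
      exact ⟨(h2.1 j).1, (h1.1 j).2⟩
    · rw [hneg j h]
      exact ⟨(h1.1 j).1, (h2.1 j).2⟩
  have hsegx : ∀ (q q' m : S.RealSpace) (j : Fin S.r), m ∈ segment ℝ q q' →
      S.xMap j q = S.xMap j q' → S.xMap j m = S.xMap j q := by
    rintro q q' m j ⟨s, t, -, -, hst, rfl⟩ h
    rw [map_add, map_smul, map_smul, ← h, ← add_smul, hst, one_smul]
  have hsegy : ∀ (q q' m : S.RealSpace) (j : Fin S.r), m ∈ segment ℝ q q' →
      S.yMap j q = S.yMap j q' → S.yMap j m = S.yMap j q := by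
    rintro q q' m j ⟨s, t, -, -, hst, rfl⟩ h
    rw [map_add, map_smul, map_smul, ← h, ← add_smul, hst, one_smul]
  refine ⟨segment ℝ z z' ∪ segment ℝ z' r, ?_, Or.inr (right_mem_segment ℝ _ _),
    Or.inl (left_mem_segment ℝ _ _), ?_⟩
  · rintro m (hm | hm)
    · refine ⟨(convex_ball p η).segment_subset hz.1 hz' hm, fun j => ?_⟩
      by_cases h : S.yMap j z ∉ (S.Q j).skeleton
      · refine Or.inr ?_
        rwa [hsegy z z' m j hm (by rw [yMap_apply, yMap_apply, hpos j h])]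
      · refine Or.inl ?_
        rw [hsegx z z' m j hm (by rw [xMap_apply, xMap_apply, hneg j h])]
        exact (hz.2 j).resolve_right h
    · refine ⟨(convex_ball p η).segment_subset hz' hr hm, fun j => ?_⟩
      by_cases h : S.yMap j z ∉ (S.Q j).skeleton
      · have e : S.xMap j z' = S.xMap j r := by rw [xMap_apply, xMap_apply, hpos j h]
        refine Or.inl ?_
        rw [hsegx z' r m j hm e, e]
        exact (hreg j).1
      · have e : S.yMap j z' = S.yMap j r := by rw [yMap_apply, yMap_apply, hneg j h]
        refine Or.inr ?_
        rw [hsegy z' r m j hm e, e]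
        exact (hreg j).2
  · exact IsPreconnected.union z' (right_mem_segment ℝ _ _) (left_mem_segment ℝ _ _)
      (convex_segment z z').isPreconnected (convex_segment z' r).isPreconnected

/-- Locally constant functions extend over the discriminant. -/
theorem exists_extension_regular {A : Type*} [Inhabited A] {O : Set S.RealSpace} (hO : IsOpen O)
    {h : S.RealSpace → A} (hh : LocConstOn h (O ∩ S.regular)) :
    ∃ g : S.RealSpace → A, LocConstOn g O ∧ ∀ z ∈ O ∩ S.regular, g z = h z := by
  refine LocConstOn.exists_extension hO dense_regular (fun z hz => ?_) hh
  obtain ⟨η, hη, hsub⟩ := Metric.isOpen_iff.1 hO z hz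
  exact ⟨_, Metric.ball_mem_nhds z hη, hsub, isPreconnected_ball_inter_regular z hη⟩

/-! ### Splitting sections of a product into components -/

variable (S) in
/-- The coordinate changes of `SympleModel.tangent` with rational coefficients. -/
def ratShear (v v' : ∀ j, Fin (S.a j + 1)) (w : ∀ j, Fin (S.b j + 1)) (t : S.Coord → ℚ) :
    S.Coord → ℚ
  | .inl ⟨j, .inl k⟩ => t (.inl ⟨j, .inl k⟩) -
      (∑ l, t (.inl ⟨j, .inr l⟩) * ((S.Q j).vertex (w j) l : ℚ)) *
        (((S.P j).vertex (v' j) k : ℚ) - (S.P j).vertex (v j) k)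
  | q => t q

variable (S) in
/-- The coordinates of the factor `j`. -/
def factorPart (j : Fin S.r) (t : S.Coord → ℚ) : (Fin (S.a j) → ℚ) × (Fin (S.b j) → ℚ) :=
  (fun k => t (.inl ⟨j, .inl k⟩), fun l => t (.inl ⟨j, .inr l⟩))

theorem factorPart_sub (j : Fin S.r) (t t' : S.Coord → ℚ) :
    S.factorPart j (t - t') = S.factorPart j t - S.factorPart j t' := rfl

theorem factorPart_add (j : Fin S.r) (t t' : S.Coord → ℚ) :
    S.factorPart j (t + t') = S.factorPart j t + S.factorPart j t' := rfl

theorem ext_coord {t t' : S.Coord → ℚ} (h : ∀ j, S.factorPart j t = S.factorPart j t')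
    (h' : ∀ q, t (.inr q) = t' (.inr q)) : t = t' := by
  funext q
  rcases q with ⟨j, k | l⟩ | q
  · exact congrFun (congrArg Prod.fst (h j)) k
  · exact congrFun (congrArg Prod.snd (h j)) l
  · exact h' q

/-- The shear from `v` to `v'` subtracts exactly the multiple of `v' - v` that distinguishes the two
shifts, so the shifts give frame-independent coordinates over the chamber. -/
theorem factorPart_ratShear (j : Fin S.r) (v v' : ∀ j, Fin (S.a j + 1))
    (w : ∀ j, Fin (S.b j + 1)) (t : S.Coord → ℚ) :
    (S.P j).shift (S.Q j) (v' j) (w j) (S.factorPart j (S.ratShear v v' w t)) =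
      (S.P j).shift (S.Q j) (v j) (w j) (S.factorPart j t) := by
  refine Prod.ext ?_ rfl
  funext k
  simp only [LatticeSimplex.shift_apply, factorPart, ratShear, LatticeSimplex.ratPair, Pi.add_apply,
    Pi.smul_apply, smul_eq_mul, LatticeSimplex.ratVertex]
  ring

theorem ratShear_eq_iff {v v' : ∀ j, Fin (S.a j + 1)} {w : ∀ j, Fin (S.b j + 1)}
    {t t' : S.Coord → ℚ} : t' = S.ratShear v v' w t ↔
      (∀ j, (S.P j).shift (S.Q j) (v j) (w j) (S.factorPart j t) =
        (S.P j).shift (S.Q j) (v' j) (w j) (S.factorPart j t')) ∧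
      ∀ q, t' (.inr q) = t (.inr q) := by
  constructor
  · rintro rfl
    exact ⟨fun j => (factorPart_ratShear j v v' w t).symm, fun q => rfl⟩
  · rintro ⟨h1, h2⟩
    refine ext_coord (fun j => ?_) fun q => h2 q
    apply ((S.P j).shift (S.Q j) (v' j) (w j)).injective
    rw [factorPart_ratShear, h1]

variable (S) in
/-- Sections over `O` of the pushforward of the local system of a product of symple models. -/
structure IsModelSection (O : Set S.RealSpace)
    (s : (∀ j, Fin (S.a j + 1)) → S.RealSpace → S.Coord → ℚ) : Prop where
  locConst : ∀ v, LocConstOn (s v) (O ∩ S.realDom v)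
  eq_ratShear : ∀ v v' w, ∀ z ∈ O, z ∈ S.realDom v → z ∈ S.realDom v' →
    (∀ j, v j ≠ v' j → S.yMap j z ∈ (S.Q j).chamber (w j)) → s v' z = S.ratShear v v' w (s v z)

namespace IsModelSection

variable {O : Set S.RealSpace} {s : (∀ j, Fin (S.a j + 1)) → S.RealSpace → S.Coord → ℚ}

theorem factorPart_eq (hs : S.IsModelSection O s) {z : S.RealSpace} (hz : z ∈ O)
    {v v' : ∀ j, Fin (S.a j + 1)} (hv : z ∈ S.realDom v) (hv' : z ∈ S.realDom v') {j : Fin S.r}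
    (hj : v j = v' j) : S.factorPart j (s v z) = S.factorPart j (s v' z) := by
  obtain ⟨w, hw⟩ := exists_chambers hv hv'
  have := (ratShear_eq_iff.1 (hs.eq_ratShear v v' w z hz hv hv' hw)).1 j
  rw [hj] at this
  exact ((S.P j).shift (S.Q j) (v' j) (w j)).injective this

theorem shift_factorPart_eq (hs : S.IsModelSection O s) {z : S.RealSpace} (hz : z ∈ O)
    {v v' : ∀ j, Fin (S.a j + 1)} (hv : z ∈ S.realDom v) (hv' : z ∈ S.realDom v') {j : Fin S.r}
    {ω : Fin (S.b j + 1)} (hω : S.yMap j z ∈ (S.Q j).chamber ω) :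
    (S.P j).shift (S.Q j) (v j) ω (S.factorPart j (s v z)) =
      (S.P j).shift (S.Q j) (v' j) ω (S.factorPart j (s v' z)) := by
  by_cases hj : v j = v' j
  · rw [hs.factorPart_eq hz hv hv' hj, hj]
  obtain ⟨w, hw⟩ := exists_chambers hv hv'
  have h := (ratShear_eq_iff.1 (hs.eq_ratShear v v' w z hz hv hv' hw)).1 j
  rwa [(S.Q j).eq_of_mem_chamber (hw j hj) hω] at h

theorem inr_eq (hs : S.IsModelSection O s) {z : S.RealSpace} (hz : z ∈ O)
    {v v' : ∀ j, Fin (S.a j + 1)} (hv : z ∈ S.realDom v) (hv' : z ∈ S.realDom v')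
    (q : Fin S.c ⊕ Fin S.c') : s v z (.inr q) = s v' z (.inr q) := by
  obtain ⟨w, hw⟩ := exists_chambers hv hv'
  exact ((ratShear_eq_iff.1 (hs.eq_ratShear v v' w z hz hv hv' hw)).2 q).symm

/-- The component in one factor, extended over the discriminants of the other factors. -/
theorem exists_factor (hs : S.IsModelSection O s) (hO : IsOpen O) (j : Fin S.r) :
    ∃ g, IsFactorSection (S.P j) (S.Q j) (S.xMap j) (S.yMap j) O g ∧
      ∀ v, ∀ z ∈ O ∩ S.realDom v, g (v j) z = S.factorPart j (s v z) := by
  classical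
  have hraw : ∀ u : Fin (S.a j + 1), ∃ g : S.RealSpace → (Fin (S.a j) → ℚ) × (Fin (S.b j) → ℚ),
      LocConstOn g (O ∩ factorDom (S.P j) (S.Q j) (S.xMap j) (S.yMap j) u) ∧
      ∀ v, v j = u → ∀ z ∈ O ∩ S.realDom v, g z = S.factorPart j (s v z) := by
    intro u
    let F := factorDom (S.P j) (S.Q j) (S.xMap j) (S.yMap j) u
    let fr : S.RealSpace → ∀ j, Fin (S.a j + 1) := fun z =>
      if h : ∃ v, z ∈ S.realDom v ∧ v j = u then h.choose else 0
    have hfr : ∀ z, (∃ v, z ∈ S.realDom v ∧ v j = u) → z ∈ S.realDom (fr z) ∧ fr z j = u := by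
      intro z h
      simp only [fr, dif_pos h]
      exact h.choose_spec
    have hval : ∀ v, v j = u → ∀ z ∈ O ∩ S.realDom v,
        S.factorPart j (s (fr z) z) = S.factorPart j (s v z) := by
      intro v hv z hz
      obtain ⟨h1, h2⟩ := hfr z ⟨v, hz.2, hv⟩
      exact hs.factorPart_eq hz.1 h1 hz.2 (h2.trans hv.symm)
    -- The component in factor `j` depends only on the frame of that factor. It is thus a
    -- well-defined locally constant function off the other discriminants and extends across them.
    obtain ⟨g, hg1, hg2⟩ := exists_extension_regular (O := O ∩ F)
      (hO.inter (isOpen_factorDom _ _ _ _ u))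
      (h := fun z => S.factorPart j (s (fr z) z)) (by
        rintro z ⟨⟨hzO, hzF⟩, hzr⟩
        obtain ⟨h1, h2⟩ := hfr z (exists_frame hzr j hzF)
        filter_upwards [hs.locConst (fr z) z ⟨hzO, h1⟩, hO.mem_nhds hzO,
          (isOpen_realDom (fr z)).mem_nhds h1] with z' h3 h4 h5
        rw [hval (fr z) h2 z' ⟨h4, h5⟩, h3])
    refine ⟨g, hg1, fun v hv z hz => ?_⟩
    rw [hg2 z ⟨⟨hz.1, by subst hv; exact realDom_subset_factorDom v j hz.2⟩, realDom_subset_regular v hz.2⟩]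
    exact hval v hv z hz
  choose g hg1 hg2 using hraw
  refine ⟨g, ⟨hg1, fun w u u' => ?_⟩, fun v z hz => hg2 (v j) v rfl z hz⟩
  have hsub : ∀ u, O ∩ S.yMap j ⁻¹' (S.Q j).chamber w ⊆
      O ∩ factorDom (S.P j) (S.Q j) (S.xMap j) (S.yMap j) u := fun u z hz =>
    ⟨hz.1, mem_factorDom_of_chamber _ _ _ _ hz.2 u⟩
  -- The coordinate changes are known at regular points and persist by density.
  have := LocConstOn.eq_of_dense
    (hO.inter (((S.Q j).isOpen_chamber w).preimage (S.yMap j).continuous)) (dense_regular (S := S))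
    (((hg1 u).mono (hsub u)).comp_left ((S.P j).shift (S.Q j) u w))
    (((hg1 u').mono (hsub u')).comp_left ((S.P j).shift (S.Q j) u' w)) (by
      rintro z ⟨hz, hzr⟩
      obtain ⟨v, hv, rfl⟩ := exists_frame hzr j (hsub u hz).2
      obtain ⟨v', hv', rfl⟩ := exists_frame hzr j (hsub u' hz).2
      rw [hg2 _ v rfl z ⟨hz.1, hv⟩, hg2 _ v' rfl z ⟨hz.1, hv'⟩]
      exact hs.shift_factorPart_eq hz.1 hv hv' hz.2)
  exact fun z hz hzw => this z ⟨hz, hzw⟩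

/-- The component in the trivial factor, extended over the discriminant. -/
theorem exists_trivial (hs : S.IsModelSection O s) (hO : IsOpen O) :
    ∃ g : S.RealSpace → (Fin S.c ⊕ Fin S.c') → ℚ, LocConstOn g O ∧
      ∀ v, ∀ z ∈ O ∩ S.realDom v, g z = fun q => s v z (.inr q) := by
  classical
  have hfr : ∀ z : S.RealSpace, ∃ v, z ∈ S.regular → z ∈ S.realDom v := by
    intro z
    by_cases hz : z ∈ S.regular
    · obtain ⟨v, hv⟩ := exists_realDom hz
      exact ⟨v, fun _ => hv⟩
    · exact ⟨0, fun h => (hz h).elim⟩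
  choose fr hfr using hfr
  have hval : ∀ v, ∀ z ∈ O ∩ S.realDom v,
      (fun q => s (fr z) z (.inr q)) = fun q => s v z (.inr q) := by
    intro v z hz
    funext q
    exact hs.inr_eq hz.1 (hfr z (realDom_subset_regular v hz.2)) hz.2 q
  obtain ⟨g, hg1, hg2⟩ := exists_extension_regular hO
    (h := fun z (q : Fin S.c ⊕ Fin S.c') => s (fr z) z (.inr q)) (by
      rintro z ⟨hzO, hzr⟩
      filter_upwards [hs.locConst (fr z) z ⟨hzO, hfr z hzr⟩, hO.mem_nhds hzO,
        (isOpen_realDom (fr z)).mem_nhds (hfr z hzr)] with z' h3 h4 h5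
      rw [hval (fr z) z' ⟨h4, h5⟩, h3])
  refine ⟨g, hg1, fun v z hz => ?_⟩
  rw [hg2 z ⟨hz.1, realDom_subset_regular v hz.2⟩]
  exact hval v z hz

end IsModelSection

/-- Čech `1`-cocycles of a product of symple models are coboundaries on small punctured balls. -/
theorem cech (hS : 3 ≤ Fintype.card S.Coord) {p : S.RealSpace} {ε : ℝ} (hε : 0 < ε)
    (hsm : ∀ j, IsSmallBall (S.P j) (S.Q j) (S.xMap j) (S.yMap j) p ε) {ι : Type u}
    (U : ι → Set S.RealSpace) (hU : ∀ i, IsOpen (U i)) (hcov : Metric.ball p ε \ {p} ⊆ ⋃ i, U i)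
    (f : ι → ι → (∀ j, Fin (S.a j + 1)) → S.RealSpace → S.Coord → ℚ)
    (hf : ∀ i k, S.IsModelSection (U i ∩ U k ∩ (Metric.ball p ε \ {p})) (f i k))
    (hcoc : ∀ i k l v, ∀ z ∈ S.realDom v ∩ (Metric.ball p ε \ {p}), z ∈ U i → z ∈ U k →
      z ∈ U l → f i k v z + f k l v z = f i l v z) :
    ∃ h : ι → (∀ j, Fin (S.a j + 1)) → S.RealSpace → S.Coord → ℚ,
      (∀ i, S.IsModelSection (U i ∩ (Metric.ball p ε \ {p})) (h i)) ∧
      ∀ i k v, ∀ z ∈ S.realDom v ∩ (Metric.ball p ε \ {p}), z ∈ U i → z ∈ U k →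
        f i k v z = h k v z - h i v z := by
  have hE : 3 ≤ Module.finrank ℝ S.RealSpace := by rwa [finrank_realSpace]
  set V := Metric.ball p ε \ {p} with hV
  have hVo : IsOpen V := Metric.isOpen_ball.sdiff isClosed_singleton
  have hOo : ∀ i k, IsOpen (U i ∩ U k ∩ V) := fun i k => ((hU i).inter (hU k)).inter hVo
  choose g hg1 hg2 using fun j i k => (hf i k).exists_factor (hOo i k) j
  choose τ hτ1 hτ2 using fun i k => (hf i k).exists_trivial (hOo i k)
  have hfac : ∀ j, ∃ h : ι → Fin (S.a j + 1) → S.RealSpace →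
      (Fin (S.a j) → ℚ) × (Fin (S.b j) → ℚ),
      (∀ i, IsFactorSection (S.P j) (S.Q j) (S.xMap j) (S.yMap j) (U i ∩ V) (h i)) ∧
      ∀ i k u, ∀ z ∈ factorDom (S.P j) (S.Q j) (S.xMap j) (S.yMap j) u ∩ V, z ∈ U i → z ∈ U k →
        g j i k u z = h k u z - h i u z := by
    intro j
    refine (hsm j).cech hE (S.exists_xMap_yMap j) hε U hU hcov (g j) (hg1 j) ?_
    intro i k l u
    set F := factorDom (S.P j) (S.Q j) (S.xMap j) (S.yMap j) u with hF
    have hloc : ∀ i' k', U i' ∩ U k' ∩ V ∩ F ⊇ U i ∩ U k ∩ U l ∩ (F ∩ V) →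
        LocConstOn (g j i' k' u) (U i ∩ U k ∩ U l ∩ (F ∩ V)) := fun i' k' h =>
      ((hg1 j i' k').locConst u).mono h
    have h1 := hloc i k fun z hz => ⟨⟨hz.1.1, hz.2.2⟩, hz.2.1⟩
    have h2 := hloc k l fun z hz => ⟨⟨⟨hz.1.1.2, hz.1.2⟩, hz.2.2⟩, hz.2.1⟩
    have h3 := hloc i l fun z hz => ⟨⟨⟨hz.1.1.1, hz.1.2⟩, hz.2.2⟩, hz.2.1⟩
    -- The cocycle identity also passes from regular points to the extended components by density.
    have := LocConstOn.eq_of_dense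
      (((((hU i).inter (hU k)).inter (hU l))).inter ((isOpen_factorDom _ _ _ _ u).inter hVo))
      (dense_regular (S := S)) (h1.comp₂ h2 (· + ·)) h3 (by
        rintro z ⟨⟨⟨⟨hi, hk⟩, hl⟩, hzF, hzV⟩, hzr⟩
        obtain ⟨v, hv, rfl⟩ := exists_frame hzr j hzF
        rw [hg2 j i k v z ⟨⟨⟨hi, hk⟩, hzV⟩, hv⟩, hg2 j k l v z ⟨⟨⟨hk, hl⟩, hzV⟩, hv⟩,
          hg2 j i l v z ⟨⟨⟨hi, hl⟩, hzV⟩, hv⟩, ← factorPart_add,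
          hcoc i k l v z ⟨hv, hzV⟩ hi hk hl])
    exact fun z hz hi hk hl => this z ⟨⟨⟨hi, hk⟩, hl⟩, hz⟩
  choose h hh1 hh2 using hfac
  obtain ⟨σ, hσ1, hσ2⟩ := ConstCechTrivial.ball_diff_singleton ((Fin S.c ⊕ Fin S.c') → ℚ) p hε hE
    ι U hU hcov τ hτ1 (by
      intro i k l z hz hi hk hl
      have h1 := (hτ1 i k).mono (t := U i ∩ U k ∩ U l ∩ V) fun z hz => ⟨hz.1.1, hz.2⟩
      have h2 := (hτ1 k l).mono (t := U i ∩ U k ∩ U l ∩ V) fun z hz =>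
        ⟨⟨hz.1.1.2, hz.1.2⟩, hz.2⟩
      have h3 := (hτ1 i l).mono (t := U i ∩ U k ∩ U l ∩ V) fun z hz =>
        ⟨⟨hz.1.1.1, hz.1.2⟩, hz.2⟩
      refine LocConstOn.eq_of_dense ((((hU i).inter (hU k)).inter (hU l)).inter hVo)
        (dense_regular (S := S)) (h1.comp₂ h2 (· + ·)) h3 ?_ z ⟨⟨⟨hi, hk⟩, hl⟩, hz⟩
      rintro z ⟨⟨⟨⟨hi, hk⟩, hl⟩, hzV⟩, hzr⟩
      obtain ⟨v, hv⟩ := exists_realDom hzr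
      rw [hτ2 i k v z ⟨⟨⟨hi, hk⟩, hzV⟩, hv⟩, hτ2 k l v z ⟨⟨⟨hk, hl⟩, hzV⟩, hv⟩,
        hτ2 i l v z ⟨⟨⟨hi, hl⟩, hzV⟩, hv⟩, ← hcoc i k l v z ⟨hv, hzV⟩ hi hk hl]
      rfl)
  let H : ι → (∀ j, Fin (S.a j + 1)) → S.RealSpace → S.Coord → ℚ := fun i v z q =>
    match q with
    | .inl ⟨j, .inl k⟩ => (h j i (v j) z).1 k
    | .inl ⟨j, .inr l⟩ => (h j i (v j) z).2 l
    | .inr q => σ i z q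
  have hH : ∀ i v z j, S.factorPart j (H i v z) = h j i (v j) z := fun i v z j => rfl
  refine ⟨H, fun i => ⟨fun v => ?_, fun v v' w z hz hv hv' hw => ?_⟩, ?_⟩
  · have hsub : ∀ j, U i ∩ V ∩ S.realDom v ⊆
        U i ∩ V ∩ factorDom (S.P j) (S.Q j) (S.xMap j) (S.yMap j) (v j) := fun j =>
      Set.inter_subset_inter_right _ (realDom_subset_factorDom v j)
    refine LocConstOn.pi fun q => ?_
    rcases q with ⟨j, k | l⟩ | q
    · exact (((hh1 j i).locConst (v j)).mono (hsub j)).comp_left fun c => c.1 k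
    · exact (((hh1 j i).locConst (v j)).mono (hsub j)).comp_left fun c => c.2 l
    · exact ((hσ1 i).mono Set.inter_subset_left).comp_left fun c => c q
  · refine ratShear_eq_iff.2 ⟨fun j => ?_, fun q => rfl⟩
    rw [hH, hH]
    by_cases hj : v j = v' j
    · rw [hj]
    · exact (hh1 j i).shift_eq (w j) (v j) (v' j) z hz (hw j hj)
  · rintro i k v z ⟨hv, hz⟩ hi hk
    refine ext_coord (fun j => ?_) fun q => ?_
    · rw [factorPart_sub, hH, hH, ← hh2 j i k (v j) z ⟨hv j, hz⟩ hi hk,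
        hg2 j i k v z ⟨⟨⟨hi, hk⟩, hz⟩, hv⟩]
    · have h1 := hσ2 i k z hz hi hk
      rw [hτ2 i k v z ⟨⟨⟨hi, hk⟩, hz⟩, hv⟩] at h1
      exact congrFun h1 q

end SympleModel

/-! ### Coherent frame systems and their isomorphisms -/

namespace FrameSystem

variable {κ κ' : Type} [Fintype κ] [Fintype κ'] {X : Type*} [TopologicalSpace X]

/-- The transition matrices of a frame system exist, are locally constant and satisfy the cocycle
condition. -/
structure IsCoherent [DecidableEq κ] (F : FrameSystem κ X) : Prop where
  isOpen_dom : ∀ i, IsOpen (F.dom i)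
  exists_trans : ∀ i j x, x ∈ F.dom i → x ∈ F.dom j → ∃ A, F.Trans i j x A
  trans_self : ∀ i x A, x ∈ F.dom i → F.Trans i i x A → A = 1
  trans_comp : ∀ i j k x A A', x ∈ F.dom i → x ∈ F.dom j → x ∈ F.dom k →
    F.Trans i j x A → F.Trans j k x A' → F.Trans i k x (A' * A)
  eventually_trans : ∀ i j x A, x ∈ F.dom i → x ∈ F.dom j → F.Trans i j x A →
    ∀ᶠ y in 𝓝 x, F.Trans i j y A

/-- Sections of a frame system as functions on the whole space, with irrelevant values outside of
`O` and outside of the domains of the frames. -/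
structure IsSection (F : FrameSystem κ X) (R : Type) [CommRing R] (O : Set X)
    (t : F.Frame → X → κ → R) : Prop where
  locConst : ∀ i, LocConstOn (t i) (O ∩ F.dom i)
  trans : ∀ i j, ∀ x ∈ O, x ∈ F.dom i → x ∈ F.dom j → ∀ A, F.Trans i j x A →
    t j x = A.map (Int.cast : ℤ → R) *ᵥ t i x

theorem IsSection.pullback {F : FrameSystem κ X} {R : Type} [CommRing R] {O : Set X}
    {t : F.Frame → X → κ → R} (ht : F.IsSection R O t) {Z : Type*} [TopologicalSpace Z] {g : Z → X}
    (hg : Continuous g) : (F.pullback g).IsSection R (g ⁻¹' O) fun i z => t i (g z) where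
  locConst i := (ht.locConst i).comp_right hg
  trans i j x hx hi hj A hA := ht.trans i j (g x) hx hi hj A hA

theorem eventually_nhds_subtype {X : Type*} [TopologicalSpace X] {q : X → Prop} {x : {x // q x}}
    {r : {x // q x} → Prop} (h : ∀ᶠ z in 𝓝 x, r z) : ∀ᶠ y in 𝓝 x.1, ∀ hy : q y, r ⟨y, hy⟩ := by
  rw [nhds_subtype_eq_comap, Filter.eventually_comap] at h
  filter_upwards [h] with y hy hq
  exact hy ⟨y, hq⟩ rfl

/-- A section as a function on the whole space. -/
theorem exists_isSection {F : FrameSystem κ X} (hF : ∀ i, IsOpen (F.dom i)) {R : Type} [CommRing R]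
    {V : Opens X} (s : F.sections R V) : ∃ t, F.IsSection R V t ∧
      ∀ (x : V) (i : F.Frame) (hi : x.1 ∈ F.dom i), s.1 x ⟨i, hi⟩ = t i x.1 := by
  classical
  let t : F.Frame → X → κ → R := fun i x =>
    if h : x ∈ V ∧ x ∈ F.dom i then s.1 ⟨x, h.1⟩ ⟨i, h.2⟩ else 0
  have ht : ∀ (x : V) (i : F.Frame) (hi : x.1 ∈ F.dom i), s.1 x ⟨i, hi⟩ = t i x.1 := by
    intro x i hi
    have h : x.1 ∈ V ∧ x.1 ∈ F.dom i := ⟨x.2, hi⟩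
    simp only [t, dif_pos h]
  refine ⟨t, ⟨?_, ?_⟩, ht⟩
  · rintro i x ⟨hxV, hi⟩
    have h1 := eventually_nhds_subtype (s.2.1 ⟨x, hxV⟩ i hi)
    filter_upwards [h1, V.isOpen.mem_nhds hxV, (hF i).mem_nhds hi] with y h1 hyV hy
    rw [← ht ⟨x, hxV⟩ i hi, ← ht ⟨y, hyV⟩ i hy]
    exact h1 hyV hy
  · intro i j x hx hi hj A hA
    rw [← ht ⟨x, hx⟩ i hi, ← ht ⟨x, hx⟩ j hj]
    exact s.2.2 ⟨x, hx⟩ i j hi hj A hA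

theorem IsSection.mem_sections {F : FrameSystem κ X} {R : Type} [CommRing R] {O : Set X}
    {t : F.Frame → X → κ → R} (ht : F.IsSection R O t) {V : Opens X} (hV : (V : Set X) ⊆ O) :
    (fun (x : V) (i : {i : F.Frame // x.1 ∈ F.dom i}) => t i.1 x.1) ∈ F.sections R V := by
  refine ⟨fun x i hi => ?_, fun x i j hi hj A hA => ht.trans i j x (hV x.2) hi hj A hA⟩
  filter_upwards [continuous_subtype_val.continuousAt.eventually
    (ht.locConst i x.1 ⟨hV x.2, hi⟩)] with y hy _ using hy

variable [DecidableEq κ] [DecidableEq κ']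

namespace IsCoherent

variable {F : FrameSystem κ X}

theorem pullback (hF : F.IsCoherent) {Z : Type*} [TopologicalSpace Z] {g : Z → X}
    (hg : Continuous g) : (F.pullback g).IsCoherent where
  isOpen_dom i := (hF.isOpen_dom i).preimage hg
  exists_trans i j x hi hj := hF.exists_trans i j (g x) hi hj
  trans_self i x A hi hA := hF.trans_self i (g x) A hi hA
  trans_comp i j k x A A' hi hj hk hA hA' := hF.trans_comp i j k (g x) A A' hi hj hk hA hA'
  eventually_trans i j x A hi hj hA :=
    hg.continuousAt.eventually (hF.eventually_trans i j (g x) A hi hj hA)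

theorem trans_unique (hF : F.IsCoherent) {i j : F.Frame} {x : X} (hi : x ∈ F.dom i)
    (hj : x ∈ F.dom j) {A A' : Matrix κ κ ℤ} (hA : F.Trans i j x A) (hA' : F.Trans i j x A') :
    A = A' := by
  obtain ⟨D, hD⟩ := hF.exists_trans j i x hj hi
  have h1 := hF.trans_self i x _ hi (hF.trans_comp i j i x _ _ hi hj hi hA hD)
  have h2 := hF.trans_self i x _ hi (hF.trans_comp i j i x _ _ hi hj hi hA' hD)
  have h3 := hF.trans_self j x _ hj (hF.trans_comp j i j x _ _ hj hi hj hD hA)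
  calc A = A * (D * A') := by rw [h2, Matrix.mul_one]
    _ = A' := by rw [← Matrix.mul_assoc, h3, Matrix.one_mul]

theorem ext_sections (hF : F.IsCoherent) {V : Opens X} {i : F.Frame}
    (hV : (V : Set X) ⊆ F.dom i) {s s' : F.sections ℤ V}
    (h : ∀ x : V, s.1 x ⟨i, hV x.2⟩ = s'.1 x ⟨i, hV x.2⟩) : s = s' := by
  apply Subtype.ext
  funext x k
  obtain ⟨A, hA⟩ := hF.exists_trans i k.1 x.1 (hV x.2) k.2
  exact (s.2.2 x i k.1 (hV x.2) k.2 A hA).trans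
    ((congrArg _ (h x)).trans (s'.2.2 x i k.1 (hV x.2) k.2 A hA).symm)

/-- The section with constant coordinates `e` in the frame `i`. -/
theorem exists_constSection (hF : F.IsCoherent) {V : Opens X} {i : F.Frame}
    (hV : (V : Set X) ⊆ F.dom i) (e : κ → ℤ) :
    ∃ s : F.sections ℤ V, ∀ x : V, s.1 x ⟨i, hV x.2⟩ = e := by
  choose! A hA using fun (k : F.Frame) (x : X) (hx : x ∈ F.dom i ∩ F.dom k) =>
    hF.exists_trans i k x hx.1 hx.2
  refine ⟨⟨fun x k => A k.1 x.1 *ᵥ e, fun x k hk => ?_, fun x k l hk hl D hD => ?_⟩, fun x => ?_⟩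
  · have h1 := continuous_subtype_val.continuousAt.eventually
      (hF.eventually_trans i k x.1 _ (hV x.2) hk (hA k x.1 ⟨hV x.2, hk⟩))
    filter_upwards [h1] with y hy hk'
    rw [hF.trans_unique (hV y.2) hk' (hA k y.1 ⟨hV y.2, hk'⟩) hy]
  · have h1 := hF.trans_comp i k l x.1 _ D (hV x.2) hk hl (hA k x.1 ⟨hV x.2, hk⟩) hD
    have h2 := hF.trans_unique (hV x.2) hl (hA l x.1 ⟨hV x.2, hl⟩) h1
    have h3 : D.map (Int.cast : ℤ → ℤ) = D := by ext; simp
    dsimp only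
    rw [h2, h3, Matrix.mulVec_mulVec]
  · have := hF.trans_self i x.1 _ (hV x.2) (hA i x.1 ⟨hV x.2, hV x.2⟩)
    dsimp only
    rw [this, Matrix.one_mulVec]

/-- A morphism between local systems is given by locally constant matrices. -/
theorem exists_matrix (hF : F.IsCoherent) {G : FrameSystem κ' X} (hG : G.IsCoherent)
    (φ : ∀ V : Opens X, F.sections ℤ V →+ G.sections ℤ V)
    (hφ : ∀ {V W : Opens X} (h : W ≤ V) (s : F.sections ℤ V),
      φ W (F.res ℤ h s) = G.res ℤ h (φ V s)) :
    ∃ M : F.Frame → G.Frame → X → Matrix κ' κ ℤ,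
      (∀ i j, LocConstOn (M i j) (F.dom i ∩ G.dom j)) ∧
      ∀ (V : Opens X) (s : F.sections ℤ V) (x : V) (i : F.Frame) (hi : x.1 ∈ F.dom i)
        (j : G.Frame) (hj : x.1 ∈ G.dom j),
        (φ V s).1 x ⟨j, hj⟩ = M i j x.1 *ᵥ s.1 x ⟨i, hi⟩ := by
  classical
  let W : F.Frame → G.Frame → Opens X := fun i j =>
    ⟨F.dom i ∩ G.dom j, (hF.isOpen_dom i).inter (hG.isOpen_dom j)⟩
  have hW : ∀ i j, (W i j : Set X) ⊆ F.dom i := fun i j => Set.inter_subset_left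
  choose c hc using fun (i : F.Frame) (j : G.Frame) (e : κ → ℤ) =>
    hF.exists_constSection (hW i j) e
  let M : F.Frame → G.Frame → X → Matrix κ' κ ℤ := fun i j x =>
    if h : x ∈ W i j then
      Matrix.of fun r k => (φ (W i j) (c i j (Pi.single k 1))).1 ⟨x, h⟩ ⟨j, h.2⟩ r
    else 0
  have hM : ∀ i j (x : W i j) r k,
      M i j x.1 r k = (φ (W i j) (c i j (Pi.single k 1))).1 x ⟨j, x.2.2⟩ r := by
    intro i j x r k
    simp only [M, dif_pos x.2, Matrix.of_apply]
  refine ⟨M, fun i j x hx => ?_, fun V s x i hi j hj => ?_⟩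
  · have h1 : ∀ k, ∀ᶠ y in 𝓝 x, ∀ hy : y ∈ W i j,
        (φ (W i j) (c i j (Pi.single k 1))).1 ⟨y, hy⟩ ⟨j, hy.2⟩ =
          (φ (W i j) (c i j (Pi.single k 1))).1 ⟨x, hx⟩ ⟨j, hx.2⟩ := by
      intro k
      have h2 := eventually_nhds_subtype
        ((φ (W i j) (c i j (Pi.single k 1))).2.1 ⟨x, hx⟩ j hx.2)
      filter_upwards [h2] with y hy hyW
      exact hy hyW hyW.2
    filter_upwards [Filter.eventually_all.2 h1, (W i j).isOpen.mem_nhds hx] with y hy hyW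
    ext r k
    rw [hM i j ⟨y, hyW⟩, hM i j ⟨x, hx⟩]
    exact congrFun (hy k hyW) r
  · set e := s.1 x ⟨i, hi⟩ with he
    have h1 := eventually_nhds_subtype (s.2.1 x i hi)
    obtain ⟨N, hN, hNo, hxN⟩ := eventually_nhds_iff.1 h1
    let W' : Opens X := ⟨N ∩ (V ∩ (F.dom i ∩ G.dom j)),
      hNo.inter (V.isOpen.inter (W i j).isOpen)⟩
    have hW'V : W' ≤ V := fun y hy => hy.2.1
    have hW'W : W' ≤ W i j := fun y hy => hy.2.2
    have hxW' : x.1 ∈ W' := ⟨hxN, x.2, hi, hj⟩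
    -- Near `x` the section has constant coordinates `e`, so it is an integral combination of the
    -- constant basis sections, and the images of these are the columns of `M`.
    have hres : F.res ℤ hW'V s = F.res ℤ hW'W (∑ k, e k • c i j (Pi.single k 1)) := by
      refine hF.ext_sections (i := i) (fun y hy => (hW'W hy).1) fun y => ?_
      have h2 : (∑ k, e k • c i j (Pi.single k 1)).1 ⟨y.1, hW'W y.2⟩ ⟨i, y.2.2.2.1⟩ = e := by
        have h3 : (∑ k, e k • c i j (Pi.single k 1)).1 ⟨y.1, hW'W y.2⟩ ⟨i, y.2.2.2.1⟩ =
            ∑ k, e k • (c i j (Pi.single k 1)).1 ⟨y.1, hW'W y.2⟩ ⟨i, y.2.2.2.1⟩ := by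
          rw [AddSubgroup.val_finsetSum, Finset.sum_apply, Finset.sum_apply]
          rfl
        rw [h3]
        have h4 : ∀ k, (c i j (Pi.single k 1)).1 ⟨y.1, hW'W y.2⟩ ⟨i, y.2.2.2.1⟩ = Pi.single k 1 :=
          fun k => hc i j (Pi.single k 1) ⟨y.1, hW'W y.2⟩
        simp only [h4]
        ext r
        simp [Finset.sum_apply, Pi.single_apply]
      exact (hN y.1 y.2.1 y.2.2.1 y.2.2.2.1).trans h2.symm
    have h5 := (hφ hW'V s).symm.trans ((congrArg (φ W') hres).trans (hφ hW'W _))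
    have h6 : (φ V s).1 x ⟨j, hj⟩ =
        (φ (W i j) (∑ k, e k • c i j (Pi.single k 1))).1 ⟨x.1, hi, hj⟩ ⟨j, hj⟩ :=
      congrFun (congrFun (congrArg Subtype.val h5) ⟨x.1, hxW'⟩) ⟨j, hj⟩
    rw [h6, map_sum]
    simp only [map_zsmul]
    rw [AddSubgroup.val_finsetSum, Finset.sum_apply, Finset.sum_apply]
    ext r
    rw [Finset.sum_apply, Matrix.mulVec, dotProduct]
    refine Finset.sum_congr rfl fun k _ => ?_
    rw [hM i j ⟨x.1, hi, hj⟩ r k, mul_comm]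
    rfl

end IsCoherent

omit [DecidableEq κ'] in
/-- The matrices of a morphism between local systems are compatible with the transition
matrices. -/
theorem IsCoherent.matrix_compatible {F : FrameSystem κ X} (hF : F.IsCoherent)
    {G : FrameSystem κ' X} {φ : ∀ V : Opens X, F.sections ℤ V →+ G.sections ℤ V}
    {M : F.Frame → G.Frame → X → Matrix κ' κ ℤ}
    (hM : ∀ (V : Opens X) (s : F.sections ℤ V) (x : V) (i : F.Frame) (hi : x.1 ∈ F.dom i)
      (j : G.Frame) (hj : x.1 ∈ G.dom j),
      (φ V s).1 x ⟨j, hj⟩ = M i j x.1 *ᵥ s.1 x ⟨i, hi⟩) :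
    (∀ i i' j, ∀ x ∈ F.dom i, x ∈ F.dom i' → x ∈ G.dom j → ∀ A, F.Trans i i' x A →
      M i' j x * A = M i j x) ∧
    (∀ i j j', ∀ x ∈ F.dom i, x ∈ G.dom j → x ∈ G.dom j' → ∀ A, G.Trans j j' x A →
      A * M i j x = M i j' x) := by
  have hcast : ∀ {κ : Type} [Fintype κ] (A : Matrix κ κ ℤ),
    A.map (Int.cast : ℤ → ℤ) = A := fun A => by ext; simp
  constructor
  · intro i i' j x hi hi' hj A hA
    refine Matrix.mulVec_injective (funext fun e => ?_)
    obtain ⟨s, hs⟩ := hF.exists_constSection (V := ⟨F.dom i, hF.isOpen_dom i⟩) subset_rfl e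
    have h1 := hM _ s ⟨x, hi⟩ i hi j hj
    have h2 := hM _ s ⟨x, hi⟩ i' hi' j hj
    have h3 := s.2.2 ⟨x, hi⟩ i i' hi hi' A hA
    rw [hcast] at h3
    have h4 : s.1 ⟨x, hi⟩ ⟨i, hi⟩ = e := hs ⟨x, hi⟩
    rw [h4] at h1 h3
    rw [← Matrix.mulVec_mulVec, ← h3, ← h2, h1]
  · intro i j j' x hi hj hj' A hA
    refine Matrix.mulVec_injective (funext fun e => ?_)
    obtain ⟨s, hs⟩ := hF.exists_constSection (V := ⟨F.dom i, hF.isOpen_dom i⟩) subset_rfl e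
    have h1 := hM _ s ⟨x, hi⟩ i hi j hj
    have h2 := hM _ s ⟨x, hi⟩ i hi j' hj'
    have h3 := (φ _ s).2.2 ⟨x, hi⟩ j j' hj hj' A hA
    rw [hcast] at h3
    have h4 : s.1 ⟨x, hi⟩ ⟨i, hi⟩ = e := hs ⟨x, hi⟩
    rw [h4] at h1 h2
    rw [← Matrix.mulVec_mulVec, ← h1, ← h2, h3]
/-- An isomorphism of local systems is given by mutually inverse locally constant matrices which
are compatible with the transition matrices. -/
theorem Iso.exists_matrices {F : FrameSystem κ X} {G : FrameSystem κ' X} (hF : F.IsCoherent)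
    (hG : G.IsCoherent) (φ : F.Iso G) :
    ∃ (M : F.Frame → G.Frame → X → Matrix κ' κ ℤ) (N : G.Frame → F.Frame → X → Matrix κ κ' ℤ),
      (∀ i j, LocConstOn (M i j) (F.dom i ∩ G.dom j)) ∧
      (∀ j i, LocConstOn (N j i) (G.dom j ∩ F.dom i)) ∧
      (∀ i i' j, ∀ x ∈ F.dom i, x ∈ F.dom i' → x ∈ G.dom j → ∀ A, F.Trans i i' x A →
        M i' j x * A = M i j x) ∧
      (∀ i j j', ∀ x ∈ F.dom i, x ∈ G.dom j → x ∈ G.dom j' → ∀ A, G.Trans j j' x A →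
        A * M i j x = M i j' x) ∧
      (∀ j j' i, ∀ x ∈ G.dom j, x ∈ G.dom j' → x ∈ F.dom i → ∀ A, G.Trans j j' x A →
        N j' i x * A = N j i x) ∧
      (∀ j i i', ∀ x ∈ G.dom j, x ∈ F.dom i → x ∈ F.dom i' → ∀ A, F.Trans i i' x A →
        A * N j i x = N j i' x) ∧
      (∀ i j, ∀ x ∈ F.dom i, x ∈ G.dom j → N j i x * M i j x = 1 ∧ M i j x * N j i x = 1) := by
  have hsymm : ∀ {V W : Opens X} (h : W ≤ V) (s : G.sections ℤ V),
      (φ.equiv W).symm (G.res ℤ h s) = F.res ℤ h ((φ.equiv V).symm s) := by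
    intro V W h s
    rw [AddEquiv.symm_apply_eq, φ.naturality, AddEquiv.apply_symm_apply]
  obtain ⟨M, hM1, hM2⟩ := hF.exists_matrix hG (fun V => (φ.equiv V).toAddMonoidHom) φ.naturality
  obtain ⟨N, hN1, hN2⟩ := hG.exists_matrix hF (fun V => (φ.equiv V).symm.toAddMonoidHom) hsymm
  obtain ⟨k1, k2⟩ := hF.matrix_compatible hM2
  obtain ⟨k3, k4⟩ := hG.matrix_compatible hN2
  refine ⟨M, N, hM1, hN1, k1, k2, k3, k4, fun i j x hi hj => ⟨?_, ?_⟩⟩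
  · refine Matrix.mulVec_injective (funext fun e => ?_)
    obtain ⟨s, hs⟩ := hF.exists_constSection (V := ⟨F.dom i, hF.isOpen_dom i⟩) subset_rfl e
    have h1 := hM2 _ s ⟨x, hi⟩ i hi j hj
    have h2 := hN2 _ (φ.equiv _ s) ⟨x, hi⟩ j hj i hi
    have h4 : s.1 ⟨x, hi⟩ ⟨i, hi⟩ = e := hs ⟨x, hi⟩
    simp only [AddEquiv.toAddMonoidHom_eq_coe, AddMonoidHom.coe_coe,
      AddEquiv.symm_apply_apply] at h1 h2
    rw [h1, h4] at h2
    rw [← Matrix.mulVec_mulVec, ← h2, Matrix.one_mulVec]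
  · refine Matrix.mulVec_injective (funext fun e => ?_)
    obtain ⟨s, hs⟩ := hG.exists_constSection (V := ⟨G.dom j, hG.isOpen_dom j⟩) subset_rfl e
    have h1 := hN2 _ s ⟨x, hj⟩ j hj i hi
    have h2 := hM2 _ ((φ.equiv _).symm s) ⟨x, hj⟩ i hi j hj
    have h4 : s.1 ⟨x, hj⟩ ⟨j, hj⟩ = e := hs ⟨x, hj⟩
    simp only [AddEquiv.toAddMonoidHom_eq_coe, AddMonoidHom.coe_coe,
      AddEquiv.apply_symm_apply] at h1 h2
    rw [h1, h4] at h2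
    rw [← Matrix.mulVec_mulVec, ← h2, Matrix.one_mulVec]

omit [DecidableEq κ'] in
/-- Sections can be transported along compatible locally constant matrices. -/
theorem IsSection.exists_transfer {F : FrameSystem κ X} {G : FrameSystem κ' X} (hF : F.IsCoherent)
    (hG : ∀ j, IsOpen (G.dom j)) (hcov : ∀ x, ∃ i, x ∈ F.dom i) {R : Type} [CommRing R]
    {M : F.Frame → G.Frame → X → Matrix κ' κ ℤ}
    (hM : ∀ i j, LocConstOn (M i j) (F.dom i ∩ G.dom j))
    (hM1 : ∀ i i' j, ∀ x ∈ F.dom i, x ∈ F.dom i' → x ∈ G.dom j → ∀ A, F.Trans i i' x A →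
        M i' j x * A = M i j x)
    (hM2 : ∀ i j j', ∀ x ∈ F.dom i, x ∈ G.dom j → x ∈ G.dom j' → ∀ A, G.Trans j j' x A →
        A * M i j x = M i j' x) {O : Set X} (hO : IsOpen O) {t : F.Frame → X → κ → R}
    (ht : F.IsSection R O t) :
    ∃ t', G.IsSection R O t' ∧ ∀ i j, ∀ x ∈ O, x ∈ F.dom i → x ∈ G.dom j →
      t' j x = (M i j x).map (Int.cast : ℤ → R) *ᵥ t i x := by
  choose c hc using hcov
  have hmul : ∀ {k l m : Type} [Fintype l] (A : Matrix k l ℤ) (D : Matrix l m ℤ),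
      (A * D).map (Int.cast : ℤ → R) = A.map (Int.cast : ℤ → R) * D.map (Int.cast : ℤ → R) :=
    fun A D => Matrix.map_mul (f := Int.castRingHom R)
  -- The transported value does not depend on the frame chosen at `x`, so near a point one fixed
  -- frame may be used.
  have hval : ∀ i j, ∀ x ∈ O, x ∈ F.dom i → x ∈ G.dom j →
      (M (c x) j x).map (Int.cast : ℤ → R) *ᵥ t (c x) x =
        (M i j x).map (Int.cast : ℤ → R) *ᵥ t i x := by
    intro i j x hx hi hj
    obtain ⟨A, hA⟩ := hF.exists_trans i (c x) x hi (hc x)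
    rw [ht.trans i (c x) x hx hi (hc x) A hA, Matrix.mulVec_mulVec, ← hmul,
      hM1 i (c x) j x hi (hc x) hj A hA]
  refine ⟨fun j x => (M (c x) j x).map (Int.cast : ℤ → R) *ᵥ t (c x) x, ⟨fun j x hx => ?_,
    fun j j' x hx hj hj' A hA => ?_⟩, hval⟩
  · filter_upwards [hM (c x) j x ⟨hc x, hx.2⟩, ht.locConst (c x) x ⟨hx.1, hc x⟩,
      hO.mem_nhds hx.1, (hG j).mem_nhds hx.2, (hF.isOpen_dom (c x)).mem_nhds (hc x)]
      with y h1 h2 h3 h4 h5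
    rw [hval (c x) j y h3 h5 h4, h1, h2]
  · rw [Matrix.mulVec_mulVec, ← hmul, hM2 (c x) j j' x (hc x) hj hj' A hA]

end FrameSystem

/-! ### Coherence of the tangent systems -/

/-- An affine map which is the identity on a nonempty open set has trivial linear part. -/
theorem Matrix.eq_one_of_eventually_mulVec_add {n : ℕ} {A : Matrix (Fin n) (Fin n) ℤ}
    {b u₀ : Fin n → ℝ} (h : ∀ᶠ u in 𝓝 u₀, u = A.map (Int.cast : ℤ → ℝ) *ᵥ u + b) : A = 1 := by
  have h0 := h.self_of_nhds
  have hinj : Function.Injective (fun D : Matrix (Fin n) (Fin n) ℤ =>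
      D.map (Int.cast : ℤ → ℝ)) := Matrix.map_injective Int.cast_injective
  apply hinj
  dsimp only
  refine Matrix.mulVec_injective (funext fun e => ?_)
  have hlim : Filter.Tendsto (fun s : ℝ => u₀ + s • e) (𝓝[>] 0) (𝓝 u₀) := by
    have : Continuous fun s : ℝ => u₀ + s • e := by fun_prop
    have h := this.tendsto 0
    simp only [zero_smul, add_zero] at h
    exact h.mono_left nhdsWithin_le_nhds
  obtain ⟨s, hs, hs0⟩ := ((hlim.eventually h).and self_mem_nhdsWithin).exists
  have hs0' : s ≠ 0 := (Set.mem_Ioi.1 hs0).ne'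
  have h1 : s • (A.map (Int.cast : ℤ → ℝ) *ᵥ e) = s • e := by
    rw [Matrix.mulVec_add, Matrix.mulVec_smul] at hs
    have h2 : u₀ + s • e = u₀ + s • (A.map (Int.cast : ℤ → ℝ) *ᵥ e) := by
      calc u₀ + s • e = A.map (Int.cast : ℤ → ℝ) *ᵥ u₀ +
            s • (A.map (Int.cast : ℤ → ℝ) *ᵥ e) + b := hs
        _ = (A.map (Int.cast : ℤ → ℝ) *ᵥ u₀ + b) + s • (A.map (Int.cast : ℤ → ℝ) *ᵥ e) := by abel
        _ = _ := by rw [← h0]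
    exact (add_left_cancel h2).symm
  have h2 := smul_right_injective (Fin n → ℝ) hs0' h1
  rw [h2]
  have h3 : (1 : Matrix (Fin n) (Fin n) ℤ).map (Int.cast : ℤ → ℝ) = 1 :=
    Matrix.map_one _ Int.cast_zero Int.cast_one
  rw [h3, Matrix.one_mulVec]

/-- At a boundary point the image of a neighbourhood need not be open. The closure condition still
supplies nearby interior points of the image, and around one of them the affine map is the identity.
-/
theorem AffineChart.IsTransition.eq_one {n : ℕ} {X : Type u} [TopologicalSpace X]
    {c : AffineChart n X} {x : X} (hx : x ∈ c.domain) {A : Matrix (Fin n) (Fin n) ℤ}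
    (h : c.IsTransition c x A) : A = 1 := by
  obtain ⟨-, b, hb⟩ := h
  obtain ⟨O, hO, hOo, hxO⟩ := eventually_nhds_iff.1 hb
  obtain ⟨G, hG, hGO⟩ := c.isEmbedding.isInducing.isOpen_iff.1
    (hOo.preimage (continuous_subtype_val : Continuous (Subtype.val : c.domain → X)))
  have hmem : ∀ y : c.domain, c.toFun y ∈ G ↔ y.1 ∈ O := fun y => Set.ext_iff.1 hGO y
  have hxG : c.toFun x ∈ G := (hmem ⟨x, hx⟩).2 hxO
  obtain ⟨u₀, hu₀G, hu₀⟩ := mem_closure_iff.1 (c.subset_closure_interior ⟨x, hx, rfl⟩) G hG hxG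
  refine Matrix.eq_one_of_eventually_mulVec_add (u₀ := u₀) (b := b) ?_
  filter_upwards [hG.mem_nhds hu₀G, isOpen_interior.mem_nhds hu₀] with u huG hu
  obtain ⟨y, hy, rfl⟩ := interior_subset hu
  exact hO y ((hmem ⟨y, hy⟩).1 huG)

theorem IntegralAffineAtlas.isCoherent_tangent {n : ℕ} {X : Type u} [TopologicalSpace X]
    (𝓐 : IntegralAffineAtlas n X) : 𝓐.tangent.IsCoherent where
  isOpen_dom c := c.1.domain.isOpen
  exists_trans c d x hc hd := 𝓐.compatible c.1 c.2 d.1 d.2 x ⟨hc, hd⟩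
  trans_self c x A hx hA := AffineChart.IsTransition.eq_one hx hA
  trans_comp c d e x A A' _ _ _ hA hA' := by
    obtain ⟨hA, b, hb⟩ := hA
    obtain ⟨hA', b', hb'⟩ := hA'
    refine ⟨by rw [Matrix.det_mul]; exact hA'.mul hA, A'.map (Int.cast : ℤ → ℝ) *ᵥ b + b', ?_⟩
    filter_upwards [hb, hb'] with y h h'
    have hmul : (A' * A).map (Int.cast : ℤ → ℝ) =
        A'.map (Int.cast : ℤ → ℝ) * A.map (Int.cast : ℤ → ℝ) :=
      Matrix.map_mul (f := Int.castRingHom ℝ)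
    rw [h', h, Matrix.mulVec_add, hmul, ← Matrix.mulVec_mulVec, add_assoc]
  eventually_trans c d x A _ _ hA := by
    obtain ⟨hA, b, hb⟩ := hA
    filter_upwards [eventually_eventually_nhds.2 hb] with y hy
    exact ⟨hA, b, hy⟩

namespace SympleModel

variable {S : SympleModel}

theorem exists_matrix_shear (v v' : ∀ j, Fin (S.a j + 1)) (w : ∀ j, Fin (S.b j + 1)) :
    ∃ A : Matrix S.Coord S.Coord ℤ, ∀ t, A *ᵥ t = S.shear v v' w t := by
  let f : (S.Coord → ℤ) →ₗ[ℤ] (S.Coord → ℤ) :=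
    { toFun := S.shear v v' w
      map_add' := fun t t' => by
        funext q
        rcases q with ⟨j, k | l⟩ | q
        · simp only [shear, Pi.add_apply, add_mul, Finset.sum_add_distrib]
          ring
        · rfl
        · rfl
      map_smul' := fun m t => by
        funext q
        rcases q with ⟨j, k | l⟩ | q
        · simp only [shear, Pi.smul_apply, smul_eq_mul, RingHom.id_apply, mul_assoc,
            ← Finset.mul_sum]
          ring
        · rfl
        · rfl }
  exact ⟨LinearMap.toMatrix' f, fun t => LinearMap.toMatrix'_mulVec f t⟩

/-- A factor in which the two vertices agree contributes nothing, so its chamber label is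
irrelevant. This is why transitions constrain only the other labels. -/
theorem shear_congr {v v' : ∀ j, Fin (S.a j + 1)} {w w' : ∀ j, Fin (S.b j + 1)}
    (h : ∀ j, v j ≠ v' j → w j = w' j) (t : S.Coord → ℤ) : S.shear v v' w t = S.shear v v' w' t := by
  funext q
  rcases q with ⟨j, k | l⟩ | q
  · by_cases hj : v j = v' j
    · simp only [shear, hj, sub_self, mul_zero]
    · simp only [shear, h j hj]
  · rfl
  · rfl

theorem shear_trans (v v' v'' : ∀ j, Fin (S.a j + 1)) (w : ∀ j, Fin (S.b j + 1))
    (t : S.Coord → ℤ) : S.shear v' v'' w (S.shear v v' w t) = S.shear v v'' w t := by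
  funext q
  rcases q with ⟨j, k | l⟩ | q
  · simp only [shear]
    ring
  · rfl
  · rfl

/-- Both sides are linear over `ℚ`, so it suffices to compare them on basis vectors, which are
integral. -/
theorem mulVec_map_eq_ratShear {v v' : ∀ j, Fin (S.a j + 1)} {w : ∀ j, Fin (S.b j + 1)}
    {A : Matrix S.Coord S.Coord ℤ} (hA : ∀ t, A *ᵥ t = S.shear v v' w t) (t : S.Coord → ℚ) :
    A.map (Int.cast : ℤ → ℚ) *ᵥ t = S.ratShear v v' w t := by
  classical
  have hcol : ∀ p q, A p q = S.shear v v' w (Pi.single q 1) p := by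
    intro p q
    rw [← hA, Matrix.mulVec_single_one, Matrix.col_apply]
  have hint : ∀ t : S.Coord → ℤ, (fun p => (S.shear v v' w t p : ℚ)) =
      S.ratShear v v' w fun p => (t p : ℚ) := by
    intro t
    funext p
    rcases p with ⟨j, k | l⟩ | p
    · simp only [shear, ratShear]
      push_cast
      rfl
    · rfl
    · rfl
  let f : (S.Coord → ℚ) →ₗ[ℚ] (S.Coord → ℚ) :=
    { toFun := S.ratShear v v' w
      map_add' := fun t t' => by
        funext q
        rcases q with ⟨j, k | l⟩ | q
        · simp only [ratShear, Pi.add_apply, add_mul, Finset.sum_add_distrib]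
          ring
        · rfl
        · rfl
      map_smul' := fun m t => by
        funext q
        rcases q with ⟨j, k | l⟩ | q
        · simp only [ratShear, Pi.smul_apply, smul_eq_mul, RingHom.id_apply, mul_assoc,
            ← Finset.mul_sum]
          ring
        · rfl
        · rfl }
  have hf : (A.map (Int.cast : ℤ → ℚ)).mulVecLin = f := by
    refine LinearMap.pi_ext' fun q => LinearMap.ext_ring ?_
    have h1 := hint (Pi.single q 1)
    have h2 : (fun p => (((Pi.single q 1 : S.Coord → ℤ) p : ℤ) : ℚ)) = Pi.single q 1 := by
      funext p
      by_cases h : p = q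
      · subst h; simp
      · simp [h]
    rw [h2] at h1
    simp only [LinearMap.comp_apply, LinearMap.single_apply, Matrix.mulVecLin_apply,
      Matrix.mulVec_single_one]
    refine Eq.trans ?_ h1
    funext p
    simp [Matrix.col_apply, hcol]
  exact LinearMap.congr_fun hf t

theorem isCoherent_tangent (S : SympleModel) : S.tangent.IsCoherent where
  isOpen_dom v := by
    have : S.tangent.dom v = ⋂ j, ((fun z : S.Space => (z.1 j).1) ⁻¹' (S.P j).chamber (v j) ∪
        (fun z : S.Space => (z.1 j).2) ⁻¹' (S.Q j).skeletonᶜ) := by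
      ext z; simp [tangent]
    rw [this]
    refine isOpen_iInter_of_finite fun j => ?_
    exact (((S.P j).isOpen_chamber _).preimage (by fun_prop)).union
      ((S.Q j).isOpen_compl_skeleton.preimage (by fun_prop))
  exists_trans v v' z hz hz' := by
    have : ∀ j, ∃ w, v j ≠ v' j → (z.1 j).2 ∈ (S.Q j).chamber w := by
      intro j
      by_cases hy : (z.1 j).2 ∈ (S.Q j).skeleton
      · refine ⟨0, fun hne => (hne ?_).elim⟩
        exact (S.P j).eq_of_mem_chamber ((hz j).resolve_right (not_not.2 hy))
          ((hz' j).resolve_right (not_not.2 hy))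
      · obtain ⟨w, hw⟩ := (S.Q j).notMem_skeleton_iff.1 hy
        exact ⟨w, fun _ => hw⟩
    choose w hw using this
    obtain ⟨A, hA⟩ := S.exists_matrix_shear v v' w
    exact ⟨A, w, hw, hA⟩
  trans_self v z A _ hA := by
    obtain ⟨w, -, hA⟩ := hA
    refine Matrix.mulVec_injective (funext fun t => ?_)
    rw [hA, Matrix.one_mulVec]
    funext q
    rcases q with ⟨j, k | l⟩ | q
    · simp [shear]
    · rfl
    · rfl
  trans_comp v v' v'' z A A' _ _ _ hA hA' := by
    classical
    obtain ⟨w, hw, hA⟩ := hA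
    obtain ⟨w', hw', hA'⟩ := hA'
    -- The labels of the two transitions are merged. Where both are constrained they agree, because
    -- a point lies in at most one chamber.
    let ω : ∀ j, Fin (S.b j + 1) := fun j => if v j ≠ v' j then w j else w' j
    have h1 : ∀ j, v j ≠ v' j → w j = ω j := fun j hj => (if_pos hj).symm
    have h2 : ∀ j, v' j ≠ v'' j → w' j = ω j := by
      intro j hj
      by_cases hj' : v j ≠ v' j
      · rw [← h1 j hj']
        exact (S.Q j).eq_of_mem_chamber (hw' j hj) (hw j hj')
      · exact (if_neg hj').symm
    refine ⟨ω, fun j hj => ?_, fun t => ?_⟩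
    · by_cases hj' : v j ≠ v' j
      · rw [← h1 j hj']
        exact hw j hj'
      · have hj'' : v' j ≠ v'' j := by rwa [← not_not.1 hj']
        rw [← h2 j hj'']
        exact hw' j hj''
    · rw [← Matrix.mulVec_mulVec, hA, hA', shear_congr h1, shear_congr h2]
      exact shear_trans v v' v'' ω t
  eventually_trans v v' z A _ _ hA := by
    obtain ⟨w, hw, hA⟩ := hA
    have h : ∀ j, ∀ᶠ y : S.Space in 𝓝 z, v j ≠ v' j → (y.1 j).2 ∈ (S.Q j).chamber (w j) := by
      intro j
      by_cases hj : v j = v' j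
      · exact Filter.Eventually.of_forall fun y h => (h hj).elim
      · have hc : Continuous fun y : S.Space => (y.1 j).2 := by fun_prop
        exact (hc.continuousAt.eventually (((S.Q j).isOpen_chamber _).mem_nhds (hw j hj))).mono
          fun y hy _ => hy
    filter_upwards [Filter.eventually_all.2 h] with y hy
    exact ⟨w, hy, hA⟩

end SympleModel

/-! ### Transport of sections through a symple chart -/

namespace FrameSystem.IsSection

variable {κ : Type} [Fintype κ] {X Z : Type*} [TopologicalSpace X] [TopologicalSpace Z]
  {F : FrameSystem κ X} {R : Type} [CommRing R]

theorem mono {O O' : Set X} {t : F.Frame → X → κ → R} (ht : F.IsSection R O t)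
    (h : ∀ i, O' ∩ F.dom i ⊆ O) : F.IsSection R O' t where
  locConst i := (ht.locConst i).mono fun _ hx => ⟨h i hx, hx.2⟩
  trans i j x hx hi hj A hA := ht.trans i j x (h i ⟨hx, hi⟩) hi hj A hA

omit [TopologicalSpace X] in
theorem congr_map {a b : Z → X} (e : a = b) {O : Set Z} {t : F.Frame → Z → κ → R}
    (h : (F.pullback a).IsSection R O t) : (F.pullback b).IsSection R O t := by
  subst e; exact h

/-- Extension by zero from an open subset. -/
theorem extend {g : Z → X} (hg : IsOpenEmbedding g) {O : Set Z} {t : F.Frame → Z → κ → R}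
    (ht : (F.pullback g).IsSection R O t) :
    F.IsSection R (g '' O) fun i => Function.extend g (t i) 0 where
  locConst i := by
    rintro _ ⟨⟨z, hz, rfl⟩, hi⟩
    rw [← hg.map_nhds_eq, Filter.eventually_map]
    filter_upwards [ht.locConst i z ⟨hz, hi⟩] with y hy
    rw [hg.injective.extend_apply, hg.injective.extend_apply, hy]
  trans i j := by
    rintro _ ⟨z, hz, rfl⟩ hi hj A hA
    rw [hg.injective.extend_apply, hg.injective.extend_apply]
    exact ht.trans i j z hz hi hj A hA

end FrameSystem.IsSection

/-! ### Doubling a model along its boundary -/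

namespace SympleModel

variable (S : SympleModel)

/-- The double of the model along its boundary. -/
def fold (e : S.RealSpace) : S.Space := (e.1, e.2.1, fun k => Real.nnabs (e.2.2 k))

/-- The inclusion of the model into the vector space. -/
def unfold (z : S.Space) : S.RealSpace := (z.1, z.2.1, fun k => (z.2.2 k : ℝ))

theorem continuous_fold : Continuous S.fold := by
  have h : Continuous Real.nnabs := continuous_real_toNNReal.comp continuous_abs |>.congr fun x => by
    simp
  exact continuous_fst.prodMk (continuous_snd.fst.prodMk
    (continuous_pi fun k => h.comp ((continuous_apply k).comp continuous_snd.snd)))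

theorem continuous_unfold : Continuous S.unfold := by
  unfold SympleModel.unfold
  fun_prop

variable {S}

theorem fold_unfold (z : S.Space) : S.fold (S.unfold z) = z := by
  refine Prod.ext rfl (Prod.ext rfl (funext fun k => NNReal.eq ?_))
  simp [fold, unfold]

theorem fold_mem_ball {e : S.RealSpace} {z : S.Space} {ε : ℝ}
    (h : e ∈ Metric.ball (S.unfold z) ε) : S.fold e ∈ Metric.ball z ε := by
  have hε : 0 < ε := dist_nonneg.trans_lt h
  rw [Metric.mem_ball, Prod.dist_eq, Prod.dist_eq, max_lt_iff, max_lt_iff,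
    dist_pi_lt_iff (g := (S.unfold z).2.2) hε] at h
  rw [Metric.mem_ball, Prod.dist_eq, Prod.dist_eq, max_lt_iff, max_lt_iff,
    dist_pi_lt_iff (g := z.2.2) hε]
  refine ⟨h.1, h.2.1, fun k => ?_⟩
  have h1 := h.2.2 k
  have h2 := abs_abs_sub_abs_le (e.2.2 k) (z.2.2 k)
  rw [NNReal.abs_eq] at h2
  rw [NNReal.dist_eq]
  rw [Real.dist_eq] at h1
  simp only [fold, Real.coe_nnabs]
  exact h2.trans_lt h1

theorem unfold_mem_ball {z p : S.Space} {ε : ℝ} (h : z ∈ Metric.ball p ε) :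
    S.unfold z ∈ Metric.ball (S.unfold p) ε := by
  have hε : 0 < ε := dist_nonneg.trans_lt h
  rw [Metric.mem_ball, Prod.dist_eq, Prod.dist_eq, max_lt_iff, max_lt_iff,
    dist_pi_lt_iff (g := p.2.2) hε] at h
  rw [Metric.mem_ball, Prod.dist_eq, Prod.dist_eq, max_lt_iff, max_lt_iff,
    dist_pi_lt_iff (g := (S.unfold p).2.2) hε]
  exact h

/-- A nonzero boundary coordinate is at least `ε`, so the ball excludes its mirror image. Hence the
double has only one point in the ball over the centre, and puncturing commutes with folding. -/
theorem eq_unfold_of_fold_eq {e : S.RealSpace} {z : S.Space} {ε : ℝ}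
    (hε : ∀ k, z.2.2 k ≠ 0 → ε ≤ z.2.2 k) (h : e ∈ Metric.ball (S.unfold z) ε)
    (he : S.fold e = z) : e = S.unfold z := by
  have hε0 : 0 < ε := dist_nonneg.trans_lt h
  rw [Metric.mem_ball, Prod.dist_eq, Prod.dist_eq, max_lt_iff, max_lt_iff,
    dist_pi_lt_iff (g := (S.unfold z).2.2) hε0] at h
  have h5 : (S.fold e).1 = z.1 := by rw [he]
  have h6 : (S.fold e).2.1 = z.2.1 := by rw [he]
  refine Prod.ext h5 (Prod.ext h6 (funext fun k => ?_))
  have h1 : |e.2.2 k| = z.2.2 k := by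
    have := congrArg (fun z : S.Space => (z.2.2 k : ℝ)) he
    simpa [fold] using this
  have h2 : |e.2.2 k - z.2.2 k| < ε := h.2.2 k
  change e.2.2 k = z.2.2 k
  by_cases h0 : z.2.2 k = 0
  · rw [h0] at h1 ⊢
    simpa using h1
  · have h3 := hε k h0
    rcases abs_cases (e.2.2 k) with h4 | h4
    · linarith [h4.1]
    · have := neg_abs_le (e.2.2 k - z.2.2 k)
      have := (z.2.2 k).2
      linarith [h4.1]

theorem isModelSection_iff {O : Set S.RealSpace}
    {s : (∀ j, Fin (S.a j + 1)) → S.RealSpace → S.Coord → ℚ} :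
    S.IsModelSection O s ↔ (S.tangent.pullback S.fold).IsSection ℚ O s := by
  constructor
  · intro h
    refine ⟨h.locConst, ?_⟩
    rintro v v' z hz hv hv' A ⟨w, hw, hA⟩
    rw [mulVec_map_eq_ratShear hA]
    exact h.eq_ratShear v v' w z hz hv hv' hw
  · intro h
    refine ⟨h.locConst, fun v v' w z hz hv hv' hw => ?_⟩
    obtain ⟨A, hA⟩ := exists_matrix_shear v v' w
    rw [← mulVec_map_eq_ratShear hA]
    exact h.trans v v' z hz hv hv' A ⟨w, hw, hA⟩

theorem fold_mem_disc_iff {e : S.RealSpace} : S.fold e ∉ S.disc ↔ e ∈ S.regular := by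
  simp only [disc, regular, Set.mem_ofPred_eq, not_exists, not_and_or]
  rfl

end SympleModel

/-! ### Transfer between the atlas and the doubled model -/

namespace SympleChart

variable {n : ℕ} {B : Type u} [TopologicalSpace B] {M : IntegralAffineSing n B} (φ : SympleChart M)

/-- The regular points of the domain of a symple chart. -/
abbrev Regular : Type u := {x : B // x ∈ φ.toHomeo.source ∧ x ∈ M.discᶜ}

/-- The inclusion into the complement of the discriminant. -/
def toCompl (z : φ.Regular) : ↥M.discᶜ := ⟨z.1, z.2.2⟩

/-- The chart on the regular points. -/
def toModel (z : φ.Regular) : φ.model.Space := φ.toHomeo z.1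

/-- The regular points of the double of the image of the chart. -/
def doubleRegular : Set φ.model.RealSpace :=
  {e | φ.model.fold e ∈ φ.toHomeo.target ∧ φ.toHomeo.symm (φ.model.fold e) ∈ M.discᶜ}

/-- The inverse of the chart, on the double. -/
def ofDouble (e : φ.doubleRegular) : φ.Regular :=
  ⟨φ.toHomeo.symm (φ.model.fold e.1), φ.toHomeo.map_target e.2.1, e.2.2⟩

theorem isOpenEmbedding_toCompl : IsOpenEmbedding φ.toCompl := by
  have h : IsEmbedding φ.toCompl :=
    IsEmbedding.of_comp (continuous_subtype_val.subtype_mk _) continuous_subtype_val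
      IsEmbedding.subtypeVal
  refine ⟨h, ?_⟩
  have : Set.range φ.toCompl = Subtype.val ⁻¹' φ.toHomeo.source := by
    ext x
    exact ⟨by rintro ⟨z, rfl⟩; exact z.2.1, fun hx => ⟨⟨x.1, hx, x.2⟩, rfl⟩⟩
  rw [this]
  exact φ.toHomeo.open_source.preimage continuous_subtype_val

theorem continuous_toModel : Continuous φ.toModel := by
  rw [continuous_iff_continuousAt]
  intro z
  exact (φ.toHomeo.continuousAt z.2.1).comp continuous_subtype_val.continuousAt

theorem continuousOn_symm_fold :
    ContinuousOn (fun e => φ.toHomeo.symm (φ.model.fold e)) (φ.model.fold ⁻¹' φ.toHomeo.target) :=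
  φ.toHomeo.continuousOn_symm.comp φ.model.continuous_fold.continuousOn fun _ h => h

/-- The preimage of an open set in the double of the image of the chart. -/
def doublePreimage (W : Set B) : Set φ.model.RealSpace :=
  {e | φ.model.fold e ∈ φ.toHomeo.target ∧ φ.toHomeo.symm (φ.model.fold e) ∈ W}

theorem isOpen_doublePreimage {W : Set B} (hW : IsOpen W) : IsOpen (φ.doublePreimage W) :=
  (φ.toHomeo.isOpen_inter_preimage_symm hW).preimage φ.model.continuous_fold

theorem isOpen_doubleRegular : IsOpen φ.doubleRegular :=
  φ.isOpen_doublePreimage M.isClosed_disc.isOpen_compl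

theorem continuous_ofDouble : Continuous φ.ofDouble :=
  Continuous.subtype_mk (continuousOn_iff_continuous_domRestrict.1
    (φ.continuousOn_symm_fold.mono fun _ h => h.1)) _

theorem toModel_ofDouble :
    φ.toModel ∘ φ.ofDouble = φ.model.fold ∘ (Subtype.val : φ.doubleRegular → _) :=
  funext fun e => φ.toHomeo.right_inv e.2.1

theorem toModel_notMem_disc (z : φ.Regular) : φ.toModel z ∉ φ.model.disc :=
  fun h => z.2.2 ((φ.mem_disc_iff z.1 z.2.1).2 h)

theorem exists_chart (z : φ.Regular) : ∃ c, z ∈ (M.atlas.tangent.pullback φ.toCompl).dom c := by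
  obtain ⟨c, hc, hz⟩ := M.atlas.cover (φ.toCompl z)
  exact ⟨⟨c, hc⟩, hz⟩

theorem exists_frame (z : φ.Regular) : ∃ v, z ∈ (φ.model.tangent.pullback φ.toModel).dom v := by
  have h : φ.model.unfold (φ.toModel z) ∈ φ.model.regular := by
    rw [← SympleModel.fold_mem_disc_iff, SympleModel.fold_unfold]
    exact φ.toModel_notMem_disc z
  exact SympleModel.exists_realDom h

theorem isCoherent_chart : (M.atlas.tangent.pullback φ.toCompl).IsCoherent :=
  M.atlas.isCoherent_tangent.pullback φ.isOpenEmbedding_toCompl.continuous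

theorem isCoherent_model : (φ.model.tangent.pullback φ.toModel).IsCoherent :=
  φ.model.isCoherent_tangent.pullback φ.continuous_toModel

variable {φ}

theorem mem_doubleRegular {e : φ.model.RealSpace} (h : φ.model.fold e ∈ φ.toHomeo.target)
    (he : e ∈ φ.model.regular) : e ∈ φ.doubleRegular := by
  refine ⟨h, fun hd => SympleModel.fold_mem_disc_iff.2 he ?_⟩
  have := (φ.mem_disc_iff _ (φ.toHomeo.map_target h)).1 hd
  rwa [φ.toHomeo.right_inv h] at this

/-- Sections in the charts of the atlas give sections of the model. -/
theorem exists_isModelSection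
    {D : M.atlas.charts → (∀ j, Fin (φ.model.a j + 1)) → φ.Regular →
      Matrix φ.model.Coord (Fin n) ℤ}
    (hD : ∀ c v, LocConstOn (D c v) ((M.atlas.tangent.pullback φ.toCompl).dom c ∩
      (φ.model.tangent.pullback φ.toModel).dom v))
    (hD1 : ∀ c c' v, ∀ z ∈ (M.atlas.tangent.pullback φ.toCompl).dom c,
      z ∈ (M.atlas.tangent.pullback φ.toCompl).dom c' →
      z ∈ (φ.model.tangent.pullback φ.toModel).dom v →
      ∀ A, (M.atlas.tangent.pullback φ.toCompl).Trans c c' z A → D c' v z * A = D c v z)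
    (hD2 : ∀ c v v', ∀ z ∈ (M.atlas.tangent.pullback φ.toCompl).dom c,
      z ∈ (φ.model.tangent.pullback φ.toModel).dom v →
      z ∈ (φ.model.tangent.pullback φ.toModel).dom v' →
      ∀ A, (φ.model.tangent.pullback φ.toModel).Trans v v' z A → A * D c v z = D c v' z)
    {W : Set B} (hW : IsOpen W) {t : M.atlas.charts → ↥M.discᶜ → Fin n → ℚ}
    (ht : M.atlas.tangent.IsSection ℚ (Subtype.val ⁻¹' W) t) :
    ∃ s, φ.model.IsModelSection (φ.doublePreimage W) s ∧
      ∀ (e : φ.model.RealSpace) (z : φ.Regular), φ.toModel z = φ.model.fold e → z.1 ∈ W →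
        ∀ v, e ∈ φ.model.realDom v → ∀ c : M.atlas.charts, φ.toCompl z ∈ c.1.domain →
          s v e = (D c v z).map (Int.cast : ℤ → ℚ) *ᵥ t c (φ.toCompl z) := by
  have ho := φ.isOpenEmbedding_toCompl.continuous
  obtain ⟨t', ht', hval⟩ := (ht.pullback ho).exists_transfer φ.isCoherent_chart
    φ.isCoherent_model.isOpen_dom φ.exists_chart hD hD1 hD2
    ((hW.preimage continuous_subtype_val).preimage ho)
  have h1 : (φ.model.tangent.pullback (φ.toModel ∘ φ.ofDouble)).IsSection ℚ _ _ :=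
    ht'.pullback φ.continuous_ofDouble
  have h2 : ((φ.model.tangent.pullback φ.model.fold).pullback
      (Subtype.val : φ.doubleRegular → _)).IsSection ℚ _ _ := h1.congr_map φ.toModel_ofDouble
  -- The zero values outside the regular points are harmless, since all frame domains lie in the
  -- regular locus.
  have h3 := h2.extend φ.isOpen_doubleRegular.isOpenEmbedding_subtypeVal
  refine ⟨_, SympleModel.isModelSection_iff.2 (h3.mono ?_), ?_⟩
  · rintro v e ⟨⟨he, heW⟩, hv⟩
    exact ⟨⟨e, mem_doubleRegular he (SympleModel.realDom_subset_regular v hv)⟩, heW, rfl⟩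
  · intro e z hz hzW v hv c hc
    have he : e ∈ φ.doubleRegular := mem_doubleRegular (hz ▸ φ.toHomeo.map_source z.2.1)
      (SympleModel.realDom_subset_regular v hv)
    have hze : φ.ofDouble ⟨e, he⟩ = z := by
      refine Subtype.ext ?_
      change φ.toHomeo.symm (φ.model.fold e) = z.1
      rw [← hz]
      exact φ.toHomeo.left_inv z.2.1
    have h4 : Function.extend Subtype.val (fun e : φ.doubleRegular => t' v (φ.ofDouble e)) 0 e =
        t' v (φ.ofDouble ⟨e, he⟩) :=
      Subtype.val_injective.extend_apply (f := (Subtype.val : φ.doubleRegular → _)) _ _ ⟨e, he⟩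
    refine h4.trans ?_
    rw [hze]
    refine hval c v z hzW hc ?_
    change φ.toModel z ∈ φ.model.tangent.dom v
    rw [hz]
    exact hv

/-- Sections of the model give sections in the charts of the atlas. -/
theorem exists_isSection_of_isModelSection
    {D : (∀ j, Fin (φ.model.a j + 1)) → M.atlas.charts → φ.Regular →
      Matrix (Fin n) φ.model.Coord ℤ}
    (hD : ∀ v c, LocConstOn (D v c) ((φ.model.tangent.pullback φ.toModel).dom v ∩
      (M.atlas.tangent.pullback φ.toCompl).dom c))
    (hD1 : ∀ v v' c, ∀ z ∈ (φ.model.tangent.pullback φ.toModel).dom v,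
      z ∈ (φ.model.tangent.pullback φ.toModel).dom v' →
      z ∈ (M.atlas.tangent.pullback φ.toCompl).dom c →
      ∀ A, (φ.model.tangent.pullback φ.toModel).Trans v v' z A → D v' c z * A = D v c z)
    (hD2 : ∀ v c c', ∀ z ∈ (φ.model.tangent.pullback φ.toModel).dom v,
      z ∈ (M.atlas.tangent.pullback φ.toCompl).dom c →
      z ∈ (M.atlas.tangent.pullback φ.toCompl).dom c' →
      ∀ A, (M.atlas.tangent.pullback φ.toCompl).Trans c c' z A → A * D v c z = D v c' z)
    {O : Set φ.model.RealSpace} (hO : IsOpen O)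
    {s : (∀ j, Fin (φ.model.a j + 1)) → φ.model.RealSpace → φ.model.Coord → ℚ}
    (hs : φ.model.IsModelSection O s) :
    ∃ t, M.atlas.tangent.IsSection ℚ (φ.toCompl '' {z | φ.model.unfold (φ.toModel z) ∈ O}) t ∧
      ∀ z : φ.Regular, φ.model.unfold (φ.toModel z) ∈ O →
        ∀ v, φ.toModel z ∈ φ.model.tangent.dom v →
        ∀ c : M.atlas.charts, φ.toCompl z ∈ c.1.domain →
          t c (φ.toCompl z) =
            (D v c z).map (Int.cast : ℤ → ℚ) *ᵥ s v (φ.model.unfold (φ.toModel z)) := by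
  have hc : Continuous (φ.model.unfold ∘ φ.toModel) :=
    φ.model.continuous_unfold.comp φ.continuous_toModel
  have e : φ.model.fold ∘ (φ.model.unfold ∘ φ.toModel) = φ.toModel :=
    funext fun z => SympleModel.fold_unfold _
  have h1 : (φ.model.tangent.pullback (φ.model.fold ∘ (φ.model.unfold ∘ φ.toModel))).IsSection ℚ
      _ _ := (SympleModel.isModelSection_iff.1 hs).pullback hc
  obtain ⟨t', ht', hval⟩ := (h1.congr_map e).exists_transfer φ.isCoherent_model
    φ.isCoherent_chart.isOpen_dom φ.exists_frame hD hD1 hD2 (hO.preimage hc)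
  refine ⟨_, ht'.extend φ.isOpenEmbedding_toCompl, fun z hz v hv c hc => ?_⟩
  refine (φ.isOpenEmbedding_toCompl.injective.extend_apply (t' c) 0 z).trans ?_
  exact hval v c z hz hv hc

end SympleChart

/-! ### Vanishing on small punctured balls -/

namespace SympleChart

variable {n : ℕ} {B : Type u} [TopologicalSpace B] {M : IntegralAffineSing n B} (φ : SympleChart M)

/-- The conditions on the radius under which the cohomology of the punctured ball vanishes. -/
structure IsGoodRadius (p : B) (ε : ℝ) : Prop where
  pos : 0 < ε
  ball_subset : Metric.ball (φ.toHomeo p) ε ⊆ φ.toHomeo.target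
  le_coord : ∀ k, (φ.toHomeo p).2.2 k ≠ 0 → ε ≤ (φ.toHomeo p).2.2 k
  isSmallBall : ∀ j, IsSmallBall (φ.model.P j) (φ.model.Q j) (φ.model.xMap j) (φ.model.yMap j)
    (φ.model.unfold (φ.toHomeo p)) ε

theorem eventually_isGoodRadius {p : B} (hp : p ∈ φ.toHomeo.source) :
    ∀ᶠ ε in 𝓝[>] (0 : ℝ), φ.IsGoodRadius p ε := by
  have h1 := eventually_ball (φ.toHomeo.open_target.mem_nhds (φ.toHomeo.map_source hp))
  have h2 : ∀ᶠ ε : ℝ in 𝓝[>] (0 : ℝ),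
      ∀ k, (φ.toHomeo p).2.2 k ≠ 0 → ε ≤ (φ.toHomeo p).2.2 k := by
    refine Filter.eventually_all.2 fun k => ?_
    by_cases h : (φ.toHomeo p).2.2 k = 0
    · exact Filter.Eventually.of_forall fun _ h' => (h' h).elim
    · have h0 : (0 : ℝ) < (φ.toHomeo p).2.2 k := NNReal.coe_pos.2 (pos_iff_ne_zero.2 h)
      filter_upwards [Ioo_mem_nhdsGT h0] with ε hε _ using hε.2.le
  have h3 := Filter.eventually_all.2 fun j => eventually_isSmallBall (φ.model.P j) (φ.model.Q j)
    (φ.model.xMap j) (φ.model.yMap j) (φ.model.unfold (φ.toHomeo p))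
  filter_upwards [h1, h2, h3, self_mem_nhdsWithin] with ε h1 h2 h3 h0
  exact ⟨h0, h1, h2, h3⟩

theorem exists_isGoodRadius_ball_subset {p : B} (hp : p ∈ φ.toHomeo.source) {N : Set B}
    (hN : N ∈ 𝓝 p) : ∃ ε, φ.IsGoodRadius p ε ∧ (φ.ball p ε : Set B) ⊆ N := by
  have h : ∀ᶠ z in 𝓝 (φ.toHomeo p), φ.toHomeo.symm z ∈ N := by
    have := φ.toHomeo.symm.continuousAt (φ.toHomeo.map_source hp)
    rw [ContinuousAt, φ.toHomeo.left_inv hp] at this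
    exact this hN
  obtain ⟨ε, h1, h2⟩ := ((φ.eventually_isGoodRadius hp).and (eventually_ball h)).exists
  refine ⟨ε, h1, ?_⟩
  rintro x ⟨hx, hxb⟩
  simpa [φ.toHomeo.left_inv hx] using h2 _ hxb

/-- By density of the complement, the chart contains a regular point. There the two local systems
are related by mutually inverse matrices, so their ranks agree. -/
theorem card_coord {D : M.atlas.charts → (∀ j, Fin (φ.model.a j + 1)) → φ.Regular →
      Matrix φ.model.Coord (Fin n) ℤ}
    {E : (∀ j, Fin (φ.model.a j + 1)) → M.atlas.charts → φ.Regular →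
      Matrix (Fin n) φ.model.Coord ℤ}
    (h : ∀ c v, ∀ z ∈ (M.atlas.tangent.pullback φ.toCompl).dom c,
      z ∈ (φ.model.tangent.pullback φ.toModel).dom v → E v c z * D c v z = 1 ∧ D c v z * E v c z = 1)
    {p : B} (hp : p ∈ φ.toHomeo.source) : Fintype.card φ.model.Coord = n := by
  obtain ⟨x, hx, hxd⟩ := M.dense_compl.inter_open_nonempty _ φ.toHomeo.open_source ⟨p, hp⟩
  obtain ⟨c, hc⟩ := φ.exists_chart ⟨x, hx, hxd⟩
  obtain ⟨v, hv⟩ := φ.exists_frame ⟨x, hx, hxd⟩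
  obtain ⟨h1, h2⟩ := h c v _ hc hv
  have := Matrix.square_of_invertible _ _ h2 h1
  simpa using this

variable {φ}

/-- A Čech cocycle is carried to the doubled model by the matrices `D`, solved there by
`SympleModel.cech`, and carried back by the inverse matrices `E` along `unfold`, a right inverse of
`fold`. -/
theorem IsGoodRadius.subsingleton_H1 [T1Space B] (hn : 3 ≤ n) {p : B}
    (hp : p ∈ φ.toHomeo.source) {ε : ℝ} (hε : φ.IsGoodRadius p ε) :
    Subsingleton (M.H1 (puncture (φ.ball p ε) p)) := by
  obtain ⟨D, E, hD, hE, hD1, hD2, hE1, hE2, hDE⟩ :=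
    φ.iso.exists_matrices φ.isCoherent_chart φ.isCoherent_model
  have hcard : 3 ≤ Fintype.card φ.model.Coord := by rwa [φ.card_coord hDE hp]
  refine TopCat.Sheaf.subsingleton_H'_one_of_cech M.pushforwardTangentRat
    (show Opens (TopCat.of B) from puncture (φ.ball p ε) p) fun U hUV hU f hf => ?_
  have hdom : ∀ c, IsOpen (M.atlas.tangent.dom c) := M.atlas.isCoherent_tangent.isOpen_dom
  let reg : Opens B → Opens ↥M.discᶜ := fun W =>
    ⟨Subtype.val ⁻¹' (W : Set B), W.isOpen.preimage continuous_subtype_val⟩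
  let s : ∀ i k, M.atlas.tangent.sections ℚ (reg (U i ⊓ U k)) := fun i k => f i k
  have hs : ∀ i k l (x : ↥M.discᶜ) (hx : x.1 ∈ U i ⊓ U k ⊓ U l) (c : M.atlas.charts)
      (hc : x ∈ c.1.domain), (s i k).1 ⟨x, hx.1⟩ ⟨c, hc⟩ + (s k l).1 ⟨x, hx.1.2, hx.2⟩ ⟨c, hc⟩ =
        (s i l).1 ⟨x, hx.1.1, hx.2⟩ ⟨c, hc⟩ := by
    intro i k l x hx c hc
    have h : M.atlas.tangent.res ℚ (V := reg (U i ⊓ U k)) (W := reg (U i ⊓ U k ⊓ U l))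
        (fun y hy => hy.1) (s i k) + M.atlas.tangent.res ℚ (V := reg (U k ⊓ U l))
        (W := reg (U i ⊓ U k ⊓ U l)) (fun y hy => ⟨hy.1.2, hy.2⟩) (s k l) =
        M.atlas.tangent.res ℚ (V := reg (U i ⊓ U l)) (W := reg (U i ⊓ U k ⊓ U l))
        (fun y hy => ⟨hy.1.1, hy.2⟩) (s i l) := hf i k l
    exact congrFun (congrFun (congrArg Subtype.val h) ⟨x, hx⟩) ⟨c, hc⟩
  choose t ht hst using fun i k => FrameSystem.exists_isSection hdom (s i k)
  have hcoc : ∀ i k l (x : ↥M.discᶜ), x.1 ∈ U i ⊓ U k ⊓ U l → ∀ c : M.atlas.charts,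
      x ∈ c.1.domain → t i k c x + t k l c x = t i l c x := by
    intro i k l x hx c hc
    have h1 := hst i k ⟨x, hx.1⟩ c hc
    have h2 := hst k l ⟨x, hx.1.2, hx.2⟩ c hc
    have h3 := hst i l ⟨x, hx.1.1, hx.2⟩ c hc
    exact (congrArg₂ (· + ·) h1 h2).symm.trans ((hs i k l x hx c hc).trans h3)
  choose g hg hgval using fun i k =>
    exists_isModelSection hD hD1 hD2 (U i ⊓ U k).isOpen (ht i k)
  set q := φ.model.unfold (φ.toHomeo p) with hq
  -- Folding maps the punctured ball of the double into the punctured ball of `B`, so the preimages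
  -- of the covering still cover.
  have hpre : ∀ e ∈ Metric.ball q ε \ {q}, ∃ i, e ∈ φ.doublePreimage (U i) := by
    rintro e ⟨he, hne⟩
    have h1 := SympleModel.fold_mem_ball he
    have h2 := hε.ball_subset h1
    have h3 : φ.toHomeo.symm (φ.model.fold e) ∈ puncture (φ.ball p ε) p := by
      refine ⟨⟨φ.toHomeo.map_target h2, ?_⟩, fun h4 => hne ?_⟩
      · rwa [Set.mem_preimage, φ.toHomeo.right_inv h2]
      · refine SympleModel.eq_unfold_of_fold_eq hε.le_coord he ?_
        rw [← Set.mem_singleton_iff.1 h4, φ.toHomeo.right_inv h2]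
    exact ⟨⟨_, h3⟩, h2, hU ⟨_, h3⟩⟩
  obtain ⟨h, hh, hgh⟩ := SympleModel.cech hcard hε.pos hε.isSmallBall
    (fun i => φ.doublePreimage (U i)) (fun i => φ.isOpen_doublePreimage (U i).isOpen)
    (fun e he => Set.mem_iUnion.2 (hpre e he)) g
    (fun i k => SympleModel.isModelSection_iff.2
      ((SympleModel.isModelSection_iff.1 (hg i k)).mono
        fun v e he => ⟨he.1.1.1.1, he.1.1.1.2, he.1.1.2.2⟩))
    (by
      rintro i k l v e ⟨hv, -⟩ hi hk hl
      have he := mem_doubleRegular hi.1 (SympleModel.realDom_subset_regular v hv)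
      have hz : φ.toModel (φ.ofDouble ⟨e, he⟩) = φ.model.fold e :=
        congrFun φ.toModel_ofDouble ⟨e, he⟩
      obtain ⟨c, hc⟩ := φ.exists_chart (φ.ofDouble ⟨e, he⟩)
      rw [hgval i k e _ hz ⟨hi.2, hk.2⟩ v hv c hc, hgval k l e _ hz ⟨hk.2, hl.2⟩ v hv c hc,
        hgval i l e _ hz ⟨hi.2, hl.2⟩ v hv c hc, ← Matrix.mulVec_add]
      exact congrArg _ (hcoc i k l (φ.toCompl (φ.ofDouble ⟨e, he⟩)) ⟨⟨hi.2, hk.2⟩, hl.2⟩ c hc))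
  have hopen : ∀ i, IsOpen (φ.doublePreimage (U i) ∩ (Metric.ball q ε \ {q})) := fun i =>
    (φ.isOpen_doublePreimage (U i).isOpen).inter (Metric.isOpen_ball.sdiff isClosed_singleton)
  choose t' ht' htval using fun i =>
    exists_isSection_of_isModelSection hE hE1 hE2 (hopen i) (hh i)
  have hmem : ∀ i (z : φ.Regular), z.1 ∈ U i →
      φ.model.unfold (φ.toModel z) ∈ φ.doublePreimage (U i) ∩ (Metric.ball q ε \ {q}) := by
    intro i z hz
    obtain ⟨hzb, hzp⟩ := hUV i hz
    refine ⟨?_, SympleModel.unfold_mem_ball hzb.2, fun h => hzp ?_⟩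
    · refine ⟨?_, ?_⟩
      · rw [SympleModel.fold_unfold]
        exact φ.toHomeo.map_source z.2.1
      · rw [SympleModel.fold_unfold, toModel, φ.toHomeo.left_inv z.2.1]
        exact hz
    · have := congrArg φ.model.fold (Set.mem_singleton_iff.1 h)
      rw [hq, SympleModel.fold_unfold, SympleModel.fold_unfold] at this
      exact φ.toHomeo.injOn z.2.1 hp this
  have hreg : ∀ i (x : ↥M.discᶜ), x.1 ∈ U i → x.1 ∈ φ.toHomeo.source := fun i x hx =>
    (hUV i hx).1.1
  let r : ∀ i, M.atlas.tangent.sections ℚ (reg (U i)) := fun i =>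
    ⟨_, (ht' i).mem_sections (V := reg (U i)) fun x hx =>
      ⟨⟨x.1, hreg i x hx, x.2⟩, hmem i ⟨x.1, hreg i x hx, x.2⟩ hx, rfl⟩⟩
  refine ⟨fun i => r i, fun i k => ?_⟩
  have hfin : s i k = M.atlas.tangent.res ℚ (V := reg (U k)) (W := reg (U i ⊓ U k))
      (fun y hy => hy.2) (r k) - M.atlas.tangent.res ℚ (V := reg (U i)) (W := reg (U i ⊓ U k))
      (fun y hy => hy.1) (r i) := by
    refine Subtype.ext (funext fun x => funext fun c => ?_)
    let z : φ.Regular := ⟨x.1.1, hreg i x.1 x.2.1, x.1.2⟩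
    obtain ⟨v, hv⟩ := φ.exists_frame z
    have hzi := hmem i z x.2.1
    have hzk := hmem k z x.2.2
    have h1 := htval i z hzi v hv c.1 c.2
    have h2 := htval k z hzk v hv c.1 c.2
    have h3 := hgval i k (φ.model.unfold (φ.toModel z)) z (SympleModel.fold_unfold _).symm x.2 v
      hv c.1 c.2
    have h4 := hgh i k v _ ⟨hv, hzi.2⟩ hzi.1 hzk.1
    -- The two transports cancel, so the coboundary identity in the model returns as one for the
    -- original cocycle.
    have h5 : (E v c.1 z).map (Int.cast : ℤ → ℚ) * (D c.1 v z).map (Int.cast : ℤ → ℚ) = 1 := by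
      have h6 : (E v c.1 z * D c.1 v z).map (Int.cast : ℤ → ℚ) =
          (E v c.1 z).map (Int.cast : ℤ → ℚ) * (D c.1 v z).map (Int.cast : ℤ → ℚ) :=
        Matrix.map_mul (f := Int.castRingHom ℚ)
      rw [← h6, (hDE c.1 v z c.2 hv).1]
      exact Matrix.map_one _ Int.cast_zero Int.cast_one
    calc (s i k).1 x c = t i k c.1 x.1 := hst i k x c.1 c.2
      _ = (E v c.1 z).map (Int.cast : ℤ → ℚ) *ᵥ
          ((D c.1 v z).map (Int.cast : ℤ → ℚ) *ᵥ t i k c.1 (φ.toCompl z)) := by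
        rw [Matrix.mulVec_mulVec, h5, Matrix.one_mulVec]; rfl
      _ = t' k c.1 (φ.toCompl z) - t' i c.1 (φ.toCompl z) := by
        rw [← h3, h4, Matrix.mulVec_sub, ← h1, ← h2]
  exact hfin

end SympleChart

theorem theorem2p1 {n : ℕ} (hn : 3 ≤ n) {B : Type u} [TopologicalSpace B] [T2Space B]
    (M : IntegralAffineSing n B) (hM : M.IsSymple) (p : B) :
    (∀ N ∈ 𝓝 p, ∃ U : Opens B, p ∈ U ∧ (U : Set B) ⊆ N ∧ Subsingleton (M.H1 (puncture U p))) ∧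
    ∀ φ : SympleChart M, p ∈ φ.toHomeo.source →
      ∀ᶠ ε in 𝓝[>] (0 : ℝ), Subsingleton (M.H1 (puncture (φ.ball p ε) p)) := by
  constructor
  · intro N hN
    obtain ⟨φ, hφ⟩ := hM p
    obtain ⟨ε, hε, hεN⟩ := φ.exists_isGoodRadius_ball_subset hφ hN
    exact ⟨φ.ball p ε, ⟨hφ, Metric.mem_ball_self hε.pos⟩, hεN, hε.subsingleton_H1 hn hφ⟩
  · intro φ hφ
    filter_upwards [φ.eventually_isGoodRadius hφ] with ε hε using hε.subsingleton_H1 hn hφ
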